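/- Let $p$ be a prime, $\mathfrak g=\mathfrak{gl}_2(\mathbb Q_p)$ with universal enveloping algebra $U(\mathfrak g)$, and let $e=\begin{pmatrix}0&1\\0&0\end{pmatrix}$, $h_1=\begin{pmatrix}1&0\\0&0\end{pmatrix}$, $h_2=\begin{pmatrix}0&0\\0&1\end{pmatrix}$, $f=\begin{pmatrix}0&0\\1&0\end{pmatrix}$. For $m,n\in\mathbb N$ put $q^{(m)}_n=\lfloor n/p^m\rfloor$, and let $U(\mathfrak g_{\mathbb Z_p})^{(m)}\subset U(\mathfrak g)$ be the $\mathbb Z_p$-submodule generated by the elements $$q^{(m)}_{\nu_1}!\,\frac{e^{\nu_1}}{\nu_1!}\cdot q^{(m)}_{\nu_2}!\binom{h_1}{\nu_2}\cdot q^{(m)}_{\nu_3}!\binom{h_2}{\nu_3}\cdot q^{(m)}_{\nu_4}!\,\frac{f^{\nu_4}}{\nu_4!},\qquad \nu\in\mathbb N^4,$$ where $\binom{h}{\nu}=\frac{h(h-1)\cdots(h-\nu+1)}{\nu!}$. It is a $\mathbb Z_p$-subalgebra of $U(\mathfrak g)$, and $U(\mathfrak g_{\mathbb Z_p})^{(m)}\subset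 U(\mathfrak g_{\mathbb Z_p})^{(m+1)}$. Let $\widehat U(\mathfrak g_{\mathbb Z_p})^{(m)}$ be its $p$-adic completion, with the $p$-adic topology, and $\widehat U(\mathfrak g_{\mathbb Z_p})^{(m)}_{\mathbb Q}=\widehat U(\mathfrak g_{\mathbb Z_p})^{(m)}\otimes_{\mathbb Z}\mathbb Q$, with the Banach space topology in which the image of $\widehat U(\mathfrak g_{\mathbb Z_p})^{(m)}$ is a bounded open lattice. Let $\mathbb G(0)^\circ$ be the wide open rigid-analytic group over $\mathbb Q_p$ with $\mathbb G(0)^\circ(\mathbb C_p)=1+M_2(\mathfrak m_{\mathbb C_p})$. In the coordinates $z_{ij}=g_{ij}-\delta_{ij}$, the space $\mathcal O(\mathbb G(0)^\circ)$ of its rigid-analytic functions consists of the power series $\sum_\mu\xi_\mu z^\mu$ over $\mathbb Q_p$ with $|\xi_\mu|r^{|\mu|}\to0$ for all $0<r<1$; it is a Fréchet space for the norms $\sup_\mu|\xi_\mu|r^{|\mu|}$, $0<r<1$. Let $\mathcal D^{\rm an}(\mathbb G(0)^\circ)=\mathcal O(\mathbb G(0)^\circ)'_b$ be its continuous dual with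 the strong topology; convolution, i.e. the product dual to the group law of $\mathbb G(0)^\circ$, makes it a topological $\mathbb Q_p$-algebra. There is a unique homomorphism of $\mathbb Q_p$-algebras $\theta:U(\mathfrak g)\to\mathcal D^{\rm an}(\mathbb G(0)^\circ)$ which sends each $X\in\mathfrak g$ to the linear form $F\mapsto\frac{d}{dt}F(e^{tX})\big|_{t=0}$. For every $m$, the restriction of $\theta$ to $U(\mathfrak g_{\mathbb Z_p})^{(m)}$ extends uniquely to a continuous homomorphism of $\mathbb Z_p$-algebras $\theta_m:\widehat U(\mathfrak g_{\mathbb Z_p})^{(m)}\to\mathcal D^{\rm an}(\mathbb G(0)^\circ)$, and the $\theta_m$ induce an isomorphism of topological $\mathbb Q_p$-algebras $$\varinjlim_m\widehat U(\mathfrak g_{\mathbb Z_p})^{(m)}_{\mathbb Q}\;\xrightarrow{\ \simeq\ }\;\mathcal D^{\rm an}(\mathbb G(0)^\circ),$$ where the left-hand side carries the locally convex inductive limit topology. -/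

import Mathlib

/-! ## `p`-adic completion of a (not necessarily commutative) `ℤ_p`-algebra -/

open scoped TensorProduct

noncomputable section

namespace WideOpen

section Completion

variable (p : ℕ)

/-- The two-sided ideal `p ^ n A` of a ring `A`. -/
def powIdeal (A : Type*) [Ring A] (n : ℕ) : Ideal A := Ideal.span {(p : A) ^ n}

theorem mem_powIdeal {A : Type*} [Ring A] {n : ℕ} {x : A} :
    x ∈ powIdeal p A n ↔ ∃ y, y * (p : A) ^ n = x := Ideal.mem_span_singleton'

instance powIdeal_isTwoSided (A : Type*) [Ring A] (n : ℕ) : (powIdeal p A n).IsTwoSided where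
  mul_mem_of_left {a} b ha := by
    obtain ⟨y, rfl⟩ := (mem_powIdeal p).1 ha
    exact (mem_powIdeal p).2 ⟨y * b, by
      rw [mul_assoc, mul_assoc, ((Nat.cast_commute p b).pow_left n).eq]⟩

theorem powIdeal_succ_le (A : Type*) [Ring A] (n : ℕ) : powIdeal p A (n + 1) ≤ powIdeal p A n := by
  intro x hx
  obtain ⟨y, rfl⟩ := (mem_powIdeal p).1 hx
  exact (mem_powIdeal p).2 ⟨y * p, by rw [pow_succ', mul_assoc]⟩

variable [Fact p.Prime] (A : Type*) [Ring A] [Algebra ℤ_[p] A]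

/-- The compatible sequences in `∏ n, A / p ^ n A`. -/
def completionSubalgebra : Subalgebra ℤ_[p] (∀ n : ℕ, A ⧸ powIdeal p A n) where
  carrier := {x | ∀ n, Ideal.Quotient.factorₐ ℤ_[p] (powIdeal_succ_le p A n) (x (n + 1)) = x n}
  mul_mem' hx hy n := by rw [Pi.mul_apply, map_mul, hx n, hy n, Pi.mul_apply]
  add_mem' hx hy n := by rw [Pi.add_apply, map_add, hx n, hy n, Pi.add_apply]
  algebraMap_mem' r n := by rw [Pi.algebraMap_apply, AlgHom.commutes, Pi.algebraMap_apply]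

/-- The `p`-adic completion `lim_n A / p ^ n A` of a `ℤ_p`-algebra `A`. -/
def PadicCompletion : Type _ := completionSubalgebra p A

instance : Ring (PadicCompletion p A) := inferInstanceAs (Ring (completionSubalgebra p A))
instance : Algebra ℤ_[p] (PadicCompletion p A) :=
  inferInstanceAs (Algebra ℤ_[p] (completionSubalgebra p A))

namespace PadicCompletion

/-- The canonical map from an algebra to its `p`-adic completion. -/
def of : A →ₐ[ℤ_[p]] PadicCompletion p A :=
  (AlgHom.pi fun n => Ideal.Quotient.mkₐ ℤ_[p] (powIdeal p A n)).codRestrict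
    (completionSubalgebra p A) fun _ _ => rfl

variable {A} {B C : Type*} [Ring B] [Algebra ℤ_[p] B] [Ring C] [Algebra ℤ_[p] C]

/-- The map `A / p ^ n A → B / p ^ n B` induced by a homomorphism `A → B`. -/
def mapLevel (φ : A →ₐ[ℤ_[p]] B) (n : ℕ) : (A ⧸ powIdeal p A n) →ₐ[ℤ_[p]] (B ⧸ powIdeal p B n) :=
  Ideal.Quotient.liftₐ (powIdeal p A n) ((Ideal.Quotient.mkₐ ℤ_[p] (powIdeal p B n)).comp φ) <| by
    intro a ha
    obtain ⟨y, rfl⟩ := (mem_powIdeal p).1 ha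
    refine Ideal.Quotient.eq_zero_iff_mem.2 ((mem_powIdeal p).2 ⟨φ y, ?_⟩)
    simp

/-- The homomorphism of `p`-adic completions induced by a homomorphism of algebras. -/
def map (φ : A →ₐ[ℤ_[p]] B) : PadicCompletion p A →ₐ[ℤ_[p]] PadicCompletion p B :=
  ((AlgHom.pi fun n => (mapLevel p φ n).comp
      (Pi.evalAlgHom ℤ_[p] (fun n : ℕ => A ⧸ powIdeal p A n) n)).comp
    (completionSubalgebra p A).val).codRestrict (completionSubalgebra p B) <| by
    intro x n
    obtain ⟨y, hy⟩ := Ideal.Quotient.mk_surjective (x.1 (n + 1))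
    have h := x.2 n
    change Ideal.Quotient.factorₐ ℤ_[p] _ (mapLevel p φ (n + 1) (x.1 (n + 1))) =
      mapLevel p φ n (x.1 n)
    rw [← h, ← hy]
    rfl

theorem map_id : map p (AlgHom.id ℤ_[p] A) = AlgHom.id ℤ_[p] _ := by
  ext x
  refine Subtype.ext (funext fun n => ?_)
  change mapLevel p (AlgHom.id ℤ_[p] A) n (x.1 n) = x.1 n
  obtain ⟨y, hy⟩ := Ideal.Quotient.mk_surjective (x.1 n)
  rw [← hy]
  rfl

theorem map_comp (ψ : B →ₐ[ℤ_[p]] C) (φ : A →ₐ[ℤ_[p]] B) :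
    (map p ψ).comp (map p φ) = map p (ψ.comp φ) := by
  ext x
  refine Subtype.ext (funext fun n => ?_)
  change mapLevel p ψ n (mapLevel p φ n (x.1 n)) = mapLevel p (ψ.comp φ) n (x.1 n)
  obtain ⟨y, hy⟩ := Ideal.Quotient.mk_surjective (x.1 n)
  rw [← hy]
  rfl

end PadicCompletion

/-- The topology on a `ℤ_p`-module in which the subsets `x + p ^ k L`, `k ∈ ℕ`, form a basis of
neighbourhoods of `x`, where `L` is a submodule. -/
@[reducible] def latticeTopology {M : Type*} [AddCommGroup M] [Module ℤ_[p] M]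
    (L : Submodule ℤ_[p] M) : TopologicalSpace M where
  IsOpen s := ∀ x ∈ s, ∃ k : ℕ, ∀ y ∈ L, x + (p : ℤ_[p]) ^ k • y ∈ s
  isOpen_univ _ _ := ⟨0, fun _ _ => trivial⟩
  isOpen_inter s t hs ht x hx := by
    obtain ⟨k, hk⟩ := hs x hx.1
    obtain ⟨l, hl⟩ := ht x hx.2
    refine ⟨k + l, fun y hy => ⟨?_, ?_⟩⟩
    · rw [pow_add, mul_smul]
      exact hk _ (L.smul_mem _ hy)
    · rw [pow_add, mul_comm, mul_smul]
      exact hl _ (L.smul_mem _ hy)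
  isOpen_sUnion S hS x := by
    rintro ⟨s, hs, hx⟩
    obtain ⟨k, hk⟩ := hS s hs x hx
    exact ⟨k, fun y hy => ⟨s, hs, hk y hy⟩⟩

/-- The `p`-adic topology on the `p`-adic completion. -/
instance : TopologicalSpace (PadicCompletion p A) := latticeTopology p ⊤

/-- The `p`-adic completion with `p` inverted. -/
def CompletionQ : Type _ := ℚ_[p] ⊗[ℤ_[p]] PadicCompletion p A

namespace CompletionQ

instance : Ring (CompletionQ p A) := inferInstanceAs (Ring (ℚ_[p] ⊗[ℤ_[p]] PadicCompletion p A))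
instance : Algebra ℚ_[p] (CompletionQ p A) :=
  inferInstanceAs (Algebra ℚ_[p] (ℚ_[p] ⊗[ℤ_[p]] PadicCompletion p A))
instance : Algebra ℤ_[p] (CompletionQ p A) :=
  inferInstanceAs (Algebra ℤ_[p] (ℚ_[p] ⊗[ℤ_[p]] PadicCompletion p A))

/-- The canonical map from the completion to the completion with `p` inverted. -/
def of : PadicCompletion p A →ₐ[ℤ_[p]] CompletionQ p A :=
  (Algebra.TensorProduct.includeRight :
    PadicCompletion p A →ₐ[ℤ_[p]] ℚ_[p] ⊗[ℤ_[p]] PadicCompletion p A)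

/-- The Banach space topology for which the image of the completion is a bounded open lattice. -/
instance : TopologicalSpace (CompletionQ p A) :=
  latticeTopology p (LinearMap.range (of p A).toLinearMap)

variable {A} {B C : Type*} [Ring B] [Algebra ℤ_[p] B] [Ring C] [Algebra ℤ_[p] C]

/-- The homomorphism of completions with `p` inverted induced by a homomorphism of algebras. -/
def map (φ : A →ₐ[ℤ_[p]] B) : CompletionQ p A →ₐ[ℚ_[p]] CompletionQ p B :=
  (Algebra.TensorProduct.map (AlgHom.id ℚ_[p] ℚ_[p]) (PadicCompletion.map p φ) :
    ℚ_[p] ⊗[ℤ_[p]] PadicCompletion p A →ₐ[ℚ_[p]] ℚ_[p] ⊗[ℤ_[p]] PadicCompletion p B)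

theorem map_id (x : CompletionQ p A) : map p (AlgHom.id ℤ_[p] A) x = x := by
  have h : map p (AlgHom.id ℤ_[p] A) = (Algebra.TensorProduct.map (AlgHom.id ℚ_[p] ℚ_[p])
      (PadicCompletion.map p (AlgHom.id ℤ_[p] A)) :
    ℚ_[p] ⊗[ℤ_[p]] PadicCompletion p A →ₐ[ℚ_[p]] ℚ_[p] ⊗[ℤ_[p]] PadicCompletion p A) := rfl
  rw [h, PadicCompletion.map_id]
  exact DFunLike.congr_fun (Algebra.TensorProduct.map_id (S := ℚ_[p]) (A := ℚ_[p])) x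

theorem map_map (ψ : B →ₐ[ℤ_[p]] C) (φ : A →ₐ[ℤ_[p]] B) (x : CompletionQ p A) :
    map p ψ (map p φ x) = map p (ψ.comp φ) x := by
  have h : map p (ψ.comp φ) = (Algebra.TensorProduct.map
      ((AlgHom.id ℚ_[p] ℚ_[p]).comp (AlgHom.id ℚ_[p] ℚ_[p]))
      ((PadicCompletion.map p ψ).comp (PadicCompletion.map p φ)) :
    ℚ_[p] ⊗[ℤ_[p]] PadicCompletion p A →ₐ[ℚ_[p]] ℚ_[p] ⊗[ℤ_[p]] PadicCompletion p C) := by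
    rw [PadicCompletion.map_comp]
    rfl
  rw [h, Algebra.TensorProduct.map_comp]
  rfl

end CompletionQ

/-! ## The direct limit of the completions of an increasing sequence of subalgebras -/

variable {p} {R : Type*} [Ring R] [Algebra ℤ_[p] R] (S : ℕ →o Subalgebra ℤ_[p] R)

/-- The map from the completion of `S m` to that of `S n`, with `p` inverted, for `m ≤ n`. -/
def transition (m n : ℕ) (h : m ≤ n) : CompletionQ p (S m) →ₐ[ℚ_[p]] CompletionQ p (S n) :=
  CompletionQ.map p (Subalgebra.inclusion (S.monotone h))

theorem transition_self (m : ℕ) (x : CompletionQ p (S m)) : transition S m m le_rfl x = x :=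
  CompletionQ.map_id p x

theorem transition_transition {k m n : ℕ} (hkm : k ≤ m) (hmn : m ≤ n) (x : CompletionQ p (S k)) :
    transition S m n hmn (transition S k m hkm x) = transition S k n (hkm.trans hmn) x :=
  CompletionQ.map_map p _ _ x

instance : DirectedSystem (fun m => CompletionQ p (S m)) (fun m n h => transition S m n h) where
  map_self m x := transition_self S m x
  map_map _ _ _ hkm hmn x := transition_transition S hkm hmn x

/-- The direct limit of the `p`-adic completions, with `p` inverted, of an increasing sequence of
subalgebras. -/
def CompletionLimit : Type _ := DirectLimit (fun m => CompletionQ p (S m)) (transition S)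

namespace CompletionLimit

instance : Ring (CompletionLimit S) :=
  inferInstanceAs (Ring (DirectLimit (fun m => CompletionQ p (S m)) (transition S)))

instance : Algebra ℚ_[p] (CompletionLimit S) :=
  letI : Module ℚ_[p] (CompletionLimit S) := inferInstanceAs
    (Module ℚ_[p] (DirectLimit (fun m => CompletionQ p (S m)) (transition S)))
  haveI : IsScalarTower ℚ_[p] (CompletionLimit S) (CompletionLimit S) := inferInstanceAs
    (IsScalarTower ℚ_[p] (DirectLimit (fun m => CompletionQ p (S m)) (transition S))
      (DirectLimit (fun m => CompletionQ p (S m)) (transition S)))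
  haveI : SMulCommClass ℚ_[p] (CompletionLimit S) (CompletionLimit S) := inferInstanceAs
    (SMulCommClass ℚ_[p] (DirectLimit (fun m => CompletionQ p (S m)) (transition S))
      (DirectLimit (fun m => CompletionQ p (S m)) (transition S)))
  Algebra.ofModule smul_mul_assoc mul_smul_comm

instance : Algebra ℤ_[p] (CompletionLimit S) :=
  Algebra.compHom (CompletionLimit S) (algebraMap ℤ_[p] ℚ_[p])

/-- The canonical map to the direct limit. -/
def of (m : ℕ) : CompletionQ p (S m) →ₐ[ℚ_[p]] CompletionLimit S :=
  AlgHom.ofLinearMap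
    { toFun := fun x => (⟦⟨m, x⟩⟧ : DirectLimit (fun m => CompletionQ p (S m)) (transition S))
      map_add' := fun x y => (DirectLimit.add_def (f := transition S) m x y).symm
      map_smul' := fun c x => by
        rw [RingHom.id_apply]
        exact (DirectLimit.smul_def (f := transition S) m x c).symm }
    (DirectLimit.one_def (f := transition S) m).symm
    (fun x y => (DirectLimit.mul_def (f := transition S) m x y).symm)

/-- The locally convex inductive limit topology: a basis of neighbourhoods of `0` is given by
those `ℤ_p`-submodules whose preimage under every `of S m` is open. -/
instance : TopologicalSpace (CompletionLimit S) where
  IsOpen s := ∀ x ∈ s, ∃ V : Submodule ℤ_[p] (CompletionLimit S),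
    (∀ m, IsOpen (of S m ⁻¹' (V : Set (CompletionLimit S)))) ∧ ∀ v ∈ V, x + v ∈ s
  isOpen_univ _ _ := ⟨⊤, fun _ => isOpen_univ, fun _ _ => trivial⟩
  isOpen_inter s t hs ht x hx := by
    obtain ⟨V, hV, hVs⟩ := hs x hx.1
    obtain ⟨W, hW, hWt⟩ := ht x hx.2
    exact ⟨V ⊓ W, fun m => (hV m).inter (hW m), fun v hv => ⟨hVs v hv.1, hWt v hv.2⟩⟩
  isOpen_sUnion S hS x := by
    rintro ⟨s, hs, hx⟩
    obtain ⟨V, hV, hVs⟩ := hS s hs x hx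
    exact ⟨V, hV, fun v hv => ⟨s, hs, hVs v hv⟩⟩

end CompletionLimit

end Completion

/-! ## The divided power enveloping algebras of `gl₂` -/

section Enveloping

attribute [local instance] LieRing.ofAssociativeRing

variable (p : ℕ) [Fact p.Prime]

/-- The Lie algebra `gl₂(ℚ_p)`. -/
abbrev Gl2 : Type := Matrix (Fin 2) (Fin 2) ℚ_[p]

/-- The universal enveloping algebra of `gl₂(ℚ_p)`. -/
def Env : Type := UniversalEnvelopingAlgebra ℚ_[p] (Gl2 p)

instance : Ring (Env p) := inferInstanceAs (Ring (UniversalEnvelopingAlgebra ℚ_[p] (Gl2 p)))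
instance : Algebra ℚ_[p] (Env p) :=
  inferInstanceAs (Algebra ℚ_[p] (UniversalEnvelopingAlgebra ℚ_[p] (Gl2 p)))
instance : Algebra ℤ_[p] (Env p) := Algebra.compHom (Env p) (algebraMap ℤ_[p] ℚ_[p])
instance : IsScalarTower ℤ_[p] ℚ_[p] (Env p) := IsScalarTower.of_algebraMap_eq' rfl

/-- The canonical map from the Lie algebra to its enveloping algebra. -/
def Env.ι (X : Gl2 p) : Env p := UniversalEnvelopingAlgebra.ι ℚ_[p] X

/-- The element `x ^ n / n!`. -/
def divPow (x : Env p) (n : ℕ) : Env p := ((n.factorial : ℚ_[p])⁻¹) • x ^ n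

/-- The element `x (x - 1) ⋯ (x - n + 1) / n!`. -/
def binom (x : Env p) (n : ℕ) : Env p :=
  ((n.factorial : ℚ_[p])⁻¹) • Polynomial.aeval x (descPochhammer ℚ_[p] n)

/-- The integer `q!`, where `q = ⌊n / p ^ m⌋`. -/
def qFactorial (m n : ℕ) : ℕ := (n / p ^ m).factorial

/-- The element `q₁! e ^ ν₁ / ν₁! · q₂! (h₁ choose ν₂) · q₃! (h₂ choose ν₃) · q₄! f ^ ν₄ / ν₄!` of
the enveloping algebra, where `qᵢ = ⌊νᵢ / p ^ m⌋`. -/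
def generator (m : ℕ) (ν : Fin 4 → ℕ) : Env p :=
  (qFactorial p m (ν 0) • divPow p (Env.ι p !![0, 1; 0, 0]) (ν 0)) *
  (qFactorial p m (ν 1) • binom p (Env.ι p !![1, 0; 0, 0]) (ν 1)) *
  (qFactorial p m (ν 2) • binom p (Env.ι p !![0, 0; 0, 1]) (ν 2)) *
  (qFactorial p m (ν 3) • divPow p (Env.ι p !![0, 0; 1, 0]) (ν 3))

/-- The `ℤ_p`-submodule of the enveloping algebra generated by the elements `generator p m ν`. -/
def levelModule (m : ℕ) : Submodule ℤ_[p] (Env p) :=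
  Submodule.span ℤ_[p] (Set.range (generator p m))

theorem levelModule_le {m n : ℕ} (h : m ≤ n) : levelModule p m ≤ levelModule p n := by
  have key : ∀ k, qFactorial p n k ∣ qFactorial p m k := fun k =>
    Nat.factorial_dvd_factorial (Nat.div_le_div_left
      (Nat.pow_le_pow_right (Fact.out : p.Prime).pos h) (pow_pos (Fact.out : p.Prime).pos m))
  refine Submodule.span_le.2 ?_
  rintro _ ⟨ν, rfl⟩
  choose c hc using key
  have : generator p m ν = (c (ν 0) * c (ν 1) * c (ν 2) * c (ν 3)) • generator p n ν := by
    simp only [generator, hc, mul_smul_comm, smul_mul_assoc, smul_smul, mul_assoc]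
    congr 1
    ring
  rw [this]
  exact (levelModule p n).nsmul_mem (Submodule.subset_span ⟨ν, rfl⟩) _

/-- The `ℤ_p`-subalgebra of the enveloping algebra generated by `levelModule p m`; it increases
with `m`. -/
def level : ℕ →o Subalgebra ℤ_[p] (Env p) where
  toFun m := Algebra.adjoin ℤ_[p] (levelModule p m : Set (Env p))
  monotone' _ _ h := Algebra.adjoin_mono (levelModule_le p h)

end Enveloping

/-! ## Rigid analytic functions on the wide open group `1 + M₂(𝔪)` -/

section Functions

open Filter Topology

variable (p : ℕ) [Fact p.Prime]

/-- Multi-indices: the exponents of monomials in the four coordinates `z_ij = g_ij - δ_ij`. -/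
abbrev MultiIndex : Type := (Fin 2 × Fin 2) →₀ ℕ

/-- The rigid analytic functions over `ℚ_p` on the wide open group `1 + M₂(𝔪)`: the power series in
the coordinates `z_ij = g_ij - δ_ij` that converge on the open unit polydisc, i.e. whose
coefficients `ξ_μ` satisfy `|ξ_μ| r ^ |μ| → 0` for all `0 < r < 1`. -/
def functionSubmodule : Submodule ℚ_[p] (MvPowerSeries (Fin 2 × Fin 2) ℚ_[p]) where
  carrier := {F | ∀ r : ℝ, 0 < r → r < 1 →
    Tendsto (fun μ : MultiIndex => ‖MvPowerSeries.coeff μ F‖ * r ^ μ.degree) cofinite (𝓝 0)}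
  zero_mem' r _ _ := by simp
  add_mem' {F G} hF hG r h0 h1 := by
    refine squeeze_zero (fun μ => by positivity) (fun μ => ?_)
      (by simpa using (hF r h0 h1).add (hG r h0 h1))
    rw [map_add, ← add_mul]
    gcongr
    exact norm_add_le _ _
  smul_mem' c F hF r h0 h1 := by
    simpa [mul_assoc] using (hF r h0 h1).const_mul ‖c‖

/-- The space of rigid analytic functions over `ℚ_p` on the wide open group `1 + M₂(𝔪)`. -/
def Fn : Type := functionSubmodule p

namespace Fn

instance : AddCommGroup (Fn p) := inferInstanceAs (AddCommGroup (functionSubmodule p))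
instance : Module ℚ_[p] (Fn p) := inferInstanceAs (Module ℚ_[p] (functionSubmodule p))

variable {p}

/-- The coefficient of a monomial. -/
def coeff (μ : MultiIndex) : Fn p →ₗ[ℚ_[p]] ℚ_[p] :=
  (MvPowerSeries.coeff μ : MvPowerSeries (Fin 2 × Fin 2) ℚ_[p] →ₗ[ℚ_[p]] ℚ_[p]) ∘ₗ
    (functionSubmodule p).subtype

theorem tendsto_coeff (F : Fn p) {r : ℝ} (h0 : 0 < r) (h1 : r < 1) :
    Tendsto (fun μ => ‖coeff μ F‖ * r ^ μ.degree) cofinite (𝓝 0) := F.2 r h0 h1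

theorem ext {F G : Fn p} (h : ∀ μ, coeff μ F = coeff μ G) : F = G :=
  Subtype.ext (MvPowerSeries.ext h)

/-- The radii in the open interval `(0, 1)`. -/
abbrev Radius : Type := Set.Ioo (0 : ℝ) 1

instance : Nonempty Radius := ⟨⟨1 / 2, by norm_num, by norm_num⟩⟩

theorem bddAbove (F : Fn p) (r : Radius) :
    BddAbove (Set.range fun μ => ‖coeff μ F‖ * (r : ℝ) ^ μ.degree) := by
  have h := (F.tendsto_coeff r.2.1 r.2.2).eventually (gt_mem_nhds one_pos)
  rw [eventually_cofinite] at h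
  obtain ⟨M, hM⟩ := (h.image fun μ => ‖coeff μ F‖ * (r : ℝ) ^ μ.degree).bddAbove
  refine ⟨max M 1, ?_⟩
  rintro _ ⟨μ, rfl⟩
  by_cases hμ : ‖coeff μ F‖ * (r : ℝ) ^ μ.degree < 1
  · exact le_max_of_le_right hμ.le
  · exact le_max_of_le_left (hM ⟨μ, hμ, rfl⟩)

/-- The Gauss norm `sup_μ |ξ_μ| r ^ |μ|` on the closed polydisc of radius `r < 1`. -/
def gauss (r : Radius) : Seminorm ℚ_[p] (Fn p) :=
  Seminorm.of (fun F => ⨆ μ, ‖coeff μ F‖ * (r : ℝ) ^ μ.degree)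
    (fun F G => by
      have h0 := r.2.1
      refine ciSup_le fun μ => ?_
      refine le_trans ?_ (add_le_add (le_ciSup (F.bddAbove r) μ) (le_ciSup (G.bddAbove r) μ))
      rw [map_add, ← add_mul]
      gcongr
      exact norm_add_le _ _)
    (fun c F => by
      rw [Real.mul_iSup_of_nonneg (norm_nonneg c)]
      simp [mul_assoc])

theorem le_gauss (F : Fn p) (r : Radius) (μ : MultiIndex) :
    ‖coeff μ F‖ * (r : ℝ) ^ μ.degree ≤ gauss r F := le_ciSup (F.bddAbove r) μ

theorem gauss_le (F : Fn p) (r : Radius) {C : ℝ}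
    (h : ∀ μ, ‖coeff μ F‖ * (r : ℝ) ^ μ.degree ≤ C) : gauss r F ≤ C := ciSup_le h

theorem gauss_mono {r s : Radius} (h : r ≤ s) : (gauss r : Seminorm ℚ_[p] (Fn p)) ≤ gauss s := by
  intro F
  refine gauss_le F r fun μ => le_trans ?_ (le_gauss F s μ)
  have h0 := r.2.1.le
  gcongr

variable (p) in
/-- The family of the Gauss norms. -/
def gaussFamily : SeminormFamily ℚ_[p] (Fn p) Radius := gauss

/-- The Fréchet topology defined by the Gauss norms for all radii `r < 1`. -/
instance : TopologicalSpace (Fn p) := (gaussFamily p).moduleFilterBasis.topology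

theorem withSeminorms : WithSeminorms (gaussFamily p) := ⟨rfl⟩

instance : IsTopologicalAddGroup (Fn p) := withSeminorms.topologicalAddGroup
instance : ContinuousSMul ℚ_[p] (Fn p) := withSeminorms.continuousSMul

/-- The value of a function at a matrix `g`, given by inserting `z_ij = g_ij - δ_ij` in the power
series. -/
def eval (F : Fn p) (g : Matrix (Fin 2) (Fin 2) ℚ_[p]) : ℚ_[p] :=
  ∑' μ : MultiIndex, coeff μ F * μ.prod fun ij n => (g - 1) ij.1 ij.2 ^ n

/-- The monomial functions. -/
def monomial (μ : MultiIndex) : Fn p :=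
  ⟨MvPowerSeries.monomial μ 1, fun r _ _ => by
    classical
    refine tendsto_const_nhds.congr' ?_
    refine (Set.finite_singleton μ).subset fun ν hν => ?_
    by_contra h
    exact hν (by simp [MvPowerSeries.coeff_monomial, show ν ≠ μ from h])⟩

open Classical in
theorem coeff_monomial (μ ν : MultiIndex) :
    coeff ν (monomial μ : Fn p) = if ν = μ then 1 else 0 := MvPowerSeries.coeff_monomial ν μ 1

theorem gauss_monomial (r : Radius) (μ : MultiIndex) :
    gauss r (monomial μ : Fn p) ≤ (r : ℝ) ^ μ.degree := by
  have h0 := r.2.1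
  refine gauss_le _ _ fun ν => ?_
  by_cases h : ν = μ
  · simp [coeff_monomial, h]
  · simp only [coeff_monomial, h, if_false, norm_zero, zero_mul]
    positivity

theorem hasSum_monomial (F : Fn p) : HasSum (fun μ => coeff μ F • (monomial μ : Fn p)) F := by
  classical
  refine (withSeminorms.tendsto_nhds _ F).2 fun r ε hε => ?_
  have h := (F.tendsto_coeff r.2.1 r.2.2).eventually (gt_mem_nhds (half_pos hε))
  rw [eventually_cofinite] at h
  filter_upwards [eventually_ge_atTop h.toFinset] with s hs
  refine lt_of_le_of_lt (gauss_le _ r (C := ε / 2) fun μ => ?_) (half_lt_self hε)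
  have hc : coeff μ (∑ ν ∈ s, coeff ν F • monomial ν - F) = if μ ∈ s then 0 else - coeff μ F := by
    rw [map_sub, map_sum]
    simp only [map_smul, coeff_monomial, smul_eq_mul, mul_ite, mul_one, mul_zero]
    rw [Finset.sum_ite_eq]
    split_ifs <;> simp
  rw [hc]
  split_ifs with hμ
  · simpa using (half_pos hε).le
  · have : μ ∉ h.toFinset := fun h' => hμ (hs h')
    rw [norm_neg]
    simpa using (by simpa using this : ‖coeff μ F‖ * (r : ℝ) ^ μ.degree < ε / 2).le

theorem exists_bound (l : Fn p →L[ℚ_[p]] ℚ_[p]) :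
    ∃ (r : Radius) (C : ℝ), 0 ≤ C ∧ ∀ F, ‖l F‖ ≤ C * gauss r F := by
  classical
  obtain ⟨s, C, -, h⟩ := Seminorm.bound_of_continuous withSeminorms
    ((normSeminorm ℚ_[p] ℚ_[p]).comp l.toLinearMap) (by
      change Continuous fun F => ‖l F‖
      fun_prop)
  obtain ⟨r, hr⟩ : ∃ r : Radius, ∀ i ∈ s, i ≤ r := by
    obtain ⟨r, hr⟩ := s.exists_le
    exact ⟨r, hr⟩
  refine ⟨r, C, C.2, fun F => (h F).trans ?_⟩
  have h2 : s.sup (gaussFamily p) ≤ gauss r := Finset.sup_le fun i hi => gauss_mono (hr i hi)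
  change (C : ℝ) * (s.sup (gaussFamily p)) F ≤ _
  gcongr
  exact h2 F

end Fn

/-! ## The analytic distribution algebra -/

/-- The analytic distributions on the wide open group: the continuous dual of the space of rigid
analytic functions, with the strong topology of uniform convergence on bounded subsets. -/
def Dist : Type := StrongDual ℚ_[p] (Fn p)

namespace Dist

instance : AddCommGroup (Dist p) := inferInstanceAs (AddCommGroup (StrongDual ℚ_[p] (Fn p)))
instance : Module ℚ_[p] (Dist p) := inferInstanceAs (Module ℚ_[p] (StrongDual ℚ_[p] (Fn p)))
instance : TopologicalSpace (Dist p) :=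
  inferInstanceAs (TopologicalSpace (StrongDual ℚ_[p] (Fn p)))
instance : FunLike (Dist p) (Fn p) ℚ_[p] :=
  inferInstanceAs (FunLike (StrongDual ℚ_[p] (Fn p)) (Fn p) ℚ_[p])

/-- The algebra of polynomial functions in the coordinates `z_ij = g_ij - δ_ij`. -/
def Poly : Type := MvPolynomial (Fin 2 × Fin 2) ℚ_[p]

instance : CommRing (Poly p) := inferInstanceAs (CommRing (MvPolynomial (Fin 2 × Fin 2) ℚ_[p]))
instance : Algebra ℚ_[p] (Poly p) :=
  inferInstanceAs (Algebra ℚ_[p] (MvPolynomial (Fin 2 × Fin 2) ℚ_[p]))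

/-- The coordinate function `z_ij`. -/
def Poly.z (ij : Fin 2 × Fin 2) : Poly p := (MvPolynomial.X ij : MvPolynomial _ ℚ_[p])

/-- The comultiplication dual to the multiplication of matrices: since
`(1 + z)(1 + z') = 1 + z + z' + z z'`, it maps `z_ij` to
`z_ij ⊗ 1 + 1 ⊗ z_ij + ∑ k, z_ik ⊗ z_kj`. -/
def Poly.comul : Poly p →ₐ[ℚ_[p]] Poly p ⊗[ℚ_[p]] Poly p :=
  (MvPolynomial.aeval fun ij => Poly.z p ij ⊗ₜ[ℚ_[p]] 1 + 1 ⊗ₜ[ℚ_[p]] Poly.z p ij +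
    ∑ k, Poly.z p (ij.1, k) ⊗ₜ[ℚ_[p]] Poly.z p (k, ij.2) :
    MvPolynomial (Fin 2 × Fin 2) ℚ_[p] →ₐ[ℚ_[p]] Poly p ⊗[ℚ_[p]] Poly p)

/-- The counit is evaluation at the unit matrix. -/
def Poly.counit : Poly p →ₐ[ℚ_[p]] ℚ_[p] :=
  (MvPolynomial.aeval fun _ => 0 : MvPolynomial (Fin 2 × Fin 2) ℚ_[p] →ₐ[ℚ_[p]] ℚ_[p])

variable {p} in
theorem Poly.comul_z (ij : Fin 2 × Fin 2) : Poly.comul p (Poly.z p ij) =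
    Poly.z p ij ⊗ₜ[ℚ_[p]] 1 + 1 ⊗ₜ[ℚ_[p]] Poly.z p ij +
    ∑ k, Poly.z p (ij.1, k) ⊗ₜ[ℚ_[p]] Poly.z p (k, ij.2) := MvPolynomial.aeval_X _ _

variable {p} in
theorem Poly.counit_z (ij : Fin 2 × Fin 2) : Poly.counit p (Poly.z p ij) = 0 :=
  MvPolynomial.aeval_X _ _

variable {p} in
theorem Poly.hom_ext {A : Type*} [Semiring A] [Algebra ℚ_[p] A] {f g : Poly p →ₐ[ℚ_[p]] A}
    (h : ∀ ij, f (Poly.z p ij) = g (Poly.z p ij)) : f = g :=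
  MvPolynomial.algHom_ext (σ := Fin 2 × Fin 2) (R := ℚ_[p]) (f := f) (g := g) h

instance : Bialgebra ℚ_[p] (Poly p) :=
  Bialgebra.ofAlgHom (Poly.comul p) (Poly.counit p)
    (Poly.hom_ext fun ij => by
      simp [Poly.comul_z, Fin.sum_univ_two, TensorProduct.add_tmul, TensorProduct.tmul_add,
        Algebra.TensorProduct.one_def]
      abel)
    (Poly.hom_ext fun ij => by
      simp [Poly.comul_z, Poly.counit_z])
    (Poly.hom_ext fun ij => by
      simp [Poly.comul_z, Poly.counit_z])

/-- The monomials. -/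
def Poly.mon (μ : MultiIndex) : Poly p :=
  (MvPolynomial.monomial μ 1 : MvPolynomial (Fin 2 × Fin 2) ℚ_[p])

/-- A polynomial function, viewed as a rigid analytic function. -/
def Poly.toFn : Poly p →ₗ[ℚ_[p]] Fn p :=
  (MvPolynomial.basisMonomials (Fin 2 × Fin 2) ℚ_[p]).constr ℚ_[p] fun μ => Fn.monomial μ

variable {p}

theorem toFn_mon (μ : MultiIndex) : Poly.toFn p (Poly.mon p μ) = Fn.monomial μ := by
  have h := (MvPolynomial.basisMonomials (Fin 2 × Fin 2) ℚ_[p]).constr_basis ℚ_[p]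
    (fun μ => (Fn.monomial μ : Fn p)) μ
  rwa [MvPolynomial.coe_basisMonomials] at h

theorem Poly.linearMap_ext {M : Type*} [AddCommMonoid M] [Module ℚ_[p] M]
    {f g : Poly p →ₗ[ℚ_[p]] M} (h : ∀ μ, f (Poly.mon p μ) = g (Poly.mon p μ)) : f = g :=
  (MvPolynomial.basisMonomials (Fin 2 × Fin 2) ℚ_[p]).ext (σ := RingHom.id _) (f₁ := f) (f₂ := g)
    fun μ => by
      rw [MvPolynomial.coe_basisMonomials]
      exact h μ

/-- The restriction of a distribution to polynomial functions, as an element of the convolution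
algebra dual to the coalgebra of polynomial functions. -/
def restrict (l : Dist p) : WithConv (Poly p →ₗ[ℚ_[p]] ℚ_[p]) :=
  WithConv.toConv ((l : Fn p →L[ℚ_[p]] ℚ_[p]).toLinearMap ∘ₗ Poly.toFn p)

theorem restrict_mon (l : Dist p) (μ : MultiIndex) :
    (restrict l).ofConv (Poly.mon p μ) = l (Fn.monomial μ) := congrArg l (toFn_mon μ)

theorem ext {l l' : Dist p} (h : ∀ F, l F = l' F) : l = l' := DFunLike.ext _ _ h

theorem hasSum_apply (l : Dist p) (F : Fn p) :
    HasSum (fun μ => Fn.coeff μ F * l (Fn.monomial μ)) (l F) := by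
  have h := F.hasSum_monomial.mapL (l : Fn p →L[ℚ_[p]] ℚ_[p])
  have h2 : (fun μ => Fn.coeff μ F * l (Fn.monomial μ)) =
      fun μ => (l : Fn p →L[ℚ_[p]] ℚ_[p]) (Fn.coeff μ F • Fn.monomial μ) :=
    funext fun μ => (ContinuousLinearMap.map_smul (l : Fn p →L[ℚ_[p]] ℚ_[p]) _ _).symm
  rw [h2]
  exact h

/-- Polynomial functions are dense, so that a distribution is determined by its restriction. -/
theorem restrict_injective : Function.Injective (restrict : Dist p → _) := by
  intro l l' h
  refine ext fun F => (hasSum_apply l F).unique ?_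
  have h2 : ∀ μ, l (Fn.monomial μ) = l' (Fn.monomial μ) := fun μ => by
    rw [← restrict_mon, ← restrict_mon, h]
  simpa only [h2] using hasSum_apply l' F

theorem exists_restrict_eq (φ : Poly p →ₗ[ℚ_[p]] ℚ_[p]) (r : Fn.Radius) (C : ℝ) (hC : 0 ≤ C)
    (h : ∀ μ, ‖φ (Poly.mon p μ)‖ ≤ C * (r : ℝ) ^ μ.degree) :
    ∃ l : Dist p, restrict l = WithConv.toConv φ := by
  have hle : ∀ (F : Fn p) μ, ‖Fn.coeff μ F * φ (Poly.mon p μ)‖ ≤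
      C * (‖Fn.coeff μ F‖ * (r : ℝ) ^ μ.degree) := fun F μ => by
    rw [norm_mul, mul_left_comm]
    gcongr
    exact h μ
  have hs : ∀ F : Fn p, Summable fun μ => Fn.coeff μ F * φ (Poly.mon p μ) := fun F => by
    refine NonarchimedeanAddGroup.summable_of_tendsto_cofinite_zero ?_
    refine squeeze_zero_norm (hle F) ?_
    simpa using (F.tendsto_coeff r.2.1 r.2.2).const_mul C
  let f : Fn p →ₗ[ℚ_[p]] ℚ_[p] :=
    { toFun := fun F => ∑' μ, Fn.coeff μ F * φ (Poly.mon p μ)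
      map_add' := fun F G => by
        rw [← (hs F).tsum_add (hs G)]
        simp only [map_add, add_mul]
      map_smul' := fun c F => by
        simp only [map_smul, smul_eq_mul, mul_assoc, RingHom.id_apply, tsum_mul_left] }
  have hf : ∀ F, ‖f F‖ ≤ C * Fn.gauss r F := fun F => by
    refine le_of_tendsto (hs F).hasSum.norm (Eventually.of_forall fun s => ?_)
    refine IsUltrametricDist.norm_sum_le_of_forall_le_of_nonneg
      (mul_nonneg hC (apply_nonneg _ _)) fun μ _ => (hle F μ).trans ?_
    gcongr
    exact Fn.le_gauss F r μ
  have hcont : Continuous f := Fn.withSeminorms.continuous_normedSpace_rng ℚ_[p] f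
    ⟨{r}, ⟨C, hC⟩, fun F => by
      rw [Finset.sup_singleton]
      exact hf F⟩
  let l : Dist p := (⟨f, hcont⟩ : Fn p →L[ℚ_[p]] ℚ_[p])
  refine ⟨l, WithConv.ext (Poly.linearMap_ext fun μ => ?_)⟩
  rw [restrict_mon]
  change ∑' ν, Fn.coeff ν (Fn.monomial μ) * φ (Poly.mon p ν) = φ (Poly.mon p μ)
  rw [tsum_eq_single μ]
  · simp [Fn.coeff_monomial]
  · intro ν hν
    simp [Fn.coeff_monomial, hν]

/-- The `ℤ`-span of the tensors of monomials of total degree at least `d`. -/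
def degGE (p : ℕ) [Fact p.Prime] (d : ℕ) : Submodule ℤ (Poly p ⊗[ℚ_[p]] Poly p) :=
  Submodule.span ℤ {t | ∃ α β : MultiIndex, d ≤ α.degree + β.degree ∧
    t = Poly.mon p α ⊗ₜ[ℚ_[p]] Poly.mon p β}

theorem Poly.mon_add (μ ν : MultiIndex) : Poly.mon p (μ + ν) = Poly.mon p μ * Poly.mon p ν := by
  have h := MvPolynomial.monomial_mul (R := ℚ_[p]) (s := μ) (s' := ν) (a := 1) (b := 1)
  rw [one_mul] at h
  exact h.symm

theorem Poly.mon_zero : Poly.mon p 0 = 1 := rfl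

theorem Poly.mon_single (ij : Fin 2 × Fin 2) : Poly.mon p (Finsupp.single ij 1) = Poly.z p ij := rfl

theorem mul_mem_degGE {d e : ℕ} {s t : Poly p ⊗[ℚ_[p]] Poly p} (hs : s ∈ degGE p d)
    (ht : t ∈ degGE p e) : s * t ∈ degGE p (d + e) := by
  induction hs using Submodule.span_induction with
  | zero => rw [zero_mul]; exact Submodule.zero_mem _
  | add x y _ _ hx hy => rw [add_mul]; exact Submodule.add_mem _ hx hy
  | smul c x _ hx => rw [smul_mul_assoc]; exact Submodule.smul_mem _ c hx
  | mem x hx =>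
    obtain ⟨α, β, hd, rfl⟩ := hx
    induction ht using Submodule.span_induction with
    | zero => rw [mul_zero]; exact Submodule.zero_mem _
    | add x y _ _ hx hy => rw [mul_add]; exact Submodule.add_mem _ hx hy
    | smul c x _ hx => rw [mul_smul_comm]; exact Submodule.smul_mem _ c hx
    | mem y hy =>
      obtain ⟨γ, δ, he, rfl⟩ := hy
      refine Submodule.subset_span ⟨α + γ, β + δ, ?_, ?_⟩
      · simp only [map_add]
        omega
      · rw [Algebra.TensorProduct.tmul_mul_tmul, Poly.mon_add, Poly.mon_add]

theorem comul_mon_mem (μ : MultiIndex) : Poly.comul p (Poly.mon p μ) ∈ degGE p μ.degree := by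
  induction μ using Finsupp.induction_linear with
  | zero =>
    rw [Poly.mon_zero, map_one]
    exact Submodule.subset_span ⟨0, 0, by simp, rfl⟩
  | add μ ν hμ hν =>
    rw [Poly.mon_add, map_mul, map_add]
    exact mul_mem_degGE hμ hν
  | single ij n =>
    induction n with
    | zero =>
      rw [Finsupp.single_zero, Poly.mon_zero, map_one]
      exact Submodule.subset_span ⟨0, 0, by simp, rfl⟩
    | succ n ih =>
      rw [Finsupp.single_add, Poly.mon_add, map_mul, map_add]
      refine mul_mem_degGE ih ?_
      rw [Poly.mon_single, Poly.comul_z]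
      have hz : ∀ α β : MultiIndex, 1 ≤ α.degree + β.degree →
          Poly.mon p α ⊗ₜ[ℚ_[p]] Poly.mon p β ∈
            degGE p (Finsupp.degree (Finsupp.single ij 1)) := fun α β h =>
        Submodule.subset_span ⟨α, β, by simpa using h, rfl⟩
      refine Submodule.add_mem _ (Submodule.add_mem _ ?_ ?_) (Submodule.sum_mem _ fun k _ => ?_)
      · exact hz (Finsupp.single ij 1) 0 (by simp)
      · exact hz 0 (Finsupp.single ij 1) (by simp)
      · exact hz (Finsupp.single (ij.1, k) 1) (Finsupp.single (k, ij.2) 1) (by simp)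

theorem norm_le_of_mem_degGE {l l' : Poly p →ₗ[ℚ_[p]] ℚ_[p]} {r : Fn.Radius} {C C' : ℝ}
    (hC : 0 ≤ C) (hC' : 0 ≤ C') (h : ∀ μ, ‖l (Poly.mon p μ)‖ ≤ C * (r : ℝ) ^ μ.degree)
    (h' : ∀ μ, ‖l' (Poly.mon p μ)‖ ≤ C' * (r : ℝ) ^ μ.degree) {d : ℕ}
    {t : Poly p ⊗[ℚ_[p]] Poly p} (ht : t ∈ degGE p d) :
    ‖LinearMap.mul' ℚ_[p] ℚ_[p] (TensorProduct.map l l' t)‖ ≤ C * C' * (r : ℝ) ^ d := by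
  have h0 := r.2.1
  induction ht using Submodule.span_induction with
  | zero =>
    simp only [map_zero, norm_zero]
    positivity
  | add x y _ _ hx hy =>
    rw [map_add, map_add]
    exact (IsUltrametricDist.norm_add_le_max _ _).trans (max_le hx hy)
  | smul c x _ hx =>
    rw [map_zsmul, map_zsmul, zsmul_eq_mul, norm_mul]
    exact (mul_le_of_le_one_left (norm_nonneg _) (Padic.norm_int_le_one c)).trans hx
  | mem x hx =>
    obtain ⟨α, β, hd, rfl⟩ := hx
    rw [TensorProduct.map_tmul, LinearMap.mul'_apply, norm_mul]
    calc _ ≤ (C * (r : ℝ) ^ α.degree) * (C' * (r : ℝ) ^ β.degree) := by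
          gcongr
          · exact h α
          · exact h' β
      _ = C * C' * (r : ℝ) ^ (α.degree + β.degree) := by ring
      _ ≤ _ := by
          gcongr ?_ * ?_
          exact pow_le_pow_of_le_one h0.le r.2.2.le hd

theorem exists_moment_bound (l : Dist p) : ∃ (r : Fn.Radius) (C : ℝ), 0 ≤ C ∧
    ∀ s : Fn.Radius, r ≤ s → ∀ μ, ‖l (Fn.monomial μ)‖ ≤ C * (s : ℝ) ^ μ.degree := by
  obtain ⟨r, C, hC, h⟩ := Fn.exists_bound (l : Fn p →L[ℚ_[p]] ℚ_[p])
  refine ⟨r, C, hC, fun s hs μ => (h _).trans ?_⟩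
  gcongr
  refine (Fn.gauss_monomial r μ).trans ?_
  have h0 := r.2.1.le
  gcongr

theorem exists_conv (l l' : Dist p) : ∃ l'' : Dist p, restrict l'' = restrict l * restrict l' := by
  obtain ⟨r, C, hC, h⟩ := exists_moment_bound l
  obtain ⟨r', C', hC', h'⟩ := exists_moment_bound l'
  refine exists_restrict_eq (restrict l * restrict l').ofConv (max r r') (C * C')
    (mul_nonneg hC hC') fun μ => ?_
  refine norm_le_of_mem_degGE hC hC' (fun ν => ?_) (fun ν => ?_) (comul_mon_mem μ)
  · rw [restrict_mon]
    exact h _ (le_max_left _ _) ν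
  · rw [restrict_mon]
    exact h' _ (le_max_right _ _) ν

theorem exists_one : ∃ l : Dist p, restrict l = 1 := by
  refine exists_restrict_eq (Poly.counit p).toLinearMap ⟨1 / 2, by norm_num, by norm_num⟩ 1
    zero_le_one fun μ => ?_
  have h : Poly.counit p (Poly.mon p μ) = algebraMap ℚ_[p] ℚ_[p] 1 * μ.prod fun _ n => 0 ^ n :=
    MvPolynomial.aeval_monomial _ _ _
  rw [AlgHom.toLinearMap_apply, h]
  by_cases hμ : μ = 0
  · simp [hμ]
  · obtain ⟨i, hi⟩ := Finsupp.ne_iff.1 hμ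
    have h2 : (μ.prod fun _ n => (0 : ℚ_[p]) ^ n) = 0 :=
      Finset.prod_eq_zero (Finsupp.mem_support_iff.2 hi) (zero_pow hi)
    rw [h2, mul_zero, norm_zero]
    positivity

/-- The convolution of distributions. It is the unique distribution whose value at a polynomial
function `P` is `(l ⊗ l') (Δ P)`, with `Δ P` the function `(g, h) ↦ P (g h)`. -/
instance : Mul (Dist p) := ⟨fun l l' => (exists_conv l l').choose⟩

/-- The unit is the distribution of evaluation at the unit matrix. -/
instance : One (Dist p) := ⟨exists_one.choose⟩

theorem restrict_mul (l l' : Dist p) : restrict (l * l') = restrict l * restrict l' :=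
  (exists_conv l l').choose_spec

theorem restrict_one : restrict (1 : Dist p) = 1 := exists_one.choose_spec

theorem restrict_add (l l' : Dist p) : restrict (l + l') = restrict l + restrict l' := rfl

theorem restrict_zero : restrict (0 : Dist p) = 0 := rfl

theorem restrict_smul (c : ℚ_[p]) (l : Dist p) : restrict (c • l) = c • restrict l := rfl

instance : Ring (Dist p) :=
  { (inferInstance : AddCommGroup (Dist p)), (inferInstance : Mul (Dist p)),
    (inferInstance : One (Dist p)) with
    left_distrib a b c := restrict_injective <| by
      simp only [restrict_mul, restrict_add, mul_add]
    right_distrib a b c := restrict_injective <| by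
      simp only [restrict_mul, restrict_add, add_mul]
    zero_mul a := restrict_injective <| by rw [restrict_mul, restrict_zero, zero_mul]
    mul_zero a := restrict_injective <| by rw [restrict_mul, restrict_zero, mul_zero]
    mul_assoc a b c := restrict_injective <| by simp only [restrict_mul, mul_assoc]
    one_mul a := restrict_injective <| by rw [restrict_mul, restrict_one, one_mul]
    mul_one a := restrict_injective <| by rw [restrict_mul, restrict_one, mul_one] }

instance : Algebra ℚ_[p] (Dist p) :=
  Algebra.ofModule
    (fun c a b => restrict_injective <| by
      simp only [restrict_mul, restrict_smul, smul_mul_assoc])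
    (fun c a b => restrict_injective <| by
      simp only [restrict_mul, restrict_smul, mul_smul_comm])

instance : Algebra ℤ_[p] (Dist p) := Algebra.compHom (Dist p) (algebraMap ℤ_[p] ℚ_[p])

end Dist

end Functions

end WideOpen

end

open scoped TensorProduct

noncomputable section

namespace WideOpen

section

/-! ### Norms of the factorials of `⌊n / p ^ m⌋` and the radii `p ^ (-1 / p ^ m)`. -/

section QFactorial

variable (p : ℕ) [hp : Fact p.Prime]

/-! A distribution on the open polydisc is the same thing as its family of moments `l(z^μ)`, and a
family occurs exactly when it is bounded by `C r^|μ|` for some `r < 1`. Call `l` of level `m` if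
`|l(z^μ)| ≤ ∏ |⌊μ_ij / p^m⌋!|`. With `R_m = p^(-1/p^m)` this weight lies between `R_m^|μ|` and `p^4
R_(m+1)^|μ|` (`levelRadius_pow_le_levelNorm`, `levelNorm_le_levelRadius_pow`). Since `R_m → 1`,
every distribution is of some level after multiplication by a power of `p`.

The link with the enveloping algebra is the Gauss decomposition `g = u t v` (upper unipotent,
diagonal, lower unipotent). In these coordinates `e`, `h₁`, `h₂` acting from the left and `f` acting
from the right become elementary vector fields, so `θ` maps the Poincaré–Birkhoff–Witt element of
exponent `ν` to the functional that takes the coefficient of index `ν` of `F(u t v)`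
(`isGaussCoeff_theta_pbw`). The coordinate change is integral, unipotent for the filtration by
order, and compatible with partial divided powers of level `m`. Size conditions therefore pass in
both directions between moments and Gauss coordinates, and the module of level `m` consists exactly
of the `u` with `θ(u)` of level `m` (`mem_levelModule_iff`).

The comultiplication also respects partial divided powers, so level `m` is stable under convolution
(`LevelBound.mul`). This makes the level module a subalgebra and lets `θ` extend to the completion.
The extension is injective, and it reaches every distribution whose Gauss coordinates are bounded by
the weight and tend to zero relative to it (`exists_completionHom_eq`). A distribution with moments
`O(r^|μ|)` has Gauss coordinates of the same decay, so any `m` with `r < R_m` gives surjectivity of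
the limit map.

For the topologies, the balls `|l(z^μ)| ρ(|μ|) ≤ 1` with `ρ` of subexponential growth form a basis
of neighbourhoods of zero in the strong dual. Each of them absorbs every level, which is continuity
of the isomorphism. Conversely, let a `ℤ_p`-submodule `W` contain `p^(k_m)` times the image of the
`m`-th completion for all `m`. Then `W` contains the ball of `ρ(n) = p · inf_m p^(k_m) R_m^(-n)`
(`exists_ball_le`): each single term of the Gauss expansion lies in `W` through a level chosen for
that term, and all but finitely many terms lie in `W` together through one fixed level. -/

theorem padicValNat_factorial_eq_add (n : ℕ) :
    padicValNat p n.factorial = n / p + padicValNat p (n / p).factorial := by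
  rw [← padicValNat_mul_div_factorial n, padicValNat_factorial_mul, add_comm]

/-- Legendre's formula stopped after `m` terms: the remaining terms form the valuation of `⌊n / p ^
m⌋!`. -/
theorem padicValNat_factorial_eq_sum_add (m n : ℕ) :
    padicValNat p n.factorial =
      (∑ i ∈ Finset.range m, n / p ^ (i + 1)) + padicValNat p (n / p ^ m).factorial := by
  induction m with
  | zero => simp
  | succ m ih =>
    rw [ih, Finset.sum_range_succ, padicValNat_factorial_eq_add p (n / p ^ m), Nat.div_div_eq_div_mul,
      ← pow_succ, add_assoc]

/-- The `p`-adic norm of `⌊n / p ^ m⌋!`. -/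
def qNorm (m n : ℕ) : ℝ := ‖(qFactorial p m n : ℚ_[p])‖

theorem qFactorial_ne_zero (m n : ℕ) : (qFactorial p m n : ℚ_[p]) ≠ 0 :=
  Nat.cast_ne_zero.2 (Nat.factorial_ne_zero _)

theorem qNorm_pos (m n : ℕ) : 0 < qNorm p m n := norm_pos_iff.2 (qFactorial_ne_zero p m n)

theorem qNorm_le_one (m n : ℕ) : qNorm p m n ≤ 1 := by
  simpa [qNorm] using Padic.norm_int_le_one (p := p) (qFactorial p m n : ℤ)

theorem qNorm_zero (m : ℕ) : qNorm p m 0 = 1 := by simp [qNorm, qFactorial]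

theorem norm_natCast_eq_zpow {n : ℕ} (hn : n ≠ 0) :
    ‖(n : ℚ_[p])‖ = (p : ℝ) ^ (-(padicValNat p n : ℤ)) := by
  have h : (n : ℚ_[p]) ≠ 0 := Nat.cast_ne_zero.2 hn
  rw [Padic.norm_eq_zpow_neg_valuation h, Padic.valuation_natCast]

theorem qNorm_add_le (m i j : ℕ) : qNorm p m (i + j) ≤ qNorm p m i * qNorm p m j := by
  have h : qFactorial p m i * qFactorial p m j ∣ qFactorial p m (i + j) :=
    (Nat.factorial_mul_factorial_dvd_factorial_add _ _).trans
      (Nat.factorial_dvd_factorial (Nat.div_add_div_le_add_div))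
  obtain ⟨c, hc⟩ := h
  rw [qNorm, hc, Nat.cast_mul, Nat.cast_mul, norm_mul, norm_mul]
  refine mul_le_of_le_one_right (by positivity) ?_
  simpa using Padic.norm_int_le_one (p := p) (c : ℤ)

/-- Integrality of the modified binomial coefficient `(i+j choose i) q_i! q_j! / q_(i+j)!`. Writing
the valuation of each factorial by the truncated Legendre formula, the valuations of the `q!` cancel
and what remains is the superadditivity of `n ↦ ⌊n / p^k⌋` for `k = 1, …, m`. -/
theorem norm_choose_mul_qNorm_le (m i j : ℕ) :
    ‖((i + j).choose i : ℚ_[p])‖ * (qNorm p m i * qNorm p m j) ≤ qNorm p m (i + j) := by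
  have hc : (i + j).choose i ≠ 0 := (Nat.choose_pos (Nat.le_add_right i j)).ne'
  have hp1 : (1 : ℝ) < p := by exact_mod_cast hp.out.one_lt
  have hp0 : (p : ℝ) ≠ 0 := by positivity
  have hv : padicValNat p ((i + j).choose i) + padicValNat p i.factorial + padicValNat p j.factorial
      = padicValNat p (i + j).factorial := by
    rw [← padicValNat.mul hc (Nat.factorial_ne_zero _), ← padicValNat.mul
      (mul_ne_zero hc (Nat.factorial_ne_zero _)) (Nat.factorial_ne_zero _),
      mul_assoc, Nat.choose_symm_add, mul_comm i.factorial, ← mul_assoc]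
    have := Nat.choose_mul_factorial_mul_factorial (Nat.le_add_left j i)
    rw [Nat.add_sub_cancel] at this
    rw [this]
  have hs : (∑ k ∈ Finset.range m, i / p ^ (k + 1)) + (∑ k ∈ Finset.range m, j / p ^ (k + 1)) ≤
      ∑ k ∈ Finset.range m, (i + j) / p ^ (k + 1) := by
    rw [← Finset.sum_add_distrib]
    exact Finset.sum_le_sum fun k _ => Nat.div_add_div_le_add_div
  rw [padicValNat_factorial_eq_sum_add p m i, padicValNat_factorial_eq_sum_add p m j,
    padicValNat_factorial_eq_sum_add p m (i + j)] at hv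
  simp only [qNorm, qFactorial]
  rw [norm_natCast_eq_zpow p hc, norm_natCast_eq_zpow p (Nat.factorial_ne_zero _),
    norm_natCast_eq_zpow p (Nat.factorial_ne_zero _), norm_natCast_eq_zpow p (Nat.factorial_ne_zero _),
    ← zpow_add₀ hp0, ← zpow_add₀ hp0]
  refine zpow_le_zpow_right₀ hp1.le ?_
  omega

/-- The radius `p ^ (- 1 / p ^ m)`. -/
def levelRadius (m : ℕ) : ℝ := (p : ℝ) ^ (-(1 / (p : ℝ) ^ m))

theorem levelRadius_pos (m : ℕ) : 0 < levelRadius p m :=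
  Real.rpow_pos_of_pos (by exact_mod_cast hp.out.pos) _

theorem levelRadius_lt_one (m : ℕ) : levelRadius p m < 1 := by
  have hp1 : (1 : ℝ) < p := by exact_mod_cast hp.out.one_lt
  refine Real.rpow_lt_one_of_one_lt_of_neg hp1 ?_
  have : (0 : ℝ) < 1 / (p : ℝ) ^ m := by positivity
  linarith

omit hp in
theorem levelRadius_pow (m n : ℕ) :
    levelRadius p m ^ n = (p : ℝ) ^ (-((n : ℝ) / (p : ℝ) ^ m)) := by
  rw [levelRadius, ← Real.rpow_natCast, ← Real.rpow_mul (by positivity)]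
  congr 1
  ring

theorem exists_lt_levelRadius {r : ℝ} (hr : r < 1) : ∃ m, r < levelRadius p m := by
  have hp1 : (1 : ℝ) < p := by exact_mod_cast hp.out.one_lt
  have h1 : Filter.Tendsto (fun m : ℕ => -(1 / (p : ℝ) ^ m)) Filter.atTop (nhds 0) := by
    simpa using ((tendsto_pow_atTop_atTop_of_one_lt hp1).inv_tendsto_atTop).neg
  have h2 : Filter.Tendsto (fun m => levelRadius p m) Filter.atTop (nhds 1) := by
    have := (Real.continuous_const_rpow (a := (p : ℝ)) (by positivity)).tendsto 0
    rw [Real.rpow_zero] at this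
    exact this.comp h1
  exact (h2.eventually (lt_mem_nhds hr)).exists

/-- With `q = ⌊n / p^m⌋`, the valuation of `q!` is at most `q`, hence at most `n / p^m`. -/
theorem levelRadius_pow_le_qNorm (m n : ℕ) : levelRadius p m ^ n ≤ qNorm p m n := by
  have hp1 : (1 : ℝ) < p := by exact_mod_cast hp.out.one_lt
  rw [levelRadius_pow, qNorm, qFactorial, norm_natCast_eq_zpow p (Nat.factorial_ne_zero _),
    ← Real.rpow_intCast]
  refine Real.rpow_le_rpow_of_exponent_le hp1.le ?_
  rw [Int.cast_neg, Int.cast_natCast]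
  have h1 : (padicValNat p (n / p ^ m).factorial : ℝ) ≤ ((n / p ^ m : ℕ) : ℝ) := by
    exact_mod_cast padicValNat_factorial_le (p := p) _
  have h2 : ((n / p ^ m : ℕ) : ℝ) ≤ (n : ℝ) / (p : ℝ) ^ m := by
    simpa using Nat.cast_div_le (α := ℝ) (m := n) (n := p ^ m)
  linarith

/-- The valuation of `q!` is at least `⌊q / p⌋ = ⌊n / p^(m+1)⌋ > n / p^(m+1) - 1`. The factor `p`
pays for rounding down, and the next radius appears because only the first Legendre term is kept. -/
theorem qNorm_le_levelRadius_pow (m n : ℕ) : qNorm p m n ≤ p * levelRadius p (m + 1) ^ n := by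
  have hp1 : (1 : ℝ) < p := by exact_mod_cast hp.out.one_lt
  have hp0 : (0 : ℝ) < p := by positivity
  rw [levelRadius_pow, qNorm, qFactorial, norm_natCast_eq_zpow p (Nat.factorial_ne_zero _),
    ← Real.rpow_intCast]
  nth_rewrite 2 [← Real.rpow_one (p : ℝ)]
  rw [← Real.rpow_add hp0]
  refine Real.rpow_le_rpow_of_exponent_le hp1.le ?_
  rw [Int.cast_neg, Int.cast_natCast]
  have h1 : n / p ^ (m + 1) ≤ padicValNat p (n / p ^ m).factorial := by
    rw [padicValNat_factorial_eq_add, Nat.div_div_eq_div_mul, ← pow_succ]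
    exact Nat.le_add_right _ _
  have h2 : (n : ℝ) / (p : ℝ) ^ (m + 1) < (n / p ^ (m + 1) : ℕ) + 1 := by
    have := Nat.lt_succ_floor ((n : ℝ) / ((p ^ (m + 1) : ℕ) : ℝ))
    rw [Nat.floor_div_eq_div] at this
    push_cast at this ⊢
    exact this
  have h3 : ((n / p ^ (m + 1) : ℕ) : ℝ) ≤ padicValNat p (n / p ^ m).factorial := by
    exact_mod_cast h1
  linarith

/-- The product of the `p`-adic norms of the `⌊ν_ij / p ^ m⌋!`. -/
def levelNorm (m : ℕ) (ν : MultiIndex) : ℝ := ∏ ij, qNorm p m (ν ij)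

theorem levelNorm_pos (m : ℕ) (ν : MultiIndex) : 0 < levelNorm p m ν :=
  Finset.prod_pos fun _ _ => qNorm_pos p m _

theorem levelNorm_zero (m : ℕ) : levelNorm p m 0 = 1 := by simp [levelNorm, qNorm_zero]

theorem levelNorm_add_le (m : ℕ) (α β : MultiIndex) :
    levelNorm p m (α + β) ≤ levelNorm p m α * levelNorm p m β := by
  simp only [levelNorm, ← Finset.prod_mul_distrib]
  exact Finset.prod_le_prod (fun _ _ => (qNorm_pos p m _).le) fun _ _ => qNorm_add_le p m _ _

theorem levelRadius_pow_le_levelNorm (m : ℕ) (ν : MultiIndex) :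
    levelRadius p m ^ ν.degree ≤ levelNorm p m ν := by
  rw [Finsupp.degree_eq_sum, ← Finset.prod_pow_eq_pow_sum]
  exact Finset.prod_le_prod (fun _ _ => pow_nonneg (levelRadius_pos p m).le _)
    fun _ _ => levelRadius_pow_le_qNorm p m _

theorem levelNorm_le_levelRadius_pow (m : ℕ) (ν : MultiIndex) :
    levelNorm p m ν ≤ (p : ℝ) ^ 4 * levelRadius p (m + 1) ^ ν.degree := by
  rw [Finsupp.degree_eq_sum, ← Finset.prod_pow_eq_pow_sum]
  have : ((p : ℝ) ^ 4) = ∏ _ij : Fin 2 × Fin 2, (p : ℝ) := by simp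
  rw [this, ← Finset.prod_mul_distrib]
  exact Finset.prod_le_prod (fun _ _ => (qNorm_pos p m _).le)
    fun _ _ => qNorm_le_levelRadius_pow p m _

theorem levelNorm_single (m : ℕ) (ij : Fin 2 × Fin 2) (k : ℕ) :
    levelNorm p m (Finsupp.single ij k) = qNorm p m k := by
  rw [levelNorm, Finset.prod_eq_single ij]
  · simp
  · intro b _ hb
    simp [Finsupp.single_eq_of_ne hb, qNorm_zero]
  · simp

end QFactorial

/-! ### Elements with partial divided powers -/

section DividedPowers

variable {p : ℕ} [hp : Fact p.Prime] {A : Type*} [CommRing A] [Algebra ℚ_[p] A]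

/-- The property of a subring to be stable under multiplication by `p`-adic integers. -/
def IsIntegralStable (W : Subring A) : Prop := ∀ c : ℚ_[p], ‖c‖ ≤ 1 → ∀ x ∈ W, c • x ∈ W

/-- The element `x` has divided powers of level `m` in `W`. -/
def HasDivPow (m : ℕ) (W : Subring A) (x : A) : Prop :=
  ∀ k, ((qFactorial p m k : ℚ_[p])⁻¹) • x ^ k ∈ W

theorem HasDivPow.add {m : ℕ} {W : Subring A} (hW : IsIntegralStable (p := p) W) {x y : A}
    (hx : HasDivPow (p := p) m W x) (hy : HasDivPow (p := p) m W y) :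
    HasDivPow (p := p) m W (x + y) := by
  intro k
  rw [add_pow, Finset.smul_sum]
  refine W.sum_mem fun i hi => ?_
  obtain ⟨j, rfl⟩ := Nat.exists_eq_add_of_le (Nat.lt_succ_iff.1 (Finset.mem_range.1 hi))
  rw [Nat.add_sub_cancel_left]
  have hi0 := qFactorial_ne_zero p m i
  have hj0 := qFactorial_ne_zero p m j
  -- Each binomial term is a product of partial divided powers of `x` and `y`, scaled by the
  -- modified binomial coefficient, which is integral.
  have key : ((qFactorial p m (i + j) : ℚ_[p])⁻¹) • (x ^ i * y ^ j * ((i + j).choose i : A)) =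
      (((qFactorial p m (i + j) : ℚ_[p])⁻¹) * (((i + j).choose i : ℚ_[p]) *
        (qFactorial p m i * qFactorial p m j))) •
      ((((qFactorial p m i : ℚ_[p])⁻¹) • x ^ i) * (((qFactorial p m j : ℚ_[p])⁻¹) • y ^ j)) := by
    rw [smul_mul_smul_comm, smul_smul, mul_comm _ ((i + j).choose i : A), ← nsmul_eq_mul,
      ← Nat.cast_smul_eq_nsmul ℚ_[p], smul_smul]
    congr 1
    field_simp
  rw [key]
  refine hW _ ?_ _ (W.mul_mem (hx i) (hy j))
  rw [norm_mul, norm_inv, norm_mul, norm_mul]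
  exact inv_mul_le_one_of_le₀ (norm_choose_mul_qNorm_le p m i j) (norm_nonneg _)

/-- Only one factor needs partial divided powers: the denominator is spent on `x ^ k`, and `w ^ k`
is already in `W`. -/
theorem HasDivPow.mul {m : ℕ} {W : Subring A} {x w : A}
    (hx : HasDivPow (p := p) m W x) (hw : w ∈ W) : HasDivPow (p := p) m W (x * w) := by
  intro k
  rw [mul_pow, ← smul_mul_assoc]
  exact W.mul_mem (hx k) (W.pow_mem hw k)

end DividedPowers

end

/-! ### Weights on polynomial functions and the level of a distribution. -/

section

open Filter Topology

variable {p : ℕ} [hp : Fact p.Prime]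

namespace Dist

/-- The coefficient of a monomial in a polynomial function. -/
def Poly.coeff (ν : MultiIndex) : Poly p →ₗ[ℚ_[p]] ℚ_[p] := MvPolynomial.lcoeff ℚ_[p] ν

/-- The exponents of the monomials that occur in a polynomial function. -/
def Poly.support (P : Poly p) : Finset MultiIndex := MvPolynomial.support P

open Classical in
theorem Poly.coeff_mon (μ ν : MultiIndex) :
    Poly.coeff ν (Poly.mon p μ) = if μ = ν then 1 else 0 := MvPolynomial.coeff_monomial _ _ _

theorem Poly.coeff_mul (P R : Poly p) (ν : MultiIndex) : Poly.coeff ν (P * R) =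
    ∑ x ∈ Finset.HasAntidiagonal.antidiagonal ν, Poly.coeff x.1 P * Poly.coeff x.2 R :=
  MvPolynomial.coeff_mul _ _ _

theorem Poly.coeff_one (ν : MultiIndex) :
    Poly.coeff ν (1 : Poly p) = if 0 = ν then 1 else 0 := MvPolynomial.coeff_one _

theorem Poly.mem_support {P : Poly p} {ν : MultiIndex} :
    ν ∈ Poly.support P ↔ Poly.coeff ν P ≠ 0 := MvPolynomial.mem_support_iff

theorem Poly.eq_sum (P : Poly p) :
    P = ∑ ν ∈ Poly.support P, Poly.coeff ν P • Poly.mon p ν := by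
  have h := MvPolynomial.support_sum_monomial_coeff (R := ℚ_[p]) P
  refine h.symm.trans (Finset.sum_congr rfl fun ν _ => ?_)
  have h2 := MvPolynomial.smul_monomial (R := ℚ_[p]) (s := ν) (a := (1 : ℚ_[p]))
    (Poly.coeff ν P)
  rw [smul_eq_mul, mul_one] at h2
  exact h2.symm

theorem Poly.map_eq_sum {M : Type*} [AddCommGroup M] [Module ℚ_[p] M] (φ : Poly p →ₗ[ℚ_[p]] M)
    (P : Poly p) : φ P = ∑ ν ∈ Poly.support P, Poly.coeff ν P • φ (Poly.mon p ν) := by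
  conv_lhs => rw [Poly.eq_sum P]
  rw [map_sum]
  exact Finset.sum_congr rfl fun ν _ => map_smul _ _ _

theorem Poly.mon_eq_prod (μ : MultiIndex) : Poly.mon p μ = ∏ ij, Poly.z p ij ^ μ ij := by
  have h := MvPolynomial.monomial_eq (R := ℚ_[p]) (s := μ) (a := 1)
  rw [MvPolynomial.C_1, one_mul, Finsupp.prod_fintype _ _ (fun i => pow_zero _)] at h
  exact h

/-- The polynomial functions with `|ξ_ν| w(ν) ≤ 1` for all coefficients `ξ_ν`. -/
def weightSubring (w : MultiIndex → ℝ) (h0 : ∀ ν, 0 ≤ w ν) (h1 : w 0 = 1)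
    (hw : ∀ α β, w (α + β) ≤ w α * w β) : Subring (Poly p) where
  carrier := {P | ∀ ν, ‖Poly.coeff ν P‖ * w ν ≤ 1}
  zero_mem' ν := by simp
  one_mem' ν := by
    rw [Poly.coeff_one]
    split_ifs with h
    · simp [← h, h1]
    · simp
  add_mem' {P R} hP hR ν := by
    rw [map_add]
    refine (mul_le_mul_of_nonneg_right (Padic.nonarchimedean _ _) (h0 ν)).trans ?_
    rw [max_mul_of_nonneg _ _ (h0 ν)]
    exact max_le (hP ν) (hR ν)
  neg_mem' {P} hP ν := by simpa using hP ν
  mul_mem' {P R} hP hR ν := by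
    rw [Poly.coeff_mul]
    rcases (h0 ν).eq_or_lt with h | h
    · simp [← h]
    rw [← le_div_iff₀ h]
    refine IsUltrametricDist.norm_sum_le_of_forall_le_of_nonneg (by positivity) fun x hx => ?_
    rw [le_div_iff₀ h, norm_mul, ← Finset.HasAntidiagonal.mem_antidiagonal.1 hx]
    have h3 := hw x.1 x.2
    calc _ ≤ ‖Poly.coeff x.1 P‖ * ‖Poly.coeff x.2 R‖ * (w x.1 * w x.2) := by gcongr
      _ = (‖Poly.coeff x.1 P‖ * w x.1) * (‖Poly.coeff x.2 R‖ * w x.2) := by ring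
      _ ≤ 1 := mul_le_one₀ (hP _) (mul_nonneg (norm_nonneg _) (h0 _)) (hR _)

theorem isIntegralStable_weightSubring {w : MultiIndex → ℝ} (h0 : ∀ ν, 0 ≤ w ν) (h1 : w 0 = 1)
    (hw : ∀ α β, w (α + β) ≤ w α * w β) :
    IsIntegralStable (p := p) (weightSubring (p := p) w h0 h1 hw) := by
  intro c hc P hP ν
  rw [map_smul, smul_eq_mul, norm_mul, mul_assoc]
  exact mul_le_one₀ hc (mul_nonneg (norm_nonneg _) (h0 _)) (hP ν)

theorem mon_smul_mem_weightSubring {w : MultiIndex → ℝ} (h0 : ∀ ν, 0 ≤ w ν) (h1 : w 0 = 1)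
    (hw : ∀ α β, w (α + β) ≤ w α * w β) {c : ℚ_[p]} {μ : MultiIndex} (h : ‖c‖ * w μ ≤ 1) :
    c • Poly.mon p μ ∈ weightSubring (p := p) w h0 h1 hw := by
  intro ν
  rw [map_smul, Poly.coeff_mon, smul_eq_mul]
  split_ifs with h2
  · subst h2
    simpa using h
  · simp

/-- The subring of weight `w` is the unit ball dual to the condition `|φ(z^ν)| ≤ w(ν)`; this pairing
turns statements about subrings into bounds on moments. -/
theorem norm_le_of_mem_weightSubring {w : MultiIndex → ℝ} {h0 : ∀ ν, 0 ≤ w ν} {h1 : w 0 = 1}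
    {hw : ∀ α β, w (α + β) ≤ w α * w β} {φ : Poly p →ₗ[ℚ_[p]] ℚ_[p]} {C : ℝ} (hC : 0 ≤ C)
    (h : ∀ ν, ‖φ (Poly.mon p ν)‖ ≤ C * w ν) {P : Poly p}
    (hP : P ∈ weightSubring (p := p) w h0 h1 hw) : ‖φ P‖ ≤ C := by
  rw [Poly.map_eq_sum φ P]
  refine IsUltrametricDist.norm_sum_le_of_forall_le_of_nonneg hC fun ν _ => ?_
  rw [smul_eq_mul, norm_mul]
  calc _ ≤ ‖Poly.coeff ν P‖ * (C * w ν) := by gcongr; exact h ν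
    _ = C * (‖Poly.coeff ν P‖ * w ν) := by ring
    _ ≤ C := mul_le_of_le_one_right hC (hP ν)

variable (p) in
/-- The polynomials `∑ ξ_ν z ^ ν` such that `ξ_ν` is an integral multiple of the inverse of the
product of the `⌊ν_ij / p ^ m⌋!`. -/
def levelSubring (m : ℕ) : Subring (Poly p) :=
  weightSubring (levelNorm p m) (fun ν => (levelNorm_pos p m ν).le) (levelNorm_zero p m)
    (levelNorm_add_le p m)

theorem z_hasDivPow (m : ℕ) (ij : Fin 2 × Fin 2) :
    HasDivPow (p := p) m (levelSubring p m) (Poly.z p ij) := by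
  intro k
  have h : Poly.z p ij ^ k = Poly.mon p (Finsupp.single ij k) := by
    rw [Poly.mon_eq_prod, Finset.prod_eq_single ij]
    · simp
    · intro b _ hb
      simp [Finsupp.single_eq_of_ne hb]
    · simp
  rw [h]
  refine mon_smul_mem_weightSubring _ _ _ ?_
  rw [levelNorm_single, norm_inv]
  exact (inv_mul_cancel₀ (qNorm_pos p m k).ne').le

theorem _root_.WideOpen.HasDivPow.mem {A : Type*} [CommRing A] [Algebra ℚ_[p] A] {m : ℕ} {W : Subring A} {x : A}
    (hx : HasDivPow (p := p) m W x) (hW : IsIntegralStable (p := p) W) : x ∈ W := by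
  have h := hW (qFactorial p m 1 : ℚ_[p]) (qNorm_le_one p m 1) _ (hx 1)
  rwa [smul_smul, mul_inv_cancel₀ (qFactorial_ne_zero p m 1), one_smul, pow_one] at h

theorem z_mem (m : ℕ) (ij : Fin 2 × Fin 2) : Poly.z p ij ∈ levelSubring p m :=
  (z_hasDivPow m ij).mem (isIntegralStable_weightSubring _ _ _)

variable (p) in
/-- The product of the `⌊μ_ij / p ^ m⌋!`. -/
def levelFactorial (m : ℕ) (μ : MultiIndex) : ℕ := ∏ ij, qFactorial p m (μ ij)

theorem norm_levelFactorial (m : ℕ) (μ : MultiIndex) :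
    ‖(levelFactorial p m μ : ℚ_[p])‖ = levelNorm p m μ := by
  rw [levelFactorial, Nat.cast_prod, norm_prod]
  rfl

theorem levelFactorial_ne_zero (m : ℕ) (μ : MultiIndex) : (levelFactorial p m μ : ℚ_[p]) ≠ 0 := by
  rw [← norm_pos_iff, norm_levelFactorial]
  exact levelNorm_pos p m μ

/-- A homomorphism respects the level as soon as the images of the four coordinates have partial
divided powers. This is applied to the comultiplication and to the Gauss coordinate change. -/
theorem map_mon_mem {A : Type*} [CommRing A] [Algebra ℚ_[p] A] {m : ℕ} {W : Subring A}
    (f : Poly p →ₐ[ℚ_[p]] A) (hf : ∀ ij, HasDivPow (p := p) m W (f (Poly.z p ij)))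
    (μ : MultiIndex) : ((levelFactorial p m μ : ℚ_[p])⁻¹) • f (Poly.mon p μ) ∈ W := by
  have h : ((levelFactorial p m μ : ℚ_[p])⁻¹) • f (Poly.mon p μ) =
      ∏ ij, ((qFactorial p m (μ ij) : ℚ_[p])⁻¹) • f (Poly.z p ij) ^ μ ij := by
    rw [Poly.mon_eq_prod, map_prod, levelFactorial, Nat.cast_prod, ← Finset.prod_inv_distrib]
    simp only [map_pow, Algebra.smul_def, Finset.prod_mul_distrib, map_prod]
  rw [h]
  exact W.prod_mem fun ij _ => hf ij _

variable (p) in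
/-- The subring of the `P ⊗ R` with `P` and `R` in `levelSubring p m`. -/
def levelTensor (m : ℕ) : Subring (Poly p ⊗[ℚ_[p]] Poly p) where
  carrier := AddSubgroup.closure
    {t | ∃ P ∈ levelSubring p m, ∃ R ∈ levelSubring p m, t = P ⊗ₜ[ℚ_[p]] R}
  zero_mem' := AddSubgroup.zero_mem _
  one_mem' := AddSubgroup.subset_closure ⟨1, Subring.one_mem _, 1, Subring.one_mem _, rfl⟩
  add_mem' := AddSubgroup.add_mem _
  neg_mem' := AddSubgroup.neg_mem _
  mul_mem' {s t} hs ht := by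
    induction hs, ht using AddSubgroup.closure_induction₂ with
    | mem x y hx hy =>
      obtain ⟨P, hP, R, hR, rfl⟩ := hx
      obtain ⟨P', hP', R', hR', rfl⟩ := hy
      exact AddSubgroup.subset_closure ⟨P * P', Subring.mul_mem _ hP hP', R * R',
        Subring.mul_mem _ hR hR', Algebra.TensorProduct.tmul_mul_tmul _ _ _ _⟩
    | zero_left x _ => rw [zero_mul]; exact AddSubgroup.zero_mem _
    | zero_right x _ => rw [mul_zero]; exact AddSubgroup.zero_mem _
    | add_left x y z _ _ _ h1 h2 => rw [add_mul]; exact AddSubgroup.add_mem _ h1 h2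
    | add_right x y z _ _ _ h1 h2 => rw [mul_add]; exact AddSubgroup.add_mem _ h1 h2
    | neg_left x y _ _ h => rw [neg_mul]; exact AddSubgroup.neg_mem _ h
    | neg_right x y _ _ h => rw [mul_neg]; exact AddSubgroup.neg_mem _ h

theorem tmul_mem_levelTensor {m : ℕ} {P R : Poly p} (hP : P ∈ levelSubring p m)
    (hR : R ∈ levelSubring p m) : P ⊗ₜ[ℚ_[p]] R ∈ levelTensor p m :=
  AddSubgroup.subset_closure ⟨P, hP, R, hR, rfl⟩

theorem isIntegralStable_levelTensor (m : ℕ) : IsIntegralStable (p := p) (levelTensor p m) := by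
  intro c hc x hx
  refine AddSubgroup.closure_induction (p := fun x _ => c • x ∈ levelTensor p m)
    ?_ ?_ ?_ ?_ hx
  · rintro _ ⟨P, hP, R, hR, rfl⟩
    rw [TensorProduct.smul_tmul']
    exact tmul_mem_levelTensor (isIntegralStable_weightSubring _ _ _ c hc P hP) hR
  · rw [smul_zero]
    exact Subring.zero_mem _
  · intro x y _ _ hx hy
    rw [smul_add]
    exact Subring.add_mem _ hx hy
  · intro x _ hx
    rw [smul_neg]
    exact Subring.neg_mem _ hx

/-- The element `z_ij ⊗ 1 + 1 ⊗ z_ij + ∑ z_ik ⊗ z_kj` is a sum of elements that inherit partial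
divided powers from the coordinates; in the quadratic terms one tensor factor suffices for this. -/
theorem comul_hasDivPow (m : ℕ) (ij : Fin 2 × Fin 2) :
    HasDivPow (p := p) m (levelTensor p m) (Poly.comul p (Poly.z p ij)) := by
  have hl : ∀ ij, HasDivPow (p := p) m (levelTensor p m) (Poly.z p ij ⊗ₜ[ℚ_[p]] 1) := by
    intro ij k
    rw [Algebra.TensorProduct.tmul_pow, one_pow, TensorProduct.smul_tmul']
    exact tmul_mem_levelTensor (z_hasDivPow m ij k) (Subring.one_mem _)
  have hr : ∀ ij, HasDivPow (p := p) m (levelTensor p m) (1 ⊗ₜ[ℚ_[p]] Poly.z p ij) := by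
    intro ij k
    rw [Algebra.TensorProduct.tmul_pow, one_pow, ← TensorProduct.tmul_smul]
    exact tmul_mem_levelTensor (Subring.one_mem _) (z_hasDivPow m ij k)
  have hm : ∀ ij kl, HasDivPow (p := p) m (levelTensor p m)
      (Poly.z p ij ⊗ₜ[ℚ_[p]] Poly.z p kl) := by
    intro ij kl
    have h := (hl ij).mul (tmul_mem_levelTensor (Subring.one_mem _) (z_mem m kl))
    rwa [Algebra.TensorProduct.tmul_mul_tmul, mul_one, one_mul] at h
  have hs := isIntegralStable_levelTensor (p := p) m
  rw [Poly.comul_z, Fin.sum_univ_two]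
  exact ((hl ij).add hs (hr ij)).add hs ((hm _ _).add hs (hm _ _))

theorem norm_le_of_mem_levelTensor {m : ℕ} {φ φ' : Poly p →ₗ[ℚ_[p]] ℚ_[p]} {C C' : ℝ} (hC : 0 ≤ C)
    (hC' : 0 ≤ C') (h : ∀ ν, ‖φ (Poly.mon p ν)‖ ≤ C * levelNorm p m ν)
    (h' : ∀ ν, ‖φ' (Poly.mon p ν)‖ ≤ C' * levelNorm p m ν) {t : Poly p ⊗[ℚ_[p]] Poly p}
    (ht : t ∈ levelTensor p m) :
    ‖LinearMap.mul' ℚ_[p] ℚ_[p] (TensorProduct.map φ φ' t)‖ ≤ C * C' := by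
  refine AddSubgroup.closure_induction
    (p := fun t _ => ‖LinearMap.mul' ℚ_[p] ℚ_[p] (TensorProduct.map φ φ' t)‖ ≤ C * C')
    ?_ ?_ ?_ ?_ ht
  · rintro _ ⟨P, hP, R, hR, rfl⟩
    rw [TensorProduct.map_tmul, LinearMap.mul'_apply, norm_mul]
    gcongr
    · exact norm_le_of_mem_weightSubring hC h hP
    · exact norm_le_of_mem_weightSubring hC' h' hR
  · simpa using mul_nonneg hC hC'
  · intro x y _ _ hx hy
    rw [map_add, map_add]
    exact (Padic.nonarchimedean _ _).trans (max_le hx hy)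
  · intro x _ hx
    rwa [map_neg, map_neg, norm_neg]

/-- The distributions whose moments are bounded by `C` times those of level `m`. -/
def LevelBound (m : ℕ) (C : ℝ) (l : Dist p) : Prop :=
  ∀ ν, ‖l (Fn.monomial ν)‖ ≤ C * levelNorm p m ν

theorem restrict_mul_mon (l l' : Dist p) (μ : MultiIndex) : (l * l') (Fn.monomial μ) =
    LinearMap.mul' ℚ_[p] ℚ_[p] (TensorProduct.map (restrict l).ofConv (restrict l').ofConv
      (Poly.comul p (Poly.mon p μ))) := by
  rw [← restrict_mon, restrict_mul]
  rfl

/-- The comultiplication sends `z^μ / ∏ q_ij!` to integral combinations of tensors from the level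
subring, on which `l ⊗ l'` is at most `C C'`; multiplying back by the factorials gives the weight of
`μ`. -/
theorem LevelBound.mul {m : ℕ} {C C' : ℝ} {l l' : Dist p} (hC : 0 ≤ C) (hC' : 0 ≤ C')
    (h : LevelBound m C l) (h' : LevelBound m C' l') : LevelBound m (C * C') (l * l') := by
  intro μ
  have key := norm_le_of_mem_levelTensor hC hC' (φ := (restrict l).ofConv)
    (φ' := (restrict l').ofConv) (fun ν => by rw [restrict_mon]; exact h ν)
    (fun ν => by rw [restrict_mon]; exact h' ν) (map_mon_mem (Poly.comul p) (comul_hasDivPow m) μ)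
  rw [map_smul, map_smul, ← restrict_mul_mon, norm_smul, norm_inv, norm_levelFactorial,
    inv_mul_le_iff₀ (levelNorm_pos p m μ)] at key
  rwa [mul_comm] at key

theorem LevelBound.add {m : ℕ} {C : ℝ} {l l' : Dist p} (h : LevelBound m C l)
    (h' : LevelBound m C l') : LevelBound m C (l + l') := fun ν =>
  (Padic.nonarchimedean (l (Fn.monomial ν)) (l' (Fn.monomial ν))).trans (max_le (h ν) (h' ν))

theorem LevelBound.smul {m : ℕ} {C : ℝ} {l : Dist p} (c : ℚ_[p]) (h : LevelBound m C l) :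
    LevelBound m (‖c‖ * C) (c • l) := fun ν => by
  change ‖c * l (Fn.monomial ν)‖ ≤ _
  rw [norm_mul, mul_assoc]
  gcongr
  exact h ν

theorem LevelBound.neg {m : ℕ} {C : ℝ} {l : Dist p} (h : LevelBound m C l) :
    LevelBound m C (-l) := fun ν => by
  change ‖-l (Fn.monomial ν)‖ ≤ _
  rw [norm_neg]
  exact h ν

theorem LevelBound.mono {m : ℕ} {C C' : ℝ} {l : Dist p} (h : LevelBound m C l) (hC : C ≤ C') :
    LevelBound m C' l := fun ν =>
  (h ν).trans (mul_le_mul_of_nonneg_right hC (levelNorm_pos p m ν).le)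

end Dist

end

section

open Filter Topology

variable {p : ℕ} [hp : Fact p.Prime]

namespace Dist

/-! ### The Gauss decomposition -/

variable (p) in
/-- The entries of `u * t * v - 1` for `u = !![1, z₀₁; 0, 1]`, `t = !![1 + z₀₀, 0; 0, 1 + z₁₁]` and
`v = !![1, 0; z₁₀, 1]`. -/
def gaussEntry : Fin 2 × Fin 2 → Poly p
  | (0, 0) => Poly.z p (0, 0) + Poly.z p (0, 1) * Poly.z p (1, 0) * (1 + Poly.z p (1, 1))
  | (0, 1) => Poly.z p (0, 1) * (1 + Poly.z p (1, 1))
  | (1, 0) => Poly.z p (1, 0) * (1 + Poly.z p (1, 1))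
  | (1, 1) => Poly.z p (1, 1)

variable (p) in
/-- The coordinate change given by the Gauss decomposition. -/
def gaussMap : Poly p →ₐ[ℚ_[p]] Poly p :=
  (MvPolynomial.aeval (gaussEntry p) : MvPolynomial (Fin 2 × Fin 2) ℚ_[p] →ₐ[ℚ_[p]] Poly p)

theorem gaussMap_z (ij : Fin 2 × Fin 2) : gaussMap p (Poly.z p ij) = gaussEntry p ij :=
  MvPolynomial.aeval_X _ _

theorem gaussMap_hasDivPow (m : ℕ) (ij : Fin 2 × Fin 2) :
    HasDivPow (p := p) m (levelSubring p m) (gaussMap p (Poly.z p ij)) := by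
  have hu : (1 + Poly.z p (1, 1)) ∈ levelSubring p m :=
    Subring.add_mem _ (Subring.one_mem _) (z_mem m _)
  have hs : IsIntegralStable (p := p) (levelSubring p m) := isIntegralStable_weightSubring _ _ _
  rw [gaussMap_z]
  match ij with
  | (0, 0) => exact (z_hasDivPow m _).add hs (((z_hasDivPow m _).mul (z_mem m _)).mul hu)
  | (0, 1) => exact (z_hasDivPow m _).mul hu
  | (1, 0) => exact (z_hasDivPow m _).mul hu
  | (1, 1) => exact z_hasDivPow m _

/-- The compatibility of the coordinate change with the level, in terms of its matrix coefficients.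
-/
theorem norm_coeff_gaussMap_mul_le (m : ℕ) (μ ν : MultiIndex) :
    ‖Poly.coeff ν (gaussMap p (Poly.mon p μ))‖ * levelNorm p m ν ≤ levelNorm p m μ := by
  have h := map_mon_mem (gaussMap p) (gaussMap_hasDivPow m) μ ν
  rwa [map_smul, smul_eq_mul, norm_mul, norm_inv, norm_levelFactorial, mul_assoc,
    inv_mul_le_iff₀ (levelNorm_pos p m μ), mul_one] at h

variable (p) in
/-- The polynomials of order at least `d` with integral coefficients. -/
def orderGE (d : ℕ) : AddSubgroup (Poly p) where
  carrier := {P | ∀ ν, ‖Poly.coeff ν P‖ ≤ 1 ∧ (Poly.coeff ν P ≠ 0 → d ≤ ν.degree)}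
  zero_mem' ν := by simp
  add_mem' {P R} hP hR ν := by
    rw [map_add]
    refine ⟨(Padic.nonarchimedean _ _).trans (max_le (hP ν).1 (hR ν).1), fun h => ?_⟩
    by_cases h2 : Poly.coeff ν P = 0
    · exact (hR ν).2 (by simpa [h2] using h)
    · exact (hP ν).2 h2
  neg_mem' {P} hP ν := by simpa using hP ν

theorem orderGE_anti {d e : ℕ} (h : d ≤ e) : orderGE p e ≤ orderGE p d := fun _ hP ν =>
  ⟨(hP ν).1, fun h2 => h.trans ((hP ν).2 h2)⟩

theorem mul_mem_orderGE {d e : ℕ} {P R : Poly p} (hP : P ∈ orderGE p d) (hR : R ∈ orderGE p e) :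
    P * R ∈ orderGE p (d + e) := by
  intro ν
  rw [Poly.coeff_mul]
  refine ⟨IsUltrametricDist.norm_sum_le_of_forall_le_of_nonneg zero_le_one fun x _ => ?_, fun h => ?_⟩
  · rw [norm_mul]
    exact mul_le_one₀ (hP _).1 (norm_nonneg _) (hR _).1
  · obtain ⟨x, hx, h2⟩ := Finset.exists_ne_zero_of_sum_ne_zero h
    rw [← Finset.HasAntidiagonal.mem_antidiagonal.1 hx, map_add]
    exact add_le_add ((hP _).2 (left_ne_zero_of_mul h2)) ((hR _).2 (right_ne_zero_of_mul h2))

theorem mon_mem_orderGE (μ : MultiIndex) : Poly.mon p μ ∈ orderGE p μ.degree := by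
  intro ν
  rw [Poly.coeff_mon]
  split_ifs with h
  · simp [h]
  · simp

theorem z_mem_orderGE (ij : Fin 2 × Fin 2) : Poly.z p ij ∈ orderGE p 1 := by
  have h := mon_mem_orderGE (p := p) (Finsupp.single ij 1)
  rwa [Finsupp.degree_single, Poly.mon_single] at h

theorem one_mem_orderGE : (1 : Poly p) ∈ orderGE p 0 := by
  have h := mon_mem_orderGE (p := p) 0
  rwa [map_zero, Poly.mon_zero] at h

/-- The Gauss coordinates agree with the matrix coordinates to first order, and all higher terms
have integral coefficients. Hence the coordinate change is unipotent for the filtration by order. -/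
theorem gaussMap_z_sub_mem (ij : Fin 2 × Fin 2) :
    gaussMap p (Poly.z p ij) - Poly.z p ij ∈ orderGE p 2 := by
  rw [gaussMap_z]
  match ij with
  | (0, 0) =>
    have h := mul_mem_orderGE (mul_mem_orderGE (z_mem_orderGE (p := p) (0, 1)) (z_mem_orderGE (1, 0)))
      ((orderGE p 0).add_mem one_mem_orderGE (orderGE_anti zero_le_one (z_mem_orderGE (1, 1))))
    simpa [gaussEntry] using h
  | (0, 1) =>
    have h := mul_mem_orderGE (z_mem_orderGE (p := p) (0, 1)) (z_mem_orderGE (1, 1))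
    simpa [gaussEntry, mul_add] using h
  | (1, 0) =>
    have h := mul_mem_orderGE (z_mem_orderGE (p := p) (1, 0)) (z_mem_orderGE (1, 1))
    simpa [gaussEntry, mul_add] using h
  | (1, 1) =>
    simp [gaussEntry]

theorem gaussMap_mon_sub_mem (μ : MultiIndex) :
    gaussMap p (Poly.mon p μ) - Poly.mon p μ ∈ orderGE p (μ.degree + 1) := by
  have hadd : ∀ (P R : Poly p) (d e : ℕ), P ∈ orderGE p d → R ∈ orderGE p e →
      gaussMap p P - P ∈ orderGE p (d + 1) → gaussMap p R - R ∈ orderGE p (e + 1) →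
      gaussMap p (P * R) - P * R ∈ orderGE p (d + e + 1) := by
    intro P R d e hP hR h1 h2
    have h3 : gaussMap p R ∈ orderGE p e := by
      have := (orderGE p e).add_mem (orderGE_anti (Nat.le_succ e) h2) hR
      rwa [sub_add_cancel] at this
    -- Telescoping: in each summand one factor gains an order and the other keeps its own.
    have h4 : gaussMap p (P * R) - P * R =
        (gaussMap p P - P) * gaussMap p R + P * (gaussMap p R - R) := by
      rw [map_mul]
      ring
    rw [h4]
    refine AddSubgroup.add_mem _ ?_ ?_
    · have := mul_mem_orderGE h1 h3
      rwa [add_right_comm] at this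
    · rw [add_assoc]
      exact mul_mem_orderGE hP h2
  induction μ using Finsupp.induction_linear with
  | zero =>
    rw [Poly.mon_zero, map_one, sub_self]
    exact AddSubgroup.zero_mem _
  | add μ ν hμ hν =>
    rw [Poly.mon_add, map_add]
    exact hadd _ _ _ _ (mon_mem_orderGE μ) (mon_mem_orderGE ν) hμ hν
  | single ij n =>
    rw [Finsupp.degree_single]
    induction n with
    | zero =>
      rw [Finsupp.single_zero, Poly.mon_zero, map_one, sub_self]
      exact AddSubgroup.zero_mem _
    | succ n ih =>
      rw [Finsupp.single_add, Poly.mon_add]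
      have h := mon_mem_orderGE (p := p) (Finsupp.single ij n)
      rw [Finsupp.degree_single] at h
      rw [Poly.mon_single]
      exact hadd _ _ _ _ h (z_mem_orderGE ij) ih (gaussMap_z_sub_mem ij)

theorem norm_coeff_gaussMap_le_one (μ ν : MultiIndex) :
    ‖Poly.coeff ν (gaussMap p (Poly.mon p μ))‖ ≤ 1 := by
  have h := (orderGE p 0).add_mem (orderGE_anti (Nat.zero_le _) (gaussMap_mon_sub_mem (p := p) μ))
    (orderGE_anti (Nat.zero_le _) (mon_mem_orderGE μ))
  rw [sub_add_cancel] at h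
  exact (h ν).1

theorem degree_lt_of_coeff_gaussMap_ne_zero {μ ν : MultiIndex}
    (h : Poly.coeff ν (gaussMap p (Poly.mon p μ) - Poly.mon p μ) ≠ 0) : μ.degree < ν.degree :=
  (gaussMap_mon_sub_mem μ ν).2 h

theorem coeff_gaussMap_eq {μ ν : MultiIndex} (hμν : μ.degree < ν.degree) :
    Poly.coeff ν (gaussMap p (Poly.mon p μ) - Poly.mon p μ) =
      Poly.coeff ν (gaussMap p (Poly.mon p μ)) := by
  rw [map_sub, Poly.coeff_mon, if_neg (fun h => by simp [h] at hμν), sub_zero]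

/-- By unipotence the coordinate change alters the value at `z^μ` only by moments of degree larger
than `|μ|`, so bounds in higher degrees control the error. -/
theorem norm_apply_gaussMap_le {w : MultiIndex → ℝ} {C : ℝ}
    {φ : Poly p →ₗ[ℚ_[p]] ℚ_[p]} (hw : ∀ μ, 0 ≤ C * w μ)
    (hdeg : ∀ μ ν, μ.degree < ν.degree →
      ‖Poly.coeff ν (gaussMap p (Poly.mon p μ))‖ * (C * w ν) ≤ C * w μ) (μ : MultiIndex)
    (h : ∀ ν, μ.degree < ν.degree → ‖φ (Poly.mon p ν)‖ ≤ C * w ν) :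
    ‖φ (gaussMap p (Poly.mon p μ)) - φ (Poly.mon p μ)‖ ≤ C * w μ := by
  rw [← map_sub, Poly.map_eq_sum φ]
  refine IsUltrametricDist.norm_sum_le_of_forall_le_of_nonneg (hw μ) fun ν hν => ?_
  have hlt := degree_lt_of_coeff_gaussMap_ne_zero (Poly.mem_support.1 hν)
  rw [coeff_gaussMap_eq hlt, smul_eq_mul, norm_mul]
  exact (mul_le_mul_of_nonneg_left (h ν hlt) (norm_nonneg _)).trans (hdeg μ ν hlt)

/-- A linear form with sufficient decay is bounded in terms of its composition with the coordinate
change. -/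
theorem norm_le_of_norm_gaussMap_le {w : MultiIndex → ℝ} {C : ℝ}
    {φ : Poly p →ₗ[ℚ_[p]] ℚ_[p]} (hw : ∀ μ, 0 ≤ C * w μ)
    (hdeg : ∀ μ ν, μ.degree < ν.degree →
      ‖Poly.coeff ν (gaussMap p (Poly.mon p μ))‖ * (C * w ν) ≤ C * w μ)
    (hfin : {ν | C * w ν < ‖φ (Poly.mon p ν)‖}.Finite)
    (h : ∀ μ, ‖φ (gaussMap p (Poly.mon p μ))‖ ≤ C * w μ) (μ : MultiIndex) :
    ‖φ (Poly.mon p μ)‖ ≤ C * w μ := by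
  by_contra! hμ
  -- Descending induction on the degree. Only finitely many indices can violate the bound, so there
  -- is a violation of maximal degree; all higher moments satisfy the bound, which makes the
  -- correction at `κ` small and gives a contradiction.
  obtain ⟨κ, hκ, hmax⟩ := hfin.exists_maximalFor (Finsupp.degree) _ ⟨μ, hμ⟩
  have h1 := norm_apply_gaussMap_le hw hdeg κ fun ν hν => by
    by_contra! h2
    exact absurd (hmax h2 hν.le) (not_le.2 hν)
  have h2 : ‖φ (Poly.mon p κ)‖ ≤ C * w κ := by
    have h3 : φ (Poly.mon p κ) = φ (gaussMap p (Poly.mon p κ)) +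
      -(φ (gaussMap p (Poly.mon p κ)) - φ (Poly.mon p κ)) := by ring
    rw [h3]
    exact (Padic.nonarchimedean _ _).trans (max_le (h κ) ((norm_neg _).trans_le h1))
  exact absurd hκ (not_lt.2 h2)

theorem norm_gaussMap_le_of_norm_le {w : MultiIndex → ℝ} {C : ℝ}
    {φ : Poly p →ₗ[ℚ_[p]] ℚ_[p]} (hw : ∀ μ, 0 ≤ C * w μ)
    (hdeg : ∀ μ ν, μ.degree < ν.degree →
      ‖Poly.coeff ν (gaussMap p (Poly.mon p μ))‖ * (C * w ν) ≤ C * w μ)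
    (h : ∀ μ, ‖φ (Poly.mon p μ)‖ ≤ C * w μ) (μ : MultiIndex) :
    ‖φ (gaussMap p (Poly.mon p μ))‖ ≤ C * w μ := by
  have h1 := norm_apply_gaussMap_le hw hdeg μ fun ν _ => h ν
  have h3 : φ (gaussMap p (Poly.mon p μ)) =
    (φ (gaussMap p (Poly.mon p μ)) - φ (Poly.mon p μ)) + φ (Poly.mon p μ) := by ring
  rw [h3]
  exact (Padic.nonarchimedean _ _).trans (max_le h1 (h μ))

theorem norm_le_of_mem_orderGE {φ : Poly p →ₗ[ℚ_[p]] ℚ_[p]} {C r : ℝ} (hC : 0 ≤ C) (h0 : 0 ≤ r)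
    (h1 : r ≤ 1) (h : ∀ μ, ‖φ (Poly.mon p μ)‖ ≤ C * r ^ μ.degree) {d : ℕ} {P : Poly p}
    (hP : P ∈ orderGE p d) : ‖φ P‖ ≤ C * r ^ d := by
  rw [Poly.map_eq_sum φ]
  refine IsUltrametricDist.norm_sum_le_of_forall_le_of_nonneg (by positivity) fun ν hν => ?_
  rw [smul_eq_mul, norm_mul]
  refine (mul_le_of_le_one_left (norm_nonneg _) (hP ν).1).trans ((h ν).trans ?_)
  gcongr ?_ * ?_
  exact pow_le_pow_of_le_one h0 h1 ((hP ν).2 (Poly.mem_support.1 hν))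

variable (p) in
/-- The difference of the coordinate change and the identity. -/
def gaussDiff : Module.End ℚ_[p] (Poly p) := (gaussMap p).toLinearMap - LinearMap.id

theorem gaussDiff_apply (P : Poly p) : gaussDiff p P = gaussMap p P - P := rfl

theorem gaussDiff_mem {d : ℕ} {P : Poly p} (hP : P ∈ orderGE p d) :
    gaussDiff p P ∈ orderGE p (d + 1) := by
  intro μ
  rw [Poly.map_eq_sum (gaussDiff p), map_sum]
  simp only [map_smul, smul_eq_mul]
  refine ⟨IsUltrametricDist.norm_sum_le_of_forall_le_of_nonneg zero_le_one fun ν _ => ?_,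
    fun h => ?_⟩
  · rw [norm_mul]
    exact mul_le_one₀ (hP ν).1 (norm_nonneg _) (gaussMap_mon_sub_mem ν μ).1
  · obtain ⟨ν, hν, h2⟩ := Finset.exists_ne_zero_of_sum_ne_zero h
    have h3 := (hP ν).2 (left_ne_zero_of_mul h2)
    have h4 := (gaussMap_mon_sub_mem ν μ).2 (right_ne_zero_of_mul h2)
    omega

theorem gaussDiff_pow_mem {d : ℕ} {P : Poly p} (hP : P ∈ orderGE p d) (k : ℕ) :
    (gaussDiff p ^ k) P ∈ orderGE p (d + k) := by
  induction k with
  | zero => exact hP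
  | succ k ih =>
    rw [pow_succ', Module.End.mul_apply]
    exact gaussDiff_mem ih

/-- A linear form with sufficient decay is the composition of such a form with the coordinate
change. -/
theorem exists_comp_gaussMap_eq (φ : Poly p →ₗ[ℚ_[p]] ℚ_[p]) {C r : ℝ} (hC : 0 ≤ C) (h0 : 0 ≤ r)
    (h1 : r < 1) (h : ∀ μ, ‖φ (Poly.mon p μ)‖ ≤ C * r ^ μ.degree) :
    ∃ ψ : Poly p →ₗ[ℚ_[p]] ℚ_[p], (∀ μ, ‖ψ (Poly.mon p μ)‖ ≤ C * r ^ μ.degree) ∧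
      ∀ P, ψ (gaussMap p P) = φ P := by
  have hmon : ∀ μ k, ‖φ ((gaussDiff p ^ k) (Poly.mon p μ))‖ ≤ C * r ^ (μ.degree + k) := fun μ k =>
    norm_le_of_mem_orderGE hC h0 h1.le h (gaussDiff_pow_mem (mon_mem_orderGE μ) k)
  have hs : ∀ P : Poly p, Summable fun k : ℕ => (-1) ^ k * φ ((gaussDiff p ^ k) P) := by
    intro P
    have h2 : ∀ k : ℕ, (-1) ^ k * φ ((gaussDiff p ^ k) P) = ∑ ν ∈ Poly.support P,
        Poly.coeff ν P * ((-1) ^ k * φ ((gaussDiff p ^ k) (Poly.mon p ν))) := by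
      intro k
      have := Poly.map_eq_sum (φ ∘ₗ (gaussDiff p ^ k)) P
      rw [LinearMap.comp_apply] at this
      rw [this, Finset.mul_sum]
      refine Finset.sum_congr rfl fun ν _ => ?_
      rw [smul_eq_mul, LinearMap.comp_apply]
      ring
    simp only [h2]
    refine summable_sum fun ν _ => Summable.mul_left _ ?_
    refine Summable.of_norm_bounded (g := fun k => C * r ^ ν.degree * r ^ k)
      ((summable_geometric_of_lt_one h0 h1).mul_left _) fun k => ?_
    rw [norm_mul, norm_pow, norm_neg, norm_one, one_pow, one_mul, mul_assoc, ← pow_add]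
    exact hmon ν k
  -- The inverse of the coordinate change `1 + D` by a Neumann series: `ψ = ∑ (-1)^k φ ∘ D^k`. Since
  -- `D` raises the order by one and `φ` decays like `r^|μ|`, the `k`-th term at `z^μ` is at most `C
  -- r^(|μ| + k)`.
  let ψ : Poly p →ₗ[ℚ_[p]] ℚ_[p] :=
    { toFun := fun P => ∑' k : ℕ, (-1) ^ k * φ ((gaussDiff p ^ k) P)
      map_add' := fun P R => by
        rw [← (hs P).tsum_add (hs R)]
        simp only [map_add, mul_add]
      map_smul' := fun c P => by
        simp only [map_smul, smul_eq_mul, RingHom.id_apply, ← tsum_mul_left, mul_left_comm] }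
  refine ⟨ψ, fun μ => ?_, fun P => ?_⟩
  · refine le_of_tendsto (hs (Poly.mon p μ)).hasSum.norm (Eventually.of_forall fun s => ?_)
    refine IsUltrametricDist.norm_sum_le_of_forall_le_of_nonneg (by positivity) fun k _ => ?_
    rw [norm_mul, norm_pow, norm_neg, norm_one, one_pow, one_mul]
    refine (hmon μ k).trans ?_
    gcongr ?_ * ?_
    exact pow_le_pow_of_le_one h0 h1.le (Nat.le_add_right _ _)
  · have h2 : gaussMap p P = P + gaussDiff p P := by rw [gaussDiff_apply]; ring
    have h3 : ψ (gaussDiff p P) =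
        -∑' k : ℕ, (-1) ^ (k + 1) * φ ((gaussDiff p ^ (k + 1)) P) := by
      rw [← tsum_neg]
      refine tsum_congr fun k => ?_
      rw [pow_succ (gaussDiff p), Module.End.mul_apply, pow_succ]
      ring
    rw [h2, map_add, h3]
    change (∑' k : ℕ, (-1) ^ k * φ ((gaussDiff p ^ k) P)) + _ = _
    rw [(hs P).tsum_eq_zero_add]
    simp

end Dist

end

section

open Filter Topology

variable {p : ℕ} [hp : Fact p.Prime]

namespace Dist

/-! ### Invariant derivations -/

/-- Two linear maps that satisfy the Leibniz rule relative to an algebra homomorphism agree if they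
agree on the coordinates. -/
theorem Poly.eq_of_leibniz {A : Type*} [CommRing A] [Algebra ℚ_[p] A] (k : Poly p →ₐ[ℚ_[p]] A)
    {f g : Poly p →ₗ[ℚ_[p]] A} (hf : ∀ P R, f (P * R) = f P * k R + k P * f R)
    (hg : ∀ P R, g (P * R) = g P * k R + k P * g R) (h : ∀ ij, f (Poly.z p ij) = g (Poly.z p ij)) :
    f = g := by
  have h1 : ∀ f : Poly p →ₗ[ℚ_[p]] A, (∀ P R, f (P * R) = f P * k R + k P * f R) → f 1 = 0 := by
    intro f hf
    simpa using hf 1 1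
  refine Poly.linearMap_ext fun μ => ?_
  induction μ using Finsupp.induction_linear with
  | zero => rw [Poly.mon_zero, h1 f hf, h1 g hg]
  | add μ ν hμ hν => rw [Poly.mon_add, hf, hg, hμ, hν]
  | single ij n =>
    induction n with
    | zero => rw [Finsupp.single_zero, Poly.mon_zero, h1 f hf, h1 g hg]
    | succ n ih => rw [Finsupp.single_add, Poly.mon_add, hf, hg, ih, Poly.mon_single, h]

variable (p) in
/-- The partial derivative. -/
def Poly.pd (ij : Fin 2 × Fin 2) : Derivation ℚ_[p] (Poly p) (Poly p) :=
  (MvPolynomial.pderiv ij :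
    Derivation ℚ_[p] (MvPolynomial (Fin 2 × Fin 2) ℚ_[p]) (MvPolynomial (Fin 2 × Fin 2) ℚ_[p]))

theorem Poly.pd_z (ij kl : Fin 2 × Fin 2) :
    Poly.pd p ij (Poly.z p kl) = if kl = ij then 1 else 0 := by
  have h := MvPolynomial.pderiv_X (R := ℚ_[p]) ij kl
  simp only [Pi.single_apply] at h
  exact h

theorem Poly.coeff_pd (ij : Fin 2 × Fin 2) (P : Poly p) (ν : MultiIndex) :
    Poly.coeff ν (Poly.pd p ij P) = ((ν ij : ℚ_[p]) + 1) * Poly.coeff (ν + Finsupp.single ij 1) P := by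
  rw [mul_comm]
  exact MvPolynomial.coeff_pderiv P ν

/-- The Euler operator `z_ij ∂_ij` is diagonal on monomials. -/
theorem Poly.coeff_z_mul_pd (ij : Fin 2 × Fin 2) (P : Poly p) (ν : MultiIndex) :
    Poly.coeff ν (Poly.z p ij * Poly.pd p ij P) = (ν ij : ℚ_[p]) * Poly.coeff ν P := by
  have h : Poly.coeff ν ∘ₗ LinearMap.mulLeft ℚ_[p] (Poly.z p ij) ∘ₗ (Poly.pd p ij).toLinearMap =
      (ν ij : ℚ_[p]) • Poly.coeff ν := by
    refine Poly.linearMap_ext fun μ => ?_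
    have h2 : Poly.z p ij * Poly.pd p ij (Poly.mon p μ) = μ ij • Poly.mon p μ :=
      MvPolynomial.X_mul_pderiv_monomial
    change Poly.coeff ν (Poly.z p ij * Poly.pd p ij (Poly.mon p μ)) = _
    rw [h2, map_nsmul, LinearMap.smul_apply, Poly.coeff_mon]
    split_ifs with h3
    · simp [h3]
    · simp
  exact DFunLike.congr_fun h P

variable (p) in
/-- The derivation with prescribed values at the coordinates. -/
def Poly.der (f : Fin 2 × Fin 2 → Poly p) : Derivation ℚ_[p] (Poly p) (Poly p) :=
  (MvPolynomial.mkDerivation ℚ_[p] (A := MvPolynomial (Fin 2 × Fin 2) ℚ_[p]) f :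
    Derivation ℚ_[p] (MvPolynomial (Fin 2 × Fin 2) ℚ_[p]) (MvPolynomial (Fin 2 × Fin 2) ℚ_[p]))

theorem Poly.der_z (f : Fin 2 × Fin 2 → Poly p) (ij : Fin 2 × Fin 2) :
    Poly.der p f (Poly.z p ij) = f ij :=
  MvPolynomial.mkDerivation_X (A := MvPolynomial (Fin 2 × Fin 2) ℚ_[p]) _ _ _

variable (p) in
/-- The coordinate functions as a matrix. -/
def Poly.zMatrix : Matrix (Fin 2) (Fin 2) (Poly p) := Matrix.of fun i j => Poly.z p (i, j)

variable (p) in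
/-- The matrix `g = 1 + z` of functions. -/
def Poly.gMatrix : Matrix (Fin 2) (Fin 2) (Poly p) := 1 + Poly.zMatrix p

/-- The scalar matrix of constant functions. -/
def Poly.const (X : Gl2 p) : Matrix (Fin 2) (Fin 2) (Poly p) := X.map (algebraMap ℚ_[p] (Poly p))

theorem Poly.const_mul (X Y : Gl2 p) : Poly.const (X * Y) = Poly.const X * Poly.const Y :=
  Matrix.map_mul

/-- The derivation `z ↦ X (1 + z)`. -/
def leftDer (X : Gl2 p) : Derivation ℚ_[p] (Poly p) (Poly p) :=
  Poly.der p fun ij => (Poly.const X * Poly.gMatrix p) ij.1 ij.2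

/-- The derivation `z ↦ (1 + z) X`. -/
def rightDer (X : Gl2 p) : Derivation ℚ_[p] (Poly p) (Poly p) :=
  Poly.der p fun ij => (Poly.gMatrix p * Poly.const X) ij.1 ij.2

theorem leftDer_z (X : Gl2 p) (i j : Fin 2) :
    leftDer X (Poly.z p (i, j)) = (Poly.const X * Poly.gMatrix p) i j := Poly.der_z _ _

theorem rightDer_z (X : Gl2 p) (i j : Fin 2) :
    rightDer X (Poly.z p (i, j)) = (Poly.gMatrix p * Poly.const X) i j := Poly.der_z _ _

theorem leftDer_gMatrix (X : Gl2 p) :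
    (Poly.gMatrix p).map (leftDer X) = Poly.const X * Poly.gMatrix p := by
  ext i j : 2
  rw [Matrix.map_apply, ← leftDer_z, Poly.gMatrix, Matrix.add_apply, map_add, Matrix.one_apply]
  have h : leftDer X (if i = j then 1 else 0) = 0 := by split_ifs <;> simp
  rw [h, zero_add]
  rfl

/-- The derivation of `Y` passes the constant matrix `X` and replaces `g` by `Y g`, so the order of
composition is reversed. -/
theorem leftDer_leftDer_z (X Y : Gl2 p) (i j : Fin 2) :
    leftDer Y (leftDer X (Poly.z p (i, j))) = (Poly.const (X * Y) * Poly.gMatrix p) i j := by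
  have h : ∀ k, leftDer Y (Poly.gMatrix p k j) = (Poly.const Y * Poly.gMatrix p) k j := fun k => by
    rw [← leftDer_gMatrix, Matrix.map_apply]
  rw [leftDer_z, Matrix.mul_apply, map_sum, Poly.const_mul, Matrix.mul_assoc, Matrix.mul_apply]
  refine Finset.sum_congr rfl fun k _ => ?_
  rw [Derivation.leibniz, h, Poly.const, Matrix.map_apply, Derivation.map_algebraMap, smul_zero,
    add_zero, smul_eq_mul]

/-- A commutator of derivations is a derivation, so it suffices to compare values at the
coordinates. -/
theorem leftDer_lie (X Y : Gl2 p) (P : Poly p) :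
    leftDer Y (leftDer X P) - leftDer X (leftDer Y P) = leftDer (X * Y - Y * X) P := by
  have h : ((⁅leftDer Y, leftDer X⁆ : Derivation ℚ_[p] (Poly p) (Poly p)) :
      Poly p →ₗ[ℚ_[p]] Poly p) = (leftDer (X * Y - Y * X)).toLinearMap := by
    refine Poly.eq_of_leibniz (AlgHom.id ℚ_[p] _) (fun P R => ?_) (fun P R => ?_) fun ij => ?_
    · simp only [Derivation.coeFn_coe, Derivation.leibniz, smul_eq_mul, AlgHom.id_apply]
      ring
    · simp only [Derivation.coeFn_coe, Derivation.leibniz, smul_eq_mul, AlgHom.id_apply]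
      ring
    · obtain ⟨i, j⟩ := ij
      have h2 : Poly.const (X * Y - Y * X) = Poly.const (X * Y) - Poly.const (Y * X) := by
        rw [Poly.const, Matrix.map_sub _ (map_sub _)]
        rfl
      simp only [Derivation.coeFn_coe, Derivation.commutator_apply]
      rw [leftDer_leftDer_z, leftDer_leftDer_z, leftDer_z, h2, Matrix.sub_mul, Matrix.sub_apply]
  have h3 := DFunLike.congr_fun h P
  simpa only [Derivation.coeFn_coe, Derivation.commutator_apply] using h3

/-! ### Tangent vectors at the unit matrix -/

theorem continuous_coeff (μ : MultiIndex) : Continuous (Fn.coeff μ : Fn p →ₗ[ℚ_[p]] ℚ_[p]) := by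
  let r : Fn.Radius := ⟨1 / 2, by norm_num, by norm_num⟩
  refine Fn.withSeminorms.continuous_normedSpace_rng ℚ_[p] _
    ⟨{r}, ⟨(2 : ℝ) ^ μ.degree, by positivity⟩, fun F => ?_⟩
  rw [Finset.sup_singleton]
  have h := Fn.le_gauss F r μ
  change ‖Fn.coeff μ F‖ ≤ (2 : ℝ) ^ μ.degree * Fn.gauss r F
  calc ‖Fn.coeff μ F‖ = (2 : ℝ) ^ μ.degree * (‖Fn.coeff μ F‖ * (1 / 2) ^ μ.degree) := by
        rw [mul_left_comm, ← mul_pow]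
        norm_num
    _ ≤ _ := by gcongr

/-- The coefficient of a monomial as a distribution. -/
def coeffDist (μ : MultiIndex) : Dist p := (⟨Fn.coeff μ, continuous_coeff μ⟩ : Fn p →L[ℚ_[p]] ℚ_[p])

variable (p) in
/-- The distribution `F ↦ d/dt F (1 + t X)` at `t = 0`. -/
def tangent : Gl2 p →ₗ[ℚ_[p]] Dist p where
  toFun X := ∑ ij : Fin 2 × Fin 2, X ij.1 ij.2 • coeffDist (Finsupp.single ij 1)
  map_add' X Y := by simp only [Matrix.add_apply, add_smul, Finset.sum_add_distrib]
  map_smul' c X := by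
    simp only [Matrix.smul_apply, smul_eq_mul, mul_smul, Finset.smul_sum, RingHom.id_apply]

/-- The evaluation of distributions at a function. -/
def evalAt (F : Fn p) : Dist p →ₗ[ℚ_[p]] ℚ_[p] where
  toFun l := l F
  map_add' _ _ := rfl
  map_smul' _ _ := rfl

theorem sum_apply {ι : Type*} (s : Finset ι) (l : ι → Dist p) (F : Fn p) :
    (∑ i ∈ s, l i) F = ∑ i ∈ s, l i F := map_sum (evalAt F) l s

theorem smul_apply (c : ℚ_[p]) (l : Dist p) (F : Fn p) : (c • l) F = c * l F := rfl

theorem tangent_apply (X : Gl2 p) (F : Fn p) : tangent p X F =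
    ∑ ij : Fin 2 × Fin 2, X ij.1 ij.2 * Fn.coeff (Finsupp.single ij 1) F := by
  change (∑ ij : Fin 2 × Fin 2, X ij.1 ij.2 • coeffDist (Finsupp.single ij 1)) F = _
  rw [sum_apply]
  rfl

theorem coeff_toFn (μ : MultiIndex) (P : Poly p) :
    Fn.coeff μ (Poly.toFn p P) = Poly.coeff μ P := by
  have h : Fn.coeff μ ∘ₗ Poly.toFn p = Poly.coeff μ := by
    refine Poly.linearMap_ext fun ν => ?_
    rw [LinearMap.comp_apply, toFn_mon, Fn.coeff_monomial, Poly.coeff_mon]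
    simp only [eq_comm]
  exact DFunLike.congr_fun h P

theorem restrict_tangent (X : Gl2 p) (P : Poly p) : (restrict (tangent p X)).ofConv P =
    ∑ ij : Fin 2 × Fin 2, X ij.1 ij.2 * Poly.coeff (Finsupp.single ij 1) P := by
  change tangent p X (Poly.toFn p P) = _
  rw [tangent_apply]
  simp only [coeff_toFn]

theorem Poly.counit_eq_coeff (P : Poly p) : Poly.counit p P = Poly.coeff 0 P := by
  have h : (Poly.counit p).toLinearMap = Poly.coeff 0 := by
    refine Poly.linearMap_ext fun ν => ?_
    have h : Poly.counit p (Poly.mon p ν) = algebraMap ℚ_[p] ℚ_[p] 1 * ν.prod fun _ n => 0 ^ n :=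
      MvPolynomial.aeval_monomial _ _ _
    rw [AlgHom.toLinearMap_apply, h, Poly.coeff_mon]
    split_ifs with hν
    · simp [hν]
    · obtain ⟨i, hi⟩ := Finsupp.ne_iff.1 hν
      rw [Finsupp.prod, Finset.prod_eq_zero (Finsupp.mem_support_iff.2 hi) (zero_pow hi), mul_zero]
  exact DFunLike.congr_fun h P

/-- The linear coefficient at `z_ij` is the value of `∂_ij` at the unit matrix, so it obeys the
Leibniz rule of a point derivation. -/
theorem Poly.coeff_single_mul (ij : Fin 2 × Fin 2) (P R : Poly p) :
    Poly.coeff (Finsupp.single ij 1) (P * R) =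
      Poly.coeff (Finsupp.single ij 1) P * Poly.counit p R +
      Poly.counit p P * Poly.coeff (Finsupp.single ij 1) R := by
  have h : Poly.counit p (Poly.pd p ij (P * R)) = Poly.counit p (Poly.pd p ij P) * Poly.counit p R +
      Poly.counit p P * Poly.counit p (Poly.pd p ij R) := by
    rw [Derivation.leibniz, map_add, smul_eq_mul, smul_eq_mul, map_mul, map_mul]
    ring
  simpa only [Poly.counit_eq_coeff, Poly.coeff_pd, Finsupp.coe_zero, Pi.zero_apply, Nat.cast_zero,
    zero_add, one_mul] using h

theorem restrict_tangent_mul (X : Gl2 p) (P R : Poly p) :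
    (restrict (tangent p X)).ofConv (P * R) = (restrict (tangent p X)).ofConv P * Poly.counit p R +
      Poly.counit p P * (restrict (tangent p X)).ofConv R := by
  simp only [restrict_tangent, Poly.coeff_single_mul, Finset.sum_mul, Finset.mul_sum,
    ← Finset.sum_add_distrib]
  refine Finset.sum_congr rfl fun ij _ => ?_
  ring

theorem Poly.coeff_z (μ : MultiIndex) (ij : Fin 2 × Fin 2) :
    Poly.coeff μ (Poly.z p ij) = if Finsupp.single ij 1 = μ then 1 else 0 := by
  classical
  rw [← Poly.mon_single, Poly.coeff_mon]

theorem restrict_tangent_z (X : Gl2 p) (i j : Fin 2) :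
    (restrict (tangent p X)).ofConv (Poly.z p (i, j)) = X i j := by
  rw [restrict_tangent, Finset.sum_eq_single (i, j)]
  · simp [Poly.coeff_z]
  · intro b _ hb
    rw [Poly.coeff_z, if_neg, mul_zero]
    intro h
    exact hb ((Finsupp.single_left_injective one_ne_zero h).symm)
  · simp

theorem restrict_tangent_one (X : Gl2 p) : (restrict (tangent p X)).ofConv 1 = 0 := by
  have h := restrict_tangent_mul X 1 1
  simpa using h

/-- The contraction of the left tensor factor with a tangent vector. -/
def contractLeft (X : Gl2 p) : Poly p ⊗[ℚ_[p]] Poly p →ₗ[ℚ_[p]] Poly p :=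
  (TensorProduct.lid ℚ_[p] (Poly p)).toLinearMap ∘ₗ
    TensorProduct.map (restrict (tangent p X)).ofConv LinearMap.id

/-- The contraction of the right tensor factor with a tangent vector. -/
def contractRight (X : Gl2 p) : Poly p ⊗[ℚ_[p]] Poly p →ₗ[ℚ_[p]] Poly p :=
  (TensorProduct.rid ℚ_[p] (Poly p)).toLinearMap ∘ₗ
    TensorProduct.map LinearMap.id (restrict (tangent p X)).ofConv

theorem contractLeft_tmul (X : Gl2 p) (P R : Poly p) : contractLeft X (P ⊗ₜ[ℚ_[p]] R) =
    (restrict (tangent p X)).ofConv P • R := rfl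

theorem contractRight_tmul (X : Gl2 p) (P R : Poly p) : contractRight X (P ⊗ₜ[ℚ_[p]] R) =
    (restrict (tangent p X)).ofConv R • P := rfl

variable (p) in
/-- The counit on the left tensor factor. -/
def counitLeft : Poly p ⊗[ℚ_[p]] Poly p →ₐ[ℚ_[p]] Poly p :=
  Algebra.TensorProduct.lift ((Algebra.ofId ℚ_[p] (Poly p)).comp (Poly.counit p))
    (AlgHom.id ℚ_[p] (Poly p)) fun _ _ => Commute.all _ _

variable (p) in
/-- The counit on the right tensor factor. -/
def counitRight : Poly p ⊗[ℚ_[p]] Poly p →ₐ[ℚ_[p]] Poly p :=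
  Algebra.TensorProduct.lift (AlgHom.id ℚ_[p] (Poly p))
    ((Algebra.ofId ℚ_[p] (Poly p)).comp (Poly.counit p)) fun _ _ => Commute.all _ _

theorem counitLeft_tmul (P R : Poly p) :
    counitLeft p (P ⊗ₜ[ℚ_[p]] R) = Poly.counit p P • R := by
  rw [counitLeft, Algebra.TensorProduct.lift_tmul, AlgHom.comp_apply, AlgHom.id_apply,
    Algebra.ofId_apply, Algebra.smul_def]

theorem counitRight_tmul (P R : Poly p) :
    counitRight p (P ⊗ₜ[ℚ_[p]] R) = Poly.counit p R • P := by
  rw [counitRight, Algebra.TensorProduct.lift_tmul, AlgHom.comp_apply, AlgHom.id_apply,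
    Algebra.ofId_apply, Algebra.smul_def, mul_comm]

theorem counitLeft_comul (P : Poly p) : counitLeft p (Poly.comul p P) = P := by
  have h : (counitLeft p).comp (Poly.comul p) = AlgHom.id ℚ_[p] (Poly p) :=
    Poly.hom_ext fun ij => by
      simp [Poly.comul_z, counitLeft_tmul, Poly.counit_z]
  exact DFunLike.congr_fun h P

theorem counitRight_comul (P : Poly p) : counitRight p (Poly.comul p P) = P := by
  have h : (counitRight p).comp (Poly.comul p) = AlgHom.id ℚ_[p] (Poly p) :=
    Poly.hom_ext fun ij => by
      simp [Poly.comul_z, counitRight_tmul, Poly.counit_z]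
  exact DFunLike.congr_fun h P

/-- Contraction with a point derivation is a derivation relative to the counit on that factor. Since
the counit undoes the comultiplication, the composite with the comultiplication is an honest
derivation of the polynomial functions. -/
theorem contractLeft_mul (X : Gl2 p) (s t : Poly p ⊗[ℚ_[p]] Poly p) :
    contractLeft X (s * t) = contractLeft X s * counitLeft p t + counitLeft p s * contractLeft X t := by
  induction s using TensorProduct.induction_on with
  | zero => simp
  | add s s' h h' => simp only [add_mul, map_add, h, h']; ring
  | tmul P R =>
    induction t using TensorProduct.induction_on with
    | zero => simp
    | add s s' h h' => simp only [mul_add, map_add, h, h']; ring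
    | tmul P' R' =>
      simp only [Algebra.TensorProduct.tmul_mul_tmul, contractLeft_tmul, counitLeft_tmul,
        restrict_tangent_mul, Algebra.smul_def, map_add, map_mul]
      ring

theorem contractRight_mul (X : Gl2 p) (s t : Poly p ⊗[ℚ_[p]] Poly p) :
    contractRight X (s * t) =
      contractRight X s * counitRight p t + counitRight p s * contractRight X t := by
  induction s using TensorProduct.induction_on with
  | zero => simp
  | add s s' h h' => simp only [add_mul, map_add, h, h']; ring
  | tmul P R =>
    induction t using TensorProduct.induction_on with
    | zero => simp
    | add s s' h h' => simp only [mul_add, map_add, h, h']; ring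
    | tmul P' R' =>
      simp only [Algebra.TensorProduct.tmul_mul_tmul, contractRight_tmul, counitRight_tmul,
        restrict_tangent_mul, Algebra.smul_def, map_add, map_mul]
      ring

/-- The derivative of `P(h g)` with respect to `h` at the unit matrix in direction `X`, as a
function of `g`. Both sides are derivations, so only the coordinates have to be compared. -/
theorem contractLeft_comul (X : Gl2 p) (P : Poly p) :
    contractLeft X (Poly.comul p P) = leftDer X P := by
  have h : contractLeft X ∘ₗ (Poly.comul p).toLinearMap = (leftDer X).toLinearMap := by
    refine Poly.eq_of_leibniz (AlgHom.id ℚ_[p] _) (fun P R => ?_) (fun P R => ?_) fun ij => ?_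
    · simp only [LinearMap.comp_apply, AlgHom.toLinearMap_apply, map_mul, contractLeft_mul,
        counitLeft_comul, AlgHom.id_apply]
    · simp only [Derivation.coeFn_coe, Derivation.leibniz, smul_eq_mul, AlgHom.id_apply]
      ring
    · obtain ⟨i, j⟩ := ij
      simp only [LinearMap.comp_apply, AlgHom.toLinearMap_apply, Poly.comul_z, map_add, map_sum,
        contractLeft_tmul, restrict_tangent_z, restrict_tangent_one,
        Derivation.coeFn_coe, leftDer_z, Matrix.mul_apply, Poly.gMatrix, Matrix.add_apply, mul_add,
        Finset.sum_add_distrib, Matrix.one_apply, mul_ite, mul_one, mul_zero, Finset.sum_ite_eq',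
        Finset.mem_univ, if_true, Poly.const, Matrix.map_apply, Poly.zMatrix, Matrix.of_apply,
        Algebra.smul_def, map_zero, zero_mul, add_zero]
  exact DFunLike.congr_fun h P

theorem contractRight_comul (X : Gl2 p) (P : Poly p) :
    contractRight X (Poly.comul p P) = rightDer X P := by
  have h : contractRight X ∘ₗ (Poly.comul p).toLinearMap = (rightDer X).toLinearMap := by
    refine Poly.eq_of_leibniz (AlgHom.id ℚ_[p] _) (fun P R => ?_) (fun P R => ?_) fun ij => ?_
    · simp only [LinearMap.comp_apply, AlgHom.toLinearMap_apply, map_mul, contractRight_mul,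
        counitRight_comul, AlgHom.id_apply]
    · simp only [Derivation.coeFn_coe, Derivation.leibniz, smul_eq_mul, AlgHom.id_apply]
      ring
    · obtain ⟨i, j⟩ := ij
      simp only [LinearMap.comp_apply, AlgHom.toLinearMap_apply, Poly.comul_z, map_add, map_sum,
        contractRight_tmul, restrict_tangent_z, restrict_tangent_one,
        Derivation.coeFn_coe, rightDer_z, Matrix.mul_apply, Poly.gMatrix, Matrix.add_apply, add_mul,
        Finset.sum_add_distrib, Matrix.one_apply, ite_mul, one_mul, zero_mul, Finset.sum_ite_eq,
        Finset.mem_univ, if_true, Poly.const, Matrix.map_apply, Poly.zMatrix, Matrix.of_apply,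
        Algebra.smul_def, mul_comm, map_zero, zero_mul, zero_add]
  exact DFunLike.congr_fun h P

theorem restrict_mul_apply (l l' : Dist p) (P : Poly p) : (restrict (l * l')).ofConv P =
    LinearMap.mul' ℚ_[p] ℚ_[p] (TensorProduct.map (restrict l).ofConv (restrict l').ofConv
      (Poly.comul p P)) := by
  rw [restrict_mul]
  rfl

/-- The convolution with a tangent vector from the left is dual to a derivation. -/
theorem restrict_tangent_mul_left (X : Gl2 p) (l : Dist p) (P : Poly p) :
    (restrict (tangent p X * l)).ofConv P = (restrict l).ofConv (leftDer X P) := by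
  rw [restrict_mul_apply, ← contractLeft_comul]
  generalize Poly.comul p P = t
  induction t using TensorProduct.induction_on with
  | zero => simp
  | add s t hs ht => simp only [map_add, hs, ht]
  | tmul P R => rw [contractLeft_tmul, map_smul, TensorProduct.map_tmul]; rfl

/-- The convolution with a tangent vector from the right is dual to a derivation. -/
theorem restrict_mul_tangent (X : Gl2 p) (l : Dist p) (P : Poly p) :
    (restrict (l * tangent p X)).ofConv P = (restrict l).ofConv (rightDer X P) := by
  rw [restrict_mul_apply, ← contractRight_comul]
  generalize Poly.comul p P = t
  induction t using TensorProduct.induction_on with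
  | zero => simp
  | add s t hs ht => simp only [map_add, hs, ht]
  | tmul P R =>
    rw [contractRight_tmul, map_smul, TensorProduct.map_tmul, LinearMap.mul'_apply, smul_eq_mul,
      mul_comm]

theorem restrict_apply_ext {l l' : Dist p}
    (h : ∀ P, (restrict l).ofConv P = (restrict l').ofConv P) : l = l' :=
  restrict_injective (WithConv.ext (LinearMap.ext h))

/-- A tangent vector is the unit distribution composed with its derivation. Left convolution
reverses the order of the derivations, and so does their composition on coordinates; the two
reversals cancel. -/
theorem tangent_lie (X Y : Gl2 p) :
    tangent p (X * Y - Y * X) = tangent p X * tangent p Y - tangent p Y * tangent p X := by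
  refine restrict_apply_ext fun P => ?_
  have h1 : ∀ Z P, (restrict (tangent p Z)).ofConv P = (restrict (1 : Dist p)).ofConv (leftDer Z P) :=
    fun Z P => by rw [← restrict_tangent_mul_left, mul_one]
  have h2 : (restrict (tangent p X * tangent p Y - tangent p Y * tangent p X)).ofConv P =
    (restrict (tangent p X * tangent p Y)).ofConv P -
      (restrict (tangent p Y * tangent p X)).ofConv P := rfl
  rw [h2, restrict_tangent_mul_left, restrict_tangent_mul_left, h1, h1, h1, ← map_sub, leftDer_lie]

end Dist

/-! ### The homomorphism from the enveloping algebra. -/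

section Theta

attribute [local instance] LieRing.ofAssociativeRing

variable (p) in
/-- The homomorphism from the enveloping algebra to the distribution algebra. -/
def theta : Env p →ₐ[ℚ_[p]] Dist p :=
  UniversalEnvelopingAlgebra.lift ℚ_[p] (L := Gl2 p)
    { Dist.tangent p with map_lie' := fun {X Y} => Dist.tangent_lie X Y }

theorem theta_ι (X : Gl2 p) : theta p (Env.ι p X) = Dist.tangent p X :=
  UniversalEnvelopingAlgebra.lift_ι_apply ℚ_[p] _ X

theorem Env.hom_ext {A : Type*} [Ring A] [Algebra ℚ_[p] A] {f g : Env p →ₐ[ℚ_[p]] A}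
    (h : ∀ X, f (Env.ι p X) = g (Env.ι p X)) : f = g :=
  UniversalEnvelopingAlgebra.hom_ext ℚ_[p] (L := Gl2 p) (LieHom.ext h)

theorem Env.ι_mul_sub (X Y : Gl2 p) : Env.ι p X * Env.ι p Y - Env.ι p Y * Env.ι p X =
    Env.ι p (X * Y - Y * X) :=
  ((UniversalEnvelopingAlgebra.ι ℚ_[p] (L := Gl2 p)).map_lie X Y).symm

end Theta

end

section

open Filter Topology

variable {p : ℕ} [hp : Fact p.Prime]

/-! ### Poincaré–Birkhoff–Witt monomials -/

namespace Env

variable (p) in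
/-- The upper triangular element of the standard basis of `gl₂`. -/
def e : Env p := Env.ι p !![0, 1; 0, 0]
variable (p) in
/-- The first diagonal element of the standard basis of `gl₂`. -/
def h₁ : Env p := Env.ι p !![1, 0; 0, 0]
variable (p) in
/-- The second diagonal element of the standard basis of `gl₂`. -/
def h₂ : Env p := Env.ι p !![0, 0; 0, 1]
variable (p) in
/-- The lower triangular element of the standard basis of `gl₂`. -/
def f : Env p := Env.ι p !![0, 0; 1, 0]

theorem ι_mul_eq {X Y Z : Gl2 p} (h : X * Y - Y * X = Z) :
    Env.ι p X * Env.ι p Y = Env.ι p Y * Env.ι p X + Env.ι p Z := by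
  rw [← h, ← Env.ι_mul_sub]
  abel

section Linear

attribute [local instance] LieRing.ofAssociativeRing

theorem ι_add (X Y : Gl2 p) : Env.ι p (X + Y) = Env.ι p X + Env.ι p Y :=
  map_add (UniversalEnvelopingAlgebra.ι ℚ_[p]) X Y

theorem ι_smul (c : ℚ_[p]) (X : Gl2 p) : Env.ι p (c • X) = c • Env.ι p X :=
  map_smul (UniversalEnvelopingAlgebra.ι ℚ_[p]) c X

theorem ι_neg (X : Gl2 p) : Env.ι p (-X) = -Env.ι p X :=
  map_neg (UniversalEnvelopingAlgebra.ι ℚ_[p]) X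

theorem ι_zero : Env.ι p 0 = 0 := map_zero (UniversalEnvelopingAlgebra.ι ℚ_[p])

end Linear

theorem h₁_mul_e : h₁ p * e p = e p * h₁ p + e p :=
  ι_mul_eq (by ext i j; fin_cases i <;> fin_cases j <;> simp)

theorem h₂_mul_e : h₂ p * e p = e p * h₂ p - e p := by
  rw [sub_eq_add_neg, e, ← ι_neg]
  exact ι_mul_eq (by ext i j; fin_cases i <;> fin_cases j <;> simp)

theorem f_mul_h₁ : f p * h₁ p = h₁ p * f p + f p :=
  ι_mul_eq (by ext i j; fin_cases i <;> fin_cases j <;> simp)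

theorem f_mul_h₂ : f p * h₂ p = h₂ p * f p - f p := by
  rw [sub_eq_add_neg, f, ← ι_neg]
  exact ι_mul_eq (by ext i j; fin_cases i <;> fin_cases j <;> simp)

theorem h₂_mul_h₁ : h₂ p * h₁ p = h₁ p * h₂ p := by
  have h := ι_mul_eq (p := p) (X := !![0, 0; 0, 1]) (Y := !![1, 0; 0, 0]) (Z := 0)
    (by ext i j; fin_cases i <;> fin_cases j <;> simp)
  rwa [ι_zero, add_zero] at h

theorem f_mul_e : f p * e p = e p * f p - (h₁ p - h₂ p) := by
  have h := ι_mul_eq (p := p) (X := !![0, 0; 1, 0]) (Y := !![0, 1; 0, 0])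
    (Z := -!![1, 0; 0, 0] + !![0, 0; 0, 1])
    (by ext i j; fin_cases i <;> fin_cases j <;> simp)
  rw [ι_add, ι_neg] at h
  rw [f, e, h, h₁, h₂]
  abel

theorem h₁_mul_e_pow (a : ℕ) : h₁ p * e p ^ a = e p ^ a * (h₁ p + a) := by
  induction a with
  | zero => simp
  | succ a ih =>
    rw [pow_succ, ← mul_assoc, ih, mul_assoc, add_mul, h₁_mul_e, mul_assoc, (Nat.cast_commute a (e p)).eq]
    push_cast
    noncomm_ring

theorem h₂_mul_e_pow (a : ℕ) : h₂ p * e p ^ a = e p ^ a * (h₂ p - a) := by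
  induction a with
  | zero => simp
  | succ a ih =>
    rw [pow_succ, ← mul_assoc, ih, mul_assoc, sub_mul, h₂_mul_e, mul_assoc, (Nat.cast_commute a (e p)).eq]
    push_cast
    noncomm_ring

/-- The commutation relation of `sl₂` for powers. The exponent `a + 1` keeps the lower power `e ^ a`
free of subtraction in `ℕ`. -/
theorem f_mul_e_pow (a : ℕ) : f p * e p ^ (a + 1) =
    e p ^ (a + 1) * f p - ((a : Env p) + 1) * (e p ^ a * (h₁ p - h₂ p + a)) := by
  induction a with
  | zero => simpa using f_mul_e
  | succ a ih =>
    have h1 : (h₁ p - h₂ p + (a : Env p)) * e p = e p * (h₁ p - h₂ p + 2 + a) := by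
      rw [add_mul, sub_mul, h₁_mul_e, h₂_mul_e, (Nat.cast_commute a (e p)).eq]
      noncomm_ring
    rw [pow_succ _ (a + 1), ← mul_assoc, ih, sub_mul, mul_assoc _ (f p), f_mul_e, mul_assoc _ _ (e p),
      mul_assoc _ _ (e p), h1, pow_succ]
    have h2 : ∀ x : Env p, (a : Env p) * x = x * a := fun x => (Nat.cast_commute a x).eq
    push_cast
    simp only [mul_add, add_mul, mul_sub, mul_assoc, h2, one_mul, mul_one]
    noncomm_ring

theorem mul_aeval_eq {x y z : Env p} (h : z * x = y * z) (P : Polynomial ℚ_[p]) :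
    z * Polynomial.aeval x P = Polynomial.aeval y P * z := by
  induction P using Polynomial.induction_on with
  | C a => rw [Polynomial.aeval_C, Polynomial.aeval_C, ← Algebra.commutes]
  | add P R hP hR => rw [map_add, map_add, mul_add, add_mul, hP, hR]
  | monomial n a ih =>
    rw [pow_succ, ← mul_assoc, map_mul (Polynomial.aeval x) (Polynomial.C a * Polynomial.X ^ n),
      map_mul (Polynomial.aeval y) (Polynomial.C a * Polynomial.X ^ n), Polynomial.aeval_X,
      Polynomial.aeval_X, ← mul_assoc, ih, mul_assoc, h, mul_assoc]

/-- A monomial in normal order with polynomials in the diagonal elements. -/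
def normal (a : ℕ) (P Q : Polynomial ℚ_[p]) (d : ℕ) : Env p :=
  e p ^ a * Polynomial.aeval (h₁ p) P * Polynomial.aeval (h₂ p) Q * f p ^ d

variable (p) in
/-- The span of the monomials in normal order. -/
def normalSpan : Submodule ℚ_[p] (Env p) :=
  Submodule.span ℚ_[p] {u | ∃ a P Q d, u = normal a P Q d}

theorem normal_mem (a : ℕ) (P Q : Polynomial ℚ_[p]) (d : ℕ) : normal a P Q d ∈ normalSpan p :=
  Submodule.subset_span ⟨a, P, Q, d, rfl⟩

open Polynomial in
theorem e_mul_normal (a : ℕ) (P Q : ℚ_[p][X]) (d : ℕ) :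
    e p * normal a P Q d = normal (a + 1) P Q d := by
  simp only [normal, pow_succ', mul_assoc]

open Polynomial in
theorem h₁_mul_normal (a : ℕ) (P Q : ℚ_[p][X]) (d : ℕ) :
    h₁ p * normal a P Q d = normal a ((X + (a : ℚ_[p][X])) * P) Q d := by
  simp only [normal, ← mul_assoc, h₁_mul_e_pow, map_mul, map_add, aeval_X, map_natCast]

open Polynomial in
theorem h₂_mul_normal (a : ℕ) (P Q : ℚ_[p][X]) (d : ℕ) :
    h₂ p * normal a P Q d = normal a P ((X - (a : ℚ_[p][X])) * Q) d := by
  have h : (h₂ p - (a : Env p)) * aeval (h₁ p) P = aeval (h₁ p) P * (h₂ p - a) := by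
    rw [sub_mul, mul_sub, mul_aeval_eq h₂_mul_h₁, (Nat.cast_commute a _).eq]
  simp only [normal, ← mul_assoc, h₂_mul_e_pow, map_mul, map_sub, aeval_X, map_natCast]
  rw [mul_assoc (e p ^ a), h, ← mul_assoc]

open Polynomial in
theorem f_mul_diag (P Q : ℚ_[p][X]) : f p * (aeval (h₁ p) P * aeval (h₂ p) Q) =
    aeval (h₁ p) (P.comp (X + 1)) * aeval (h₂ p) (Q.comp (X - 1)) * f p := by
  have h1 := mul_aeval_eq (p := p) (x := h₁ p) (y := h₁ p + 1) (z := f p)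
    (by rw [f_mul_h₁, add_mul, one_mul]) P
  have h2 := mul_aeval_eq (p := p) (x := h₂ p) (y := h₂ p - 1) (z := f p)
    (by rw [f_mul_h₂, sub_mul, one_mul]) Q
  rw [← mul_assoc, h1, mul_assoc, h2, aeval_comp, aeval_comp, mul_assoc]
  simp

open Polynomial in
theorem f_mul_normal_zero (P Q : ℚ_[p][X]) (d : ℕ) :
    f p * normal 0 P Q d = normal 0 (P.comp (X + 1)) (Q.comp (X - 1)) (d + 1) := by
  simp only [normal, pow_zero, one_mul]
  rw [← mul_assoc, f_mul_diag, pow_succ', mul_assoc _ (f p)]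

open Polynomial in
theorem f_mul_normal_succ (a : ℕ) (P Q : ℚ_[p][X]) (d : ℕ) :
    f p * normal (a + 1) P Q d =
      normal (a + 1) (P.comp (X + 1)) (Q.comp (X - 1)) (d + 1) -
      ((a : ℚ_[p]) + 1) • (normal a ((X + (a : ℚ_[p][X])) * P) Q d - normal a P (X * Q) d) := by
  have h2 : h₂ p * aeval (h₁ p) P = aeval (h₁ p) P * h₂ p := mul_aeval_eq h₂_mul_h₁ P
  have h3 : normal (a + 1) (P.comp (X + 1)) (Q.comp (X - 1)) (d + 1) =
      e p ^ (a + 1) * f p * (aeval (h₁ p) P * aeval (h₂ p) Q) * f p ^ d := by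
    simp only [normal]
    rw [mul_assoc (e p ^ (a + 1)) (f p), f_mul_diag, pow_succ' (f p)]
    simp only [mul_assoc]
  have h4 : normal a ((X + (a : ℚ_[p][X])) * P) Q d - normal a P (X * Q) d =
      e p ^ a * (h₁ p - h₂ p + a) * (aeval (h₁ p) P * aeval (h₂ p) Q) * f p ^ d := by
    simp only [normal, map_mul, map_add, aeval_X, map_natCast]
    rw [show aeval (h₁ p) P = aeval (h₁ p) P from rfl, mul_assoc (e p ^ a) (aeval (h₁ p) P),
      ← mul_assoc (aeval (h₁ p) P) (h₂ p), ← h2]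
    noncomm_ring
  have h5 : f p * normal (a + 1) P Q d =
      f p * e p ^ (a + 1) * (aeval (h₁ p) P * aeval (h₂ p) Q) * f p ^ d := by
    simp only [normal, mul_assoc]
  rw [h5, h3, h4, f_mul_e_pow, sub_mul, sub_mul, Algebra.smul_def, map_add, map_natCast, map_one]
  simp only [mul_assoc]

theorem mul_mem_normalSpan (X : Gl2 p) {u : Env p} (hu : u ∈ normalSpan p) :
    Env.ι p X * u ∈ normalSpan p := by
  -- By linearity it is enough to multiply by the four basis elements. Moving them past powers of
  -- `e` shifts or multiplies the polynomials in `h₁` and `h₂`, which is why arbitrary polynomials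
  -- are allowed there.
  have hX : X = X 0 1 • !![0, 1; 0, 0] + X 0 0 • !![1, 0; 0, 0] + X 1 1 • !![0, 0; 0, 1] +
      X 1 0 • !![0, 0; 1, 0] := by
    ext i j
    fin_cases i <;> fin_cases j <;> simp
  have key : ∀ x : Env p, (∀ a P Q d, x * normal a P Q d ∈ normalSpan p) →
      x * u ∈ normalSpan p := by
    intro x hx
    have h : normalSpan p ≤ (normalSpan p).comap (LinearMap.mulLeft ℚ_[p] x) := by
      refine Submodule.span_le.2 ?_
      rintro _ ⟨a, P, Q, d, rfl⟩
      exact hx a P Q d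
    exact h hu
  rw [hX, ι_add, ι_add, ι_add, ι_smul, ι_smul, ι_smul, ι_smul, add_mul, add_mul, add_mul,
    smul_mul_assoc, smul_mul_assoc, smul_mul_assoc, smul_mul_assoc]
  refine Submodule.add_mem _ (Submodule.add_mem _ (Submodule.add_mem _ ?_ ?_) ?_) ?_ <;>
    refine Submodule.smul_mem _ _ (key _ fun a P Q d => ?_)
  · rw [← e, e_mul_normal]
    exact normal_mem _ _ _ _
  · rw [← h₁, h₁_mul_normal]
    exact normal_mem _ _ _ _
  · rw [← h₂, h₂_mul_normal]
    exact normal_mem _ _ _ _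
  · rw [← f]
    cases a with
    | zero =>
      rw [f_mul_normal_zero]
      exact normal_mem _ _ _ _
    | succ a =>
      rw [f_mul_normal_succ]
      exact Submodule.sub_mem _ (normal_mem _ _ _ _) (Submodule.smul_mem _ _
        (Submodule.sub_mem _ (normal_mem _ _ _ _) (normal_mem _ _ _ _)))

attribute [local instance] LieRing.ofAssociativeRing in
-- The universal property yields a homomorphism into `A` whose composite with the inclusion fixes
-- `gl₂`, hence is the identity.
theorem mem_of_ι_mem (A : Subalgebra ℚ_[p] (Env p)) (h : ∀ X, Env.ι p X ∈ A) (u : Env p) :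
    u ∈ A := by
  let φ : Gl2 p →ₗ⁅ℚ_[p]⁆ A :=
    { toFun := fun X => ⟨Env.ι p X, h X⟩
      map_add' := fun X Y => Subtype.ext (ι_add X Y)
      map_smul' := fun c X => Subtype.ext (ι_smul c X)
      map_lie' := fun {X Y} => Subtype.ext (Env.ι_mul_sub X Y).symm }
  let g : Env p →ₐ[ℚ_[p]] A := UniversalEnvelopingAlgebra.lift ℚ_[p] (L := Gl2 p) φ
  have hg : A.val.comp g = AlgHom.id ℚ_[p] (Env p) := Env.hom_ext fun X => by
    have : g (Env.ι p X) = φ X := UniversalEnvelopingAlgebra.lift_ι_apply ℚ_[p] φ X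
    rw [AlgHom.comp_apply, this]
    rfl
  have := DFunLike.congr_fun hg u
  rw [AlgHom.id_apply] at this
  rw [← this]
  exact (g u).2

/-- The elements that preserve the span by left multiplication form a subalgebra containing `gl₂`,
hence are everything; apply this to `1`. Only the spanning half of the Poincaré–Birkhoff–Witt
theorem enters the argument. -/
theorem normalSpan_eq_top : normalSpan p = ⊤ := by
  let A : Subalgebra ℚ_[p] (Env p) :=
    { carrier := {x | ∀ u ∈ normalSpan p, x * u ∈ normalSpan p}
      mul_mem' := fun {x y} hx hy u hu => by
        rw [mul_assoc]
        exact hx _ (hy u hu)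
      add_mem' := fun {x y} hx hy u hu => by
        rw [add_mul]
        exact Submodule.add_mem _ (hx u hu) (hy u hu)
      algebraMap_mem' := fun c u hu => by
        rw [← Algebra.smul_def]
        exact Submodule.smul_mem _ _ hu }
  refine Submodule.eq_top_iff'.2 fun u => ?_
  have h1 : (1 : Env p) ∈ normalSpan p := by
    have := normal_mem (p := p) 0 1 1 0
    simpa [normal] using this
  have h := mem_of_ι_mem A (fun X u hu => mul_mem_normalSpan X hu) u 1 h1
  rwa [mul_one] at h

/-- The product of the divided powers and binomial coefficients with given exponents. -/
def pbw (ν : Fin 4 → ℕ) : Env p :=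
  divPow p (e p) (ν 0) * binom p (h₁ p) (ν 1) * binom p (h₂ p) (ν 2) * divPow p (f p) (ν 3)

theorem descPochhammer_span (P : Polynomial ℚ_[p]) :
    P ∈ Submodule.span ℚ_[p] (Set.range (descPochhammer ℚ_[p])) := by
  have hX : ∀ P ∈ Submodule.span ℚ_[p] (Set.range (descPochhammer ℚ_[p])),
      P * Polynomial.X ∈ Submodule.span ℚ_[p] (Set.range (descPochhammer ℚ_[p])) := by
    intro P hP
    induction hP using Submodule.span_induction with
    | zero => rw [zero_mul]; exact Submodule.zero_mem _
    | add x y _ _ hx hy => rw [add_mul]; exact Submodule.add_mem _ hx hy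
    | smul c x _ hx => rw [smul_mul_assoc]; exact Submodule.smul_mem _ c hx
    | mem x hx =>
      obtain ⟨n, rfl⟩ := hx
      have h : descPochhammer ℚ_[p] n * Polynomial.X =
          descPochhammer ℚ_[p] (n + 1) + (n : ℚ_[p]) • descPochhammer ℚ_[p] n := by
        rw [descPochhammer_succ_right, Nat.cast_smul_eq_nsmul, nsmul_eq_mul]
        ring
      rw [h]
      exact Submodule.add_mem _ (Submodule.subset_span ⟨_, rfl⟩)
        (Submodule.smul_mem _ _ (Submodule.subset_span ⟨_, rfl⟩))
  induction P using Polynomial.induction_on with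
  | C a =>
    have h : Polynomial.C a = a • descPochhammer ℚ_[p] 0 := by
      rw [descPochhammer_zero, Polynomial.smul_eq_C_mul, mul_one]
    rw [h]
    exact Submodule.smul_mem _ _ (Submodule.subset_span ⟨_, rfl⟩)
  | add P R hP hR => exact Submodule.add_mem _ hP hR
  | monomial n a ih =>
    rw [pow_succ, ← mul_assoc]
    exact hX _ ih

theorem normal_eq_smul_pbw (a b c d : ℕ) :
    normal a (descPochhammer ℚ_[p] b) (descPochhammer ℚ_[p] c) d =
      ((a.factorial * b.factorial * c.factorial * d.factorial : ℕ) : ℚ_[p]) • pbw ![a, b, c, d] := by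
  have h : ∀ n : ℕ, (n.factorial : ℚ_[p]) ≠ 0 := fun n => Nat.cast_ne_zero.2 n.factorial_ne_zero
  have ha := h a
  have hb := h b
  have hc := h c
  have hd := h d
  simp only [pbw, divPow, binom, normal, Matrix.cons_val, smul_mul_assoc, mul_smul_comm, smul_smul]
  push_cast
  rw [show ((a.factorial : ℚ_[p]) * b.factorial * c.factorial * d.factorial *
    ((d.factorial : ℚ_[p])⁻¹ * ((c.factorial : ℚ_[p])⁻¹ * ((b.factorial : ℚ_[p])⁻¹ *
      (a.factorial : ℚ_[p])⁻¹)))) = 1 by field_simp, one_smul]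

theorem span_pbw : Submodule.span ℚ_[p] (Set.range (pbw : (Fin 4 → ℕ) → Env p)) = ⊤ := by
  rw [eq_top_iff, ← normalSpan_eq_top]
  refine Submodule.span_le.2 ?_
  rintro _ ⟨a, P, Q, d, rfl⟩
  have hP := descPochhammer_span P
  induction hP using Submodule.span_induction with
  | zero => simp [normal]
  | add x y _ _ hx hy =>
    have : normal a (x + y) Q d = normal a x Q d + normal a y Q d := by
      simp only [normal, map_add, mul_add, add_mul]
    rw [this]
    exact Submodule.add_mem _ hx hy
  | smul r x _ hx =>
    have : normal a (r • x) Q d = r • normal a x Q d := by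
      simp only [normal, map_smul, mul_smul_comm, smul_mul_assoc]
    rw [this]
    exact Submodule.smul_mem _ _ hx
  | mem P hP =>
    obtain ⟨b, rfl⟩ := hP
    have hQ := descPochhammer_span Q
    induction hQ using Submodule.span_induction with
    | zero => simp [normal]
    | add x y _ _ hx hy =>
      have : normal a (descPochhammer ℚ_[p] b) (x + y) d =
          normal a (descPochhammer ℚ_[p] b) x d + normal a (descPochhammer ℚ_[p] b) y d := by
        simp only [normal, map_add, mul_add, add_mul]
      rw [this]
      exact Submodule.add_mem _ hx hy
    | smul r x _ hx =>
      have : normal a (descPochhammer ℚ_[p] b) (r • x) d =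
          r • normal a (descPochhammer ℚ_[p] b) x d := by
        simp only [normal, map_smul, mul_smul_comm, smul_mul_assoc]
      rw [this]
      exact Submodule.smul_mem _ _ hx
    | mem Q hQ =>
      obtain ⟨c, rfl⟩ := hQ
      rw [normal_eq_smul_pbw]
      exact Submodule.smul_mem _ _ (Submodule.subset_span ⟨_, rfl⟩)

theorem generator_eq (m : ℕ) (ν : Fin 4 → ℕ) : generator p m ν =
    ((qFactorial p m (ν 0) * qFactorial p m (ν 1) * qFactorial p m (ν 2) * qFactorial p m (ν 3) : ℕ) :
      ℚ_[p]) • pbw ν := by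
  simp only [generator, pbw, e, h₁, h₂, f, ← Nat.cast_smul_eq_nsmul ℚ_[p], smul_mul_assoc,
    mul_smul_comm, smul_smul, Nat.cast_mul]
  congr 1
  ring

end Env

end

section

open Filter Topology

variable {p : ℕ} [hp : Fact p.Prime]

namespace Dist

/-! ### The images of the Poincaré–Birkhoff–Witt monomials -/

/-- Both composites satisfy the Leibniz rule relative to the coordinate change, so an identity of
vector fields in the two coordinate systems can be checked on the coordinates. -/
theorem gaussMap_comp_eq {D D' : Derivation ℚ_[p] (Poly p) (Poly p)}
    (h : ∀ ij, gaussMap p (D (Poly.z p ij)) = D' (gaussMap p (Poly.z p ij))) (P : Poly p) :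
    gaussMap p (D P) = D' (gaussMap p P) := by
  have h2 : (gaussMap p).toLinearMap ∘ₗ D.toLinearMap = D'.toLinearMap ∘ₗ (gaussMap p).toLinearMap :=
    Poly.eq_of_leibniz (gaussMap p)
      (fun P R => by
        simp only [LinearMap.comp_apply, Derivation.coeFn_coe, Derivation.leibniz, smul_eq_mul,
          AlgHom.toLinearMap_apply, map_add, map_mul]
        ring)
      (fun P R => by
        simp only [LinearMap.comp_apply, Derivation.coeFn_coe, Derivation.leibniz, smul_eq_mul,
          AlgHom.toLinearMap_apply, map_mul]
        ring) h
  exact DFunLike.congr_fun h2 P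

/-- Left multiplication by `1 + s e` only translates the coordinate of `u` in `u t v`. -/
theorem gaussMap_leftDer_e (P : Poly p) :
    gaussMap p (leftDer !![0, 1; 0, 0] P) = Poly.pd p (0, 1) (gaussMap p P) := by
  refine gaussMap_comp_eq (fun ij => ?_) P
  obtain ⟨i, j⟩ := ij
  rw [leftDer_z]
  fin_cases i <;> fin_cases j <;>
    simp [Poly.const, Poly.gMatrix, Poly.zMatrix, Matrix.mul_apply, Fin.sum_univ_two, gaussMap_z,
      gaussEntry, Poly.pd_z, mul_comm]

/-- Right multiplication by `1 + s f` only translates the coordinate of `v` in `u t v`. -/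
theorem gaussMap_rightDer_f (P : Poly p) :
    gaussMap p (rightDer !![0, 0; 1, 0] P) = Poly.pd p (1, 0) (gaussMap p P) := by
  refine gaussMap_comp_eq (fun ij => ?_) P
  obtain ⟨i, j⟩ := ij
  rw [rightDer_z]
  fin_cases i <;> fin_cases j <;>
    simp [Poly.const, Poly.gMatrix, Poly.zMatrix, Matrix.mul_apply, Fin.sum_univ_two, gaussMap_z,
      gaussEntry, Poly.pd_z]
  ring

/-- Left multiplication by `diag(s, 1)` scales `1 + z₀₀` and, by conjugation, the coordinate of `u`.
For `diag(1, s)` the coordinate of `u` is scaled by `s⁻¹`, whence the minus sign in the companion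
formula for `h₂`. -/
theorem gaussMap_leftDer_h₁ (P : Poly p) :
    gaussMap p (leftDer !![1, 0; 0, 0] P) = Poly.pd p (0, 0) (gaussMap p P) +
      Poly.z p (0, 0) * Poly.pd p (0, 0) (gaussMap p P) +
      Poly.z p (0, 1) * Poly.pd p (0, 1) (gaussMap p P) := by
  refine gaussMap_comp_eq (D' := Poly.pd p (0, 0) + Poly.z p (0, 0) • Poly.pd p (0, 0) +
    Poly.z p (0, 1) • Poly.pd p (0, 1)) (fun ij => ?_) P
  obtain ⟨i, j⟩ := ij
  rw [leftDer_z]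
  fin_cases i <;> fin_cases j <;>
    simp [Poly.const, Poly.gMatrix, Poly.zMatrix, Matrix.mul_apply, Fin.sum_univ_two, gaussMap_z,
      gaussEntry, Poly.pd_z] <;> ring

theorem gaussMap_leftDer_h₂ (P : Poly p) :
    gaussMap p (leftDer !![0, 0; 0, 1] P) = Poly.pd p (1, 1) (gaussMap p P) +
      Poly.z p (1, 1) * Poly.pd p (1, 1) (gaussMap p P) -
      Poly.z p (0, 1) * Poly.pd p (0, 1) (gaussMap p P) := by
  refine gaussMap_comp_eq (D' := Poly.pd p (1, 1) + Poly.z p (1, 1) • Poly.pd p (1, 1) -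
    Poly.z p (0, 1) • Poly.pd p (0, 1)) (fun ij => ?_) P
  obtain ⟨i, j⟩ := ij
  rw [leftDer_z]
  fin_cases i <;> fin_cases j <;>
    simp [Poly.const, Poly.gMatrix, Poly.zMatrix, Matrix.mul_apply, Fin.sum_univ_two, gaussMap_z,
      gaussEntry, Poly.pd_z] <;> ring

/-- The distribution `l` is the coefficient of index `ν` in the coordinates of the Gauss
decomposition. -/
def IsGaussCoeff (ν : MultiIndex) (l : Dist p) : Prop :=
  ∀ P, (restrict l).ofConv P = Poly.coeff ν (gaussMap p P)

theorem isGaussCoeff_one : IsGaussCoeff 0 (1 : Dist p) := by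
  intro P
  have h : (restrict (1 : Dist p)).ofConv P = Poly.counit p P := by
    rw [restrict_one]
    rfl
  have h2 : (Poly.counit p).comp (gaussMap p) = Poly.counit p := Poly.hom_ext fun ij => by
    obtain ⟨i, j⟩ := ij
    fin_cases i <;> fin_cases j <;> simp [gaussMap_z, gaussEntry, Poly.counit_z]
  rw [h, ← Poly.counit_eq_coeff]
  exact (DFunLike.congr_fun h2 P).symm

theorem restrict_smul_apply (c : ℚ_[p]) (l : Dist p) (P : Poly p) :
    (restrict (c • l)).ofConv P = c * (restrict l).ofConv P := rfl

theorem restrict_sub_apply (l l' : Dist p) (P : Poly p) :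
    (restrict (l - l')).ofConv P = (restrict l).ofConv P - (restrict l').ofConv P := rfl

theorem factorial_succ_inv (n : ℕ) : (((n + 1).factorial : ℕ) : ℚ_[p])⁻¹ =
    ((n : ℚ_[p]) + 1)⁻¹ * ((n.factorial : ℕ) : ℚ_[p])⁻¹ := by
  rw [Nat.factorial_succ, Nat.cast_mul, mul_inv]
  push_cast
  rfl

/-- Here `e` acts as `∂₀₁`, and `∂₀₁ ^ n / n!` at exponent `0` extracts the coefficient of exponent
`n`. -/
theorem IsGaussCoeff.divPow_mul {ν : MultiIndex} {l : Dist p} (h : IsGaussCoeff ν l)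
    (hν : ν (0, 1) = 0) (n : ℕ) :
    IsGaussCoeff (ν + Finsupp.single (0, 1) n)
      (((n.factorial : ℚ_[p])⁻¹ • tangent p !![0, 1; 0, 0] ^ n) * l) := by
  induction n with
  | zero => simpa using h
  | succ n ih =>
    intro P
    have h1 : (((n + 1).factorial : ℚ_[p])⁻¹ • tangent p !![0, 1; 0, 0] ^ (n + 1)) * l =
        ((n : ℚ_[p]) + 1)⁻¹ • (tangent p !![0, 1; 0, 0] *
          (((n.factorial : ℚ_[p])⁻¹ • tangent p !![0, 1; 0, 0] ^ n) * l)) := by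
      simp only [factorial_succ_inv, pow_succ', smul_mul_assoc, mul_smul_comm, smul_smul, mul_assoc]
    have h2 : (n : ℚ_[p]) + 1 ≠ 0 := by exact_mod_cast n.succ_ne_zero
    rw [h1, restrict_smul_apply, restrict_tangent_mul_left, ih, gaussMap_leftDer_e, Poly.coeff_pd]
    simp only [Finsupp.add_apply, hν, Finsupp.single_eq_same, zero_add]
    rw [inv_mul_cancel_left₀ h2, add_assoc, ← Finsupp.single_add]

theorem IsGaussCoeff.mul_divPow {ν : MultiIndex} {l : Dist p} (h : IsGaussCoeff ν l)
    (hν : ν (1, 0) = 0) (n : ℕ) :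
    IsGaussCoeff (ν + Finsupp.single (1, 0) n)
      (l * ((n.factorial : ℚ_[p])⁻¹ • tangent p !![0, 0; 1, 0] ^ n)) := by
  induction n with
  | zero => simpa using h
  | succ n ih =>
    intro P
    have h1 : l * (((n + 1).factorial : ℚ_[p])⁻¹ • tangent p !![0, 0; 1, 0] ^ (n + 1)) =
        ((n : ℚ_[p]) + 1)⁻¹ • ((l *
          ((n.factorial : ℚ_[p])⁻¹ • tangent p !![0, 0; 1, 0] ^ n)) * tangent p !![0, 0; 1, 0]) := by
      simp only [factorial_succ_inv, pow_succ, smul_mul_assoc, mul_smul_comm, smul_smul, mul_assoc]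
    have h2 : (n : ℚ_[p]) + 1 ≠ 0 := by exact_mod_cast n.succ_ne_zero
    rw [h1, restrict_smul_apply, restrict_mul_tangent, ih, gaussMap_rightDer_f, Poly.coeff_pd]
    simp only [Finsupp.add_apply, hν, Finsupp.single_eq_same, zero_add]
    rw [inv_mul_cancel_left₀ h2, add_assoc, ← Finsupp.single_add]

/-- The binomial coefficient `t (t - 1) ⋯ (t - n + 1) / n!`. -/
def distBinom (t : Dist p) (n : ℕ) : Dist p :=
  (n.factorial : ℚ_[p])⁻¹ • Polynomial.aeval t (descPochhammer ℚ_[p] n)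

theorem distBinom_zero (t : Dist p) : distBinom t 0 = 1 := by simp [distBinom]

theorem distBinom_succ_mul (t l : Dist p) (n : ℕ) : distBinom t (n + 1) * l =
    ((n : ℚ_[p]) + 1)⁻¹ • (t * (distBinom t n * l) - (n : ℚ_[p]) • (distBinom t n * l)) := by
  have h : descPochhammer ℚ_[p] (n + 1) =
      Polynomial.X * descPochhammer ℚ_[p] n - (n : ℚ_[p]) • descPochhammer ℚ_[p] n := by
    rw [descPochhammer_succ_right, Nat.cast_smul_eq_nsmul, nsmul_eq_mul]
    ring
  rw [distBinom, distBinom, factorial_succ_inv, h, map_sub, map_mul, Polynomial.aeval_X, map_smul]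
  simp only [smul_mul_assoc, mul_smul_comm, sub_mul, smul_sub, smul_smul, mul_assoc]
  congr 2
  ring

/-- At exponent `n` the operator `(1 + z₀₀) ∂₀₀` gives `(n + 1) c_(n+1) + n c_n`, so `(h₁ - n) / (n
+ 1)` moves from `c_n` to `c_(n+1)`; this is the recursion of the binomial coefficients. The extra
term `z₀₁ ∂₀₁` vanishes because the exponent of `z₀₁` is still zero, so the diagonal factors have to
be applied before those of `e`. -/
theorem IsGaussCoeff.binom_h₁_mul {ν : MultiIndex} {l : Dist p} (h : IsGaussCoeff ν l)
    (h01 : ν (0, 1) = 0) (h00 : ν (0, 0) = 0) (n : ℕ) :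
    IsGaussCoeff (ν + Finsupp.single (0, 0) n) (distBinom (tangent p !![1, 0; 0, 0]) n * l) := by
  induction n with
  | zero => simpa [distBinom_zero] using h
  | succ n ih =>
    intro P
    have h2 : (n : ℚ_[p]) + 1 ≠ 0 := by exact_mod_cast n.succ_ne_zero
    rw [distBinom_succ_mul, restrict_smul_apply, restrict_sub_apply, restrict_smul_apply,
      restrict_tangent_mul_left, ih, ih, gaussMap_leftDer_h₁, map_add, map_add,
      Poly.coeff_z_mul_pd, Poly.coeff_z_mul_pd, Poly.coeff_pd]
    simp only [Finsupp.add_apply, h00, h01, Finsupp.single_eq_same, zero_add, ne_eq, Prod.mk.injEq,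
      one_ne_zero, and_false, not_false_eq_true, Finsupp.single_eq_of_ne,
      Nat.cast_zero, zero_mul, add_zero, add_sub_cancel_right]
    rw [inv_mul_cancel_left₀ h2, add_assoc, ← Finsupp.single_add]

theorem IsGaussCoeff.binom_h₂_mul {ν : MultiIndex} {l : Dist p} (h : IsGaussCoeff ν l)
    (h01 : ν (0, 1) = 0) (h11 : ν (1, 1) = 0) (n : ℕ) :
    IsGaussCoeff (ν + Finsupp.single (1, 1) n) (distBinom (tangent p !![0, 0; 0, 1]) n * l) := by
  induction n with
  | zero => simpa [distBinom_zero] using h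
  | succ n ih =>
    intro P
    have h2 : (n : ℚ_[p]) + 1 ≠ 0 := by exact_mod_cast n.succ_ne_zero
    rw [distBinom_succ_mul, restrict_smul_apply, restrict_sub_apply, restrict_smul_apply,
      restrict_tangent_mul_left, ih, ih, gaussMap_leftDer_h₂, map_sub, map_add,
      Poly.coeff_z_mul_pd, Poly.coeff_z_mul_pd, Poly.coeff_pd]
    simp only [Finsupp.add_apply, h11, h01, Finsupp.single_eq_same, zero_add, ne_eq, Prod.mk.injEq,
      zero_ne_one, and_true, not_false_eq_true, Finsupp.single_eq_of_ne,
      Nat.cast_zero, zero_mul, sub_zero, add_zero, add_sub_cancel_right]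
    rw [inv_mul_cancel_left₀ h2, add_assoc, ← Finsupp.single_add]

end Dist

open WideOpen.Dist

theorem theta_divPow (X : Gl2 p) (n : ℕ) : theta p (divPow p (Env.ι p X) n) =
    (n.factorial : ℚ_[p])⁻¹ • tangent p X ^ n := by
  rw [divPow, map_smul, map_pow, theta_ι]

theorem theta_binom (X : Gl2 p) (n : ℕ) : theta p (binom p (Env.ι p X) n) =
    distBinom (tangent p X) n := by
  rw [binom, map_smul, ← Polynomial.aeval_algHom_apply, theta_ι, distBinom]

/-- The exponents of a Poincaré–Birkhoff–Witt monomial. -/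
def pbwExp (μ : MultiIndex) : Fin 4 → ℕ := ![μ (0, 1), μ (0, 0), μ (1, 1), μ (1, 0)]

/-- The multi-index with given exponents of a Poincaré–Birkhoff–Witt monomial. -/
def pbwIndex (ν : Fin 4 → ℕ) : MultiIndex :=
  Finsupp.single (1, 1) (ν 2) + Finsupp.single (0, 0) (ν 1) + Finsupp.single (0, 1) (ν 0) +
    Finsupp.single (1, 0) (ν 3)

theorem pbwIndex_pbwExp (μ : MultiIndex) : pbwIndex (pbwExp μ) = μ := by
  ext ⟨i, j⟩
  fin_cases i <;> fin_cases j <;> simp [pbwIndex, pbwExp]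

theorem pbwExp_pbwIndex (ν : Fin 4 → ℕ) : pbwExp (pbwIndex ν) = ν := by
  ext i
  fin_cases i <;> simp [pbwIndex, pbwExp]

/-- The monomial is built up from the unit: `h₂`, then `h₁`, then `e` from the left, and finally `f`
from the right. In this order every exponent that must vanish does so. -/
theorem isGaussCoeff_theta_pbw (ν : Fin 4 → ℕ) :
    IsGaussCoeff (pbwIndex ν) (theta p (Env.pbw ν)) := by
  have h := ((((isGaussCoeff_one (p := p)).binom_h₂_mul rfl rfl (ν 2)).binom_h₁_mul
    (by simp) (by simp) (ν 1)).divPow_mul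
    (by simp) (ν 0)).mul_divPow (by simp) (ν 3)
  rw [zero_add, mul_one, ← theta_divPow, ← theta_divPow, ← theta_binom, ← theta_binom] at h
  have h2 : Env.pbw ν = divPow p (Env.ι p !![0, 1; 0, 0]) (ν 0) *
      (binom p (Env.ι p !![1, 0; 0, 0]) (ν 1) * binom p (Env.ι p !![0, 0; 0, 1]) (ν 2)) *
      divPow p (Env.ι p !![0, 0; 1, 0]) (ν 3) := by
    simp only [Env.pbw, Env.e, Env.h₁, Env.h₂, Env.f, mul_assoc]
  rw [h2, map_mul, map_mul, map_mul]
  exact h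

end

section

open Filter Topology WideOpen.Dist

variable {p : ℕ} [hp : Fact p.Prime]

/-! ### The divided power enveloping algebras in terms of moments -/

theorem Env.intCoe_smul (c : ℤ_[p]) (u : Env p) : c • u = (c : ℚ_[p]) • u := rfl

theorem Dist.intCoe_smul (c : ℤ_[p]) (l : Dist p) : c • l = (c : ℚ_[p]) • l := rfl

instance : IsScalarTower ℤ_[p] ℚ_[p] (Dist p) := IsScalarTower.of_algebraMap_eq' rfl

variable (p) in
/-- The homomorphism from the enveloping algebra to the distribution algebra over `ℤ_p`. -/
def thetaInt : Env p →ₐ[ℤ_[p]] Dist p := (theta p).restrictScalars ℤ_[p]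

theorem gaussMap_weight_bound (m : ℕ) {C : ℝ} (hC : 0 ≤ C) (μ ν : MultiIndex) :
    ‖Poly.coeff ν (gaussMap p (Poly.mon p μ))‖ * (C * levelNorm p m ν) ≤ C * levelNorm p m μ := by
  rw [mul_left_comm]
  exact mul_le_mul_of_nonneg_left (norm_coeff_gaussMap_mul_le m μ ν) hC

theorem Dist.IsGaussCoeff.levelBound {ν : MultiIndex} {l : Dist p} (h : IsGaussCoeff ν l) (m : ℕ) :
    LevelBound m (levelNorm p m ν)⁻¹ l := by
  intro μ
  rw [← restrict_mon, h, inv_mul_eq_div, le_div_iff₀ (levelNorm_pos p m ν)]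
  exact norm_coeff_gaussMap_mul_le m μ ν

theorem levelBound_one (m : ℕ) : LevelBound m 1 (1 : Dist p) := by
  simpa [levelNorm_zero] using (isGaussCoeff_one (p := p)).levelBound m

omit hp in
theorem levelFactorial_pbwIndex (m : ℕ) (ν : Fin 4 → ℕ) : levelFactorial p m (pbwIndex ν) =
    qFactorial p m (ν 0) * qFactorial p m (ν 1) * qFactorial p m (ν 2) * qFactorial p m (ν 3) := by
  rw [levelFactorial, Fintype.prod_prod_type, Fin.prod_univ_two, Fin.prod_univ_two, Fin.prod_univ_two]
  simp [pbwIndex]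
  ring

theorem generator_eq_smul_pbw (m : ℕ) (ν : Fin 4 → ℕ) :
    generator p m ν = (levelFactorial p m (pbwIndex ν) : ℚ_[p]) • Env.pbw ν := by
  rw [Env.generator_eq, levelFactorial_pbwIndex]

theorem levelBound_theta_of_mem {m : ℕ} {u : Env p} (hu : u ∈ levelModule p m) :
    LevelBound m 1 (theta p u) := by
  induction hu using Submodule.span_induction with
  | mem u hu =>
    obtain ⟨ν, rfl⟩ := hu
    rw [generator_eq_smul_pbw, map_smul]
    have h := ((isGaussCoeff_theta_pbw (p := p) ν).levelBound m).smul
      (levelFactorial p m (pbwIndex ν) : ℚ_[p])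
    rwa [norm_levelFactorial, mul_inv_cancel₀ (levelNorm_pos p m _).ne'] at h
  | zero =>
    rw [map_zero]
    intro ν
    have : (0 : Dist p) (Fn.monomial ν) = 0 := rfl
    rw [this, norm_zero, one_mul]
    exact (levelNorm_pos p m ν).le
  | add x y _ _ hx hy =>
    rw [map_add]
    exact hx.add hy
  | smul c x _ hx =>
    rw [Env.intCoe_smul, map_smul]
    refine (hx.smul (c : ℚ_[p])).mono ?_
    rw [mul_one]
    exact c.2

/-- For the converse, the coefficients of `u` in the Poincaré–Birkhoff–Witt elements are the Gauss
coordinates of `θ(u)`. The bound on the moments passes to them, and it says that each coefficient is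
an integral multiple of the factorials in the generator. -/
theorem mem_levelModule_iff {m : ℕ} {u : Env p} :
    u ∈ levelModule p m ↔ LevelBound m 1 (theta p u) := by
  refine ⟨levelBound_theta_of_mem, fun h => ?_⟩
  have hu : u ∈ Submodule.span ℚ_[p] (Set.range (Env.pbw : (Fin 4 → ℕ) → Env p)) := by
    rw [Env.span_pbw]
    trivial
  obtain ⟨c, rfl⟩ := (Finsupp.mem_span_range_iff_exists_finsupp).1 hu
  let φ : Poly p →ₗ[ℚ_[p]] ℚ_[p] := c.sum fun ν a => a • Poly.coeff (pbwIndex ν)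
  have hφ : ∀ P, φ P = c.sum fun ν a => a * Poly.coeff (pbwIndex ν) P := fun P => by
    simp only [φ, Finsupp.sum, LinearMap.sum_apply, LinearMap.smul_apply, smul_eq_mul]
  have hinj : ∀ ν ν', pbwIndex ν = pbwIndex ν' → ν = ν' := fun ν ν' h => by
    rw [← pbwExp_pbwIndex ν, h, pbwExp_pbwIndex]
  have hmon : ∀ μ, φ (Poly.mon p μ) = c (pbwExp μ) := fun μ => by
    rw [hφ, Finsupp.sum, Finset.sum_eq_single (pbwExp μ)]
    · rw [pbwIndex_pbwExp, Poly.coeff_mon, if_pos rfl, mul_one]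
    · intro ν _ hν
      rw [Poly.coeff_mon, if_neg, mul_zero]
      rintro rfl
      exact hν (pbwExp_pbwIndex ν).symm
    · intro h
      rw [Finsupp.notMem_support_iff.1 h, zero_mul]
  have hgauss : ∀ P, φ (gaussMap p P) =
      (restrict (theta p (c.sum fun ν a => a • Env.pbw ν))).ofConv P := fun P => by
    rw [hφ, Finsupp.sum, Finsupp.sum, map_sum]
    have : (restrict (∑ ν ∈ c.support, theta p (c ν • Env.pbw ν))).ofConv P =
        ∑ ν ∈ c.support, (restrict (theta p (c ν • Env.pbw ν))).ofConv P :=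
      map_sum (evalAt (Poly.toFn p P)) _ _
    rw [this]
    refine Finset.sum_congr rfl fun ν _ => ?_
    rw [map_smul, restrict_smul_apply, isGaussCoeff_theta_pbw]
  have hle := norm_le_of_norm_gaussMap_le (φ := φ) (w := levelNorm p m) (C := 1)
    (fun μ => by rw [one_mul]; exact (levelNorm_pos p m μ).le)
    (fun μ ν _ => gaussMap_weight_bound m zero_le_one μ ν)
    -- The coefficients have finite support, so only finitely many indices could violate the bound;
    -- this starts the descending induction.
    (by
      refine (c.support.finite_toSet.image pbwIndex).subset fun μ hμ => ?_
      refine ⟨pbwExp μ, ?_, pbwIndex_pbwExp μ⟩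
      rw [Finset.mem_coe, Finsupp.mem_support_iff, ← hmon]
      intro h0
      rw [Set.mem_ofPred_eq, h0, norm_zero, one_mul] at hμ
      exact absurd hμ (not_lt.2 (levelNorm_pos p m μ).le))
    (fun μ => by rw [hgauss, restrict_mon]; exact h μ)
  refine Submodule.sum_mem _ fun ν _ => ?_
  have h1 := hle (pbwIndex ν)
  rw [hmon, pbwExp_pbwIndex, one_mul] at h1
  have h2 : ‖c ν * (levelFactorial p m (pbwIndex ν) : ℚ_[p])⁻¹‖ ≤ 1 := by
    rw [norm_mul, norm_inv, norm_levelFactorial]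
    exact mul_inv_le_one_of_le₀ h1 (levelNorm_pos p m _).le
  let d : ℤ_[p] := ⟨c ν * (levelFactorial p m (pbwIndex ν) : ℚ_[p])⁻¹, h2⟩
  have hd : (d : ℚ_[p]) = c ν * (levelFactorial p m (pbwIndex ν) : ℚ_[p])⁻¹ := rfl
  have h3 : c ν • Env.pbw ν = d • generator p m ν := by
    rw [Env.intCoe_smul, generator_eq_smul_pbw, hd, smul_smul,
      inv_mul_cancel_right₀ (levelFactorial_ne_zero m _)]
  change c ν • Env.pbw ν ∈ _
  rw [h3]
  exact Submodule.smul_mem _ _ (Submodule.subset_span ⟨ν, rfl⟩)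

/-- The submodule `levelModule p m` is a subalgebra. -/
theorem toSubmodule_level (m : ℕ) : Subalgebra.toSubmodule (level p m) = levelModule p m := by
  let S : Subalgebra ℤ_[p] (Env p) := (levelModule p m).toSubalgebra
    (by rw [mem_levelModule_iff, map_one]; exact levelBound_one m)
    (fun x y hx hy => by
      rw [mem_levelModule_iff] at hx hy ⊢
      rw [map_mul]
      simpa using hx.mul zero_le_one zero_le_one hy)
  have h : level p m = S :=
    le_antisymm (Algebra.adjoin_le fun x hx => hx) (fun x hx => Algebra.subset_adjoin hx)
  rw [h]
  rfl

theorem mem_level_iff {m : ℕ} {u : Env p} : u ∈ level p m ↔ LevelBound m 1 (theta p u) := by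
  rw [← mem_levelModule_iff, ← toSubmodule_level]
  rfl

theorem coe_natCast_pow_mul {m n : ℕ} (y : level p m) :
    ((y * (p : level p m) ^ n : level p m) : Env p) = ((p : ℚ_[p]) ^ n) • (y : Env p) := by
  rw [← (Nat.cast_commute p y).pow_left n, Algebra.smul_def, map_pow, map_natCast]
  simp

/-- The `p`-adic filtration on the level algebra is the filtration by the size of the moments; hence
completing it means completing for the weighted sup norm. -/
theorem mem_powIdeal_level_iff {m n : ℕ} {u : level p m} :
    u ∈ powIdeal p (level p m) n ↔ LevelBound m (‖(p : ℚ_[p])‖ ^ n) (theta p u) := by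
  have hp0 : (p : ℚ_[p]) ≠ 0 := Nat.cast_ne_zero.2 hp.out.ne_zero
  rw [mem_powIdeal]
  constructor
  · rintro ⟨y, rfl⟩
    rw [coe_natCast_pow_mul, map_smul]
    simpa using (mem_level_iff.1 y.2).smul ((p : ℚ_[p]) ^ n)
  · intro h
    have h2 : (((p : ℚ_[p]) ^ n)⁻¹ • (u : Env p)) ∈ level p m := by
      rw [mem_level_iff, map_smul]
      have h3 := h.smul (((p : ℚ_[p]) ^ n)⁻¹)
      rwa [norm_inv, norm_pow, inv_mul_cancel₀ (pow_ne_zero n (norm_ne_zero_iff.2 hp0))] at h3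
    refine ⟨⟨_, h2⟩, Subtype.ext ?_⟩
    rw [coe_natCast_pow_mul, smul_inv_smul₀ (pow_ne_zero n hp0)]

/-! ### The extension to the completion -/

theorem Dist.ext_mon {l l' : Dist p} (h : ∀ μ, l (Fn.monomial μ) = l' (Fn.monomial μ)) : l = l' :=
  restrict_injective (WithConv.ext (Poly.linearMap_ext fun μ => by
    rw [restrict_mon, restrict_mon, h]))

theorem Dist.eq_of_levelBound {m : ℕ} {l l' : Dist p}
    (h : ∀ n : ℕ, LevelBound m (‖(p : ℚ_[p])‖ ^ n) (l - l')) : l = l' := by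
  refine Dist.ext_mon fun μ => sub_eq_zero.1 (norm_le_zero_iff.1 ?_)
  have h2 : Tendsto (fun n : ℕ => ‖(p : ℚ_[p])‖ ^ n * levelNorm p m μ) atTop (𝓝 0) := by
    simpa using (tendsto_pow_atTop_nhds_zero_of_lt_one (norm_nonneg _)
      (Padic.norm_p_lt_one (p := p))).mul_const (levelNorm p m μ)
  exact ge_of_tendsto' h2 fun n => h n μ

/-- The distribution `l` is the limit of the images of the components of `x`. -/
def IsImage {m : ℕ} (x : PadicCompletion p (level p m)) (l : Dist p) : Prop :=
  ∀ (n : ℕ) (u : level p m), Ideal.Quotient.mk (powIdeal p (level p m) n) u = x.1 n →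
    LevelBound m (‖(p : ℚ_[p])‖ ^ n) (l - theta p u)

theorem IsImage.unique {m : ℕ} {x : PadicCompletion p (level p m)} {l l' : Dist p}
    (h : IsImage x l) (h' : IsImage x l') : l = l' := by
  refine Dist.eq_of_levelBound (m := m) fun n => ?_
  obtain ⟨u, hu⟩ := Ideal.Quotient.mk_surjective (x.1 n)
  have h3 : l - l' = (l - theta p u) + -(l' - theta p u) := by abel
  rw [h3]
  exact (h n u hu).add (h' n u hu).neg

/-- One representative for each `n` suffices, since two representatives differ by an element whose
image has moments of size `|p|^n` relative to the weight. -/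
theorem isImage_of_forall_exists {m : ℕ} {x : PadicCompletion p (level p m)} {l : Dist p}
    (h : ∀ n, ∃ u : level p m, Ideal.Quotient.mk (powIdeal p (level p m) n) u = x.1 n ∧
      LevelBound m (‖(p : ℚ_[p])‖ ^ n) (l - theta p u)) : IsImage x l := by
  intro n u hu
  obtain ⟨v, hv, hl⟩ := h n
  have h2 : v - u ∈ powIdeal p (level p m) n := by
    rw [← Ideal.Quotient.eq, hv, hu]
  have h3 : l - theta p u = (l - theta p v) + theta p ((v - u : level p m) : Env p) := by
    rw [AddSubgroupClass.coe_sub, map_sub]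
    abel
  rw [h3]
  exact hl.add (mem_powIdeal_level_iff.1 h2)

theorem PadicCompletion.mk_eq_of_le {A : Type*} [Ring A] [Algebra ℤ_[p] A]
    (x : PadicCompletion p A) {n k : ℕ} (h : n ≤ k) {u : A}
    (hu : Ideal.Quotient.mk (powIdeal p A k) u = x.1 k) :
    Ideal.Quotient.mk (powIdeal p A n) u = x.1 n := by
  induction k, h using Nat.le_induction with
  | base => exact hu
  | succ k _ ih =>
    refine ih ?_
    have h2 := x.2 k
    rw [← hu] at h2
    exact h2

/-- The weight of level `m` decays at least like the powers of the radius of level `m + 1`, which is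
smaller than `1`, so such moments define a continuous form. -/
theorem Dist.exists_of_levelBound {m : ℕ} {a : MultiIndex → ℚ_[p]} {C : ℝ} (hC : 0 ≤ C)
    (h : ∀ μ, ‖a μ‖ ≤ C * levelNorm p m μ) : ∃ l : Dist p, ∀ μ, l (Fn.monomial μ) = a μ := by
  let φ : Poly p →ₗ[ℚ_[p]] ℚ_[p] :=
    (MvPolynomial.basisMonomials (Fin 2 × Fin 2) ℚ_[p]).constr ℚ_[p] a
  have hφ : ∀ μ, φ (Poly.mon p μ) = a μ := fun μ => by
    have h := (MvPolynomial.basisMonomials (Fin 2 × Fin 2) ℚ_[p]).constr_basis ℚ_[p] a μ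
    rwa [MvPolynomial.coe_basisMonomials] at h
  obtain ⟨l, hl⟩ := exists_restrict_eq φ ⟨_, levelRadius_pos p (m + 1), levelRadius_lt_one p (m + 1)⟩
    (C * (p : ℝ) ^ 4) (by positivity) fun μ => by
      rw [hφ, mul_assoc]
      exact (h μ).trans (mul_le_mul_of_nonneg_left (levelNorm_le_levelRadius_pow p m μ) hC)
  refine ⟨l, fun μ => ?_⟩
  rw [← restrict_mon, hl]
  exact hφ μ

/-- The moments of successive representatives form Cauchy sequences, with the same rate relative to
the weight for all `μ`; their limits are again moments of level `m`. -/
theorem exists_isImage {m : ℕ} (x : PadicCompletion p (level p m)) : ∃ l, IsImage x l := by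
  choose u hu using fun n => Ideal.Quotient.mk_surjective (x.1 n)
  have hdiff : ∀ n k, n ≤ k → LevelBound m (‖(p : ℚ_[p])‖ ^ n) (theta p (u k) - theta p (u n)) := by
    intro n k h
    have h2 : u k - u n ∈ powIdeal p (level p m) n := by
      rw [← Ideal.Quotient.eq, hu, PadicCompletion.mk_eq_of_le x h (hu k)]
    have h3 := mem_powIdeal_level_iff.1 h2
    rwa [AddSubgroupClass.coe_sub, map_sub] at h3
  have hlim : ∀ μ, ∃ a : ℚ_[p],
      Tendsto (fun n => theta p (u n) (Fn.monomial μ)) atTop (𝓝 a) := by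
    intro μ
    refine cauchySeq_tendsto_of_complete (cauchySeq_of_le_tendsto_0
      (fun n => ‖(p : ℚ_[p])‖ ^ n * levelNorm p m μ + ‖(p : ℚ_[p])‖ ^ n * levelNorm p m μ) ?_ ?_)
    · intro k l n hk hl
      refine (dist_triangle_right _ _ (theta p (u n) (Fn.monomial μ))).trans (add_le_add ?_ ?_)
      · rw [dist_eq_norm]
        exact hdiff n k hk μ
      · rw [dist_eq_norm]
        exact hdiff n l hl μ
    · have h := (tendsto_pow_atTop_nhds_zero_of_lt_one (norm_nonneg _)
        (Padic.norm_p_lt_one (p := p))).mul_const (levelNorm p m μ)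
      simpa using h.add h
  choose a ha using hlim
  have hbound : ∀ n μ, ‖a μ - theta p (u n) (Fn.monomial μ)‖ ≤
      ‖(p : ℚ_[p])‖ ^ n * levelNorm p m μ := by
    intro n μ
    refine le_of_tendsto ((ha μ).sub_const _).norm (eventually_atTop.2 ⟨n, fun k hk => ?_⟩)
    exact hdiff n k hk μ
  obtain ⟨l, hl⟩ := Dist.exists_of_levelBound (m := m) (a := a) zero_le_one fun μ => by
    have h3 : a μ = (a μ - theta p (u 0) (Fn.monomial μ)) + theta p (u 0) (Fn.monomial μ) := by ring
    rw [h3]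
    refine (Padic.nonarchimedean _ _).trans (max_le ?_ (mem_level_iff.1 (u 0).2 μ))
    simpa using hbound 0 μ
  refine ⟨l, isImage_of_forall_exists fun n => ⟨u n, hu n, fun μ => ?_⟩⟩
  change ‖l (Fn.monomial μ) - theta p (u n) (Fn.monomial μ)‖ ≤ _
  rw [hl]
  exact hbound n μ

/-- The limit of the images of the components. -/
def completionFun {m : ℕ} (x : PadicCompletion p (level p m)) : Dist p := (exists_isImage x).choose

theorem isImage_completionFun {m : ℕ} (x : PadicCompletion p (level p m)) :
    IsImage x (completionFun x) := (exists_isImage x).choose_spec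

theorem isImage_of {m : ℕ} (u : level p m) :
    IsImage (PadicCompletion.of p (level p m) u) (theta p u) :=
  isImage_of_forall_exists fun n => ⟨u, rfl, by
    rw [sub_self]
    intro ν
    have : (0 : Dist p) (Fn.monomial ν) = 0 := rfl
    rw [this, norm_zero]
    exact mul_nonneg (by positivity) (levelNorm_pos p m ν).le⟩

theorem IsImage.add {m : ℕ} {x y : PadicCompletion p (level p m)} {l l' : Dist p}
    (h : IsImage x l) (h' : IsImage y l') : IsImage (x + y) (l + l') :=
  isImage_of_forall_exists fun n => by
    obtain ⟨u, hu⟩ := Ideal.Quotient.mk_surjective (x.1 n)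
    obtain ⟨v, hv⟩ := Ideal.Quotient.mk_surjective (y.1 n)
    refine ⟨u + v, ?_, ?_⟩
    · rw [RingHom.map_add, hu, hv]
      rfl
    · have h3 : l + l' - theta p ((u + v : level p m) : Env p) =
          (l - theta p u) + (l' - theta p v) := by
        rw [AddMemClass.coe_add, map_add]
        abel
      rw [h3]
      exact (h n u hu).add (h' n v hv)

theorem IsImage.mul {m : ℕ} {x y : PadicCompletion p (level p m)} {l l' : Dist p}
    (h : IsImage x l) (h' : IsImage y l') : IsImage (x * y) (l * l') := by
  have hl : LevelBound m 1 l := by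
    obtain ⟨u, hu⟩ := Ideal.Quotient.mk_surjective (x.1 0)
    have h2 := (h 0 u hu).add (by simpa using mem_level_iff.1 u.2)
    simpa using h2
  refine isImage_of_forall_exists fun n => ?_
  obtain ⟨u, hu⟩ := Ideal.Quotient.mk_surjective (x.1 n)
  obtain ⟨v, hv⟩ := Ideal.Quotient.mk_surjective (y.1 n)
  refine ⟨u * v, ?_, ?_⟩
  · rw [RingHom.map_mul, hu, hv]
    rfl
  · have h3 : l * l' - theta p ((u * v : level p m) : Env p) =
        l * (l' - theta p v) + (l - theta p u) * theta p v := by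
      rw [MulMemClass.coe_mul, map_mul, mul_sub, sub_mul]
      abel
    rw [h3]
    refine LevelBound.add ?_ ?_
    · simpa using hl.mul zero_le_one (by positivity) (h' n v hv)
    · simpa using (h n u hu).mul (by positivity) zero_le_one (mem_level_iff.1 v.2)

variable (p) in
/-- The extension of the homomorphism from the enveloping algebra to the completions. -/
def completionHom (m : ℕ) : PadicCompletion p (level p m) →ₐ[ℤ_[p]] Dist p where
  toFun := completionFun
  map_one' := (isImage_completionFun _).unique (by
    simpa using isImage_of (p := p) (m := m) 1)
  map_mul' x y := (isImage_completionFun _).unique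
    ((isImage_completionFun x).mul (isImage_completionFun y))
  map_zero' := (isImage_completionFun _).unique (by
    simpa using isImage_of (p := p) (m := m) 0)
  map_add' x y := (isImage_completionFun _).unique
    ((isImage_completionFun x).add (isImage_completionFun y))
  commutes' c := (isImage_completionFun _).unique (by
    have h := isImage_of (p := p) (m := m) (algebraMap ℤ_[p] _ c)
    rw [AlgHom.commutes] at h
    exact ((thetaInt p).commutes c) ▸ h)

theorem isImage_completionHom {m : ℕ} (x : PadicCompletion p (level p m)) :
    IsImage x (completionHom p m x) := isImage_completionFun x

theorem completionHom_of {m : ℕ} (u : level p m) :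
    completionHom p m (PadicCompletion.of p (level p m) u) = theta p u :=
  (isImage_completionHom _).unique (isImage_of u)

theorem levelBound_completionHom {m : ℕ} (x : PadicCompletion p (level p m)) :
    LevelBound m 1 (completionHom p m x) := by
  obtain ⟨u, hu⟩ := Ideal.Quotient.mk_surjective (x.1 0)
  have h2 := (isImage_completionHom x 0 u hu).add (by simpa using mem_level_iff.1 u.2)
  simpa using h2

/-- If the image is zero, each representative modulo `p^n` has moments of size `|p|^n` relative to
the weight, so it lies in the `n`-th ideal. -/
theorem completionHom_injective (m : ℕ) : Function.Injective (completionHom p m) := by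
  refine (injective_iff_map_eq_zero _).2 fun x hx => Subtype.ext (funext fun n => ?_)
  obtain ⟨u, hu⟩ := Ideal.Quotient.mk_surjective (x.1 n)
  have h := (isImage_completionHom x n u hu).neg
  rw [hx, zero_sub, neg_neg] at h
  rw [← hu]
  exact Ideal.Quotient.eq_zero_iff_mem.2 (mem_powIdeal_level_iff.2 h)

/-- A distribution whose coordinates with respect to the Gauss decomposition are integral of level
`m` and tend to zero relative to that level is the image of an element of the completion. -/
theorem exists_completionHom_eq {m : ℕ} {l : Dist p} (φ : Poly p →ₗ[ℚ_[p]] ℚ_[p])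
    (h : ∀ P, (restrict l).ofConv P = φ (gaussMap p P))
    (hφ : ∀ μ, ‖φ (Poly.mon p μ)‖ ≤ levelNorm p m μ)
    (hfin : ∀ n : ℕ, {μ | ‖(p : ℚ_[p])‖ ^ n * levelNorm p m μ < ‖φ (Poly.mon p μ)‖}.Finite) :
    ∃ x, completionHom p m x = l := by
  -- Truncation of the Gauss expansion to the finitely many coordinates larger than `|p|^n` times
  -- the weight. The coordinates left over are at most that size, and the coordinate change carries
  -- this bound to the moments.
  let v : ℕ → Env p := fun n =>
    ∑ μ ∈ (hfin n).toFinset, φ (Poly.mon p μ) • Env.pbw (pbwExp μ)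
  have hv : ∀ n, LevelBound m (‖(p : ℚ_[p])‖ ^ n) (l - theta p (v n)) := by
    intro n
    let ψ : Poly p →ₗ[ℚ_[p]] ℚ_[p] := φ - ∑ μ ∈ (hfin n).toFinset, φ (Poly.mon p μ) • Poly.coeff μ
    have hψmon : ∀ μ, ‖ψ (Poly.mon p μ)‖ ≤ ‖(p : ℚ_[p])‖ ^ n * levelNorm p m μ := by
      intro μ
      have h1 : ψ (Poly.mon p μ) =
          φ (Poly.mon p μ) - if μ ∈ (hfin n).toFinset then φ (Poly.mon p μ) else 0 := by
        simp only [ψ, LinearMap.sub_apply, LinearMap.sum_apply, LinearMap.smul_apply,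
          Poly.coeff_mon, smul_eq_mul, mul_ite, mul_one, mul_zero, Finset.sum_ite_eq]
      rw [h1]
      split_ifs with hμ
      · rw [sub_self, norm_zero]
        exact mul_nonneg (by positivity) (levelNorm_pos p m μ).le
      · rw [sub_zero]
        rwa [Set.Finite.mem_toFinset, Set.mem_ofPred_eq, not_lt] at hμ
    intro μ
    have h2 : (l - theta p (v n)) (Fn.monomial μ) = ψ (gaussMap p (Poly.mon p μ)) := by
      rw [← restrict_mon, restrict_sub_apply, h]
      simp only [ψ, v, LinearMap.sub_apply, LinearMap.sum_apply, LinearMap.smul_apply, map_sum]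
      congr 1
      have : (restrict (∑ ν ∈ (hfin n).toFinset,
          theta p (φ (Poly.mon p ν) • Env.pbw (pbwExp ν)))).ofConv (Poly.mon p μ) =
          ∑ ν ∈ (hfin n).toFinset,
          (restrict (theta p (φ (Poly.mon p ν) • Env.pbw (pbwExp ν)))).ofConv (Poly.mon p μ) :=
        map_sum (evalAt (Poly.toFn p (Poly.mon p μ))) _ _
      rw [this]
      refine Finset.sum_congr rfl fun ν _ => ?_
      rw [map_smul, restrict_smul_apply, isGaussCoeff_theta_pbw, pbwIndex_pbwExp, smul_eq_mul]
    rw [h2]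
    exact norm_gaussMap_le_of_norm_le (w := levelNorm p m)
      (fun μ => mul_nonneg (by positivity) (levelNorm_pos p m μ).le)
      (fun μ ν _ => gaussMap_weight_bound m (by positivity) μ ν) hψmon μ
  have hl : LevelBound m 1 l := by
    intro μ
    rw [← restrict_mon, h]
    exact norm_gaussMap_le_of_norm_le (w := levelNorm p m) (C := 1)
      (fun μ => mul_nonneg zero_le_one (levelNorm_pos p m μ).le)
      (fun μ ν _ => gaussMap_weight_bound m zero_le_one μ ν) (fun μ => by simpa using hφ μ) μ
  have hmem : ∀ n, v n ∈ level p m := by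
    intro n
    rw [mem_level_iff]
    have h1 := ((hv n).mono (pow_le_one₀ (norm_nonneg _) Padic.norm_p_lt_one.le)).neg.add hl
    simpa using h1
  let x : PadicCompletion p (level p m) :=
    ⟨fun n => Ideal.Quotient.mk (powIdeal p (level p m) n) ⟨v n, hmem n⟩, fun n => by
      change Ideal.Quotient.mk (powIdeal p (level p m) n) ⟨v (n + 1), hmem (n + 1)⟩ =
        Ideal.Quotient.mk (powIdeal p (level p m) n) ⟨v n, hmem n⟩
      rw [Ideal.Quotient.eq, mem_powIdeal_level_iff, AddSubgroupClass.coe_sub, map_sub]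
      have h1 := ((hv (n + 1)).mono (pow_le_pow_of_le_one (norm_nonneg _)
        Padic.norm_p_lt_one.le (Nat.le_succ n))).neg.add (hv n)
      have h2 : theta p (v (n + 1)) - theta p (v n) =
        -(l - theta p (v (n + 1))) + (l - theta p (v n)) := by abel
      rw [h2]
      exact h1⟩
  exact ⟨x, (isImage_completionHom x).unique
    (isImage_of_forall_exists fun n => ⟨⟨v n, hmem n⟩, rfl, hv n⟩)⟩

end

section

open Filter Topology WideOpen.Dist

variable {p : ℕ} [hp : Fact p.Prime]

/-! ### Neighbourhoods of zero in the distribution algebra -/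

/-- Monotone functions of subexponential growth with values at least `1`. -/
structure IsGrowth (ρ : ℕ → ℝ) : Prop where
  one_le : ∀ n, 1 ≤ ρ n
  mono : Monotone ρ
  bound : ∀ r : ℝ, 0 < r → r < 1 → ∃ C, ∀ n, ρ n * r ^ n ≤ C

theorem IsGrowth.pos {ρ : ℕ → ℝ} (h : IsGrowth ρ) (n : ℕ) : 0 < ρ n := one_pos.trans_le (h.one_le n)

theorem IsGrowth.const_mul {ρ : ℕ → ℝ} (h : IsGrowth ρ) {c : ℝ} (hc : 1 ≤ c) :
    IsGrowth fun n => c * ρ n where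
  one_le n := one_le_mul_of_one_le_of_one_le hc (h.one_le n)
  mono := h.mono.const_mul (zero_le_one.trans hc)
  bound r h0 h1 := by
    obtain ⟨C, hC⟩ := h.bound r h0 h1
    refine ⟨c * C, fun n => ?_⟩
    rw [mul_assoc]
    exact mul_le_mul_of_nonneg_left (hC n) (zero_le_one.trans hc)

/-- Doubling the argument costs a square root of the radius, which is again smaller than `1`. -/
theorem IsGrowth.comp_two_mul {ρ : ℕ → ℝ} (h : IsGrowth ρ) : IsGrowth fun n => ρ (2 * n) where
  one_le n := h.one_le _
  mono := h.mono.comp fun _ _ hij => Nat.mul_le_mul_left 2 hij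
  bound r h0 h1 := by
    obtain ⟨C, hC⟩ := h.bound (Real.sqrt r) (Real.sqrt_pos.2 h0) ((Real.sqrt_lt' one_pos).2 (by simpa))
    refine ⟨C, fun n => ?_⟩
    have := hC (2 * n)
    rwa [pow_mul, Real.sq_sqrt h0.le] at this

/-- The infimum of the functions `n ↦ M i * r i ^ (- n)`. -/
def infGrowth {ι : Type*} (M r : ι → ℝ) (n : ℕ) : ℝ := ⨅ i, M i * (r i ^ n)⁻¹

section InfGrowth

variable {ι : Type*} {M r : ι → ℝ} (hM : ∀ i, 1 ≤ M i) (h0 : ∀ i, 0 < r i) (h1 : ∀ i, r i < 1)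

include hM h0 in
theorem infGrowth_bddBelow (n : ℕ) : BddBelow (Set.range fun i => M i * (r i ^ n)⁻¹) :=
  ⟨0, by
    rintro _ ⟨i, rfl⟩
    have := h0 i
    have := zero_le_one.trans (hM i)
    positivity⟩

include hM h0 in
theorem infGrowth_le (n : ℕ) (i : ι) : infGrowth M r n ≤ M i * (r i ^ n)⁻¹ :=
  ciInf_le (infGrowth_bddBelow hM h0 n) i

-- Each index `i` bounds the infimum by a multiple of `r_i ^ (-n)`. Since the radii `r_i` come
-- arbitrarily close to `1`, the growth is subexponential.
include hM h0 h1 in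
theorem isGrowth_infGrowth [Nonempty ι] (hr : ∀ s < 1, ∃ i, s ≤ r i) :
    IsGrowth (infGrowth M r) where
  one_le n := le_ciInf fun i => one_le_mul_of_one_le_of_one_le (hM i)
    (one_le_inv₀ (pow_pos (h0 i) n) |>.2 (pow_le_one₀ (h0 i).le (h1 i).le))
  mono m n h := ciInf_mono (infGrowth_bddBelow hM h0 m) fun i =>
    mul_le_mul_of_nonneg_left (inv_anti₀ (pow_pos (h0 i) n)
      (pow_le_pow_of_le_one (h0 i).le (h1 i).le h)) (zero_le_one.trans (hM i))
  bound s hs0 hs1 := by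
    obtain ⟨i, hi⟩ := hr s hs1
    refine ⟨M i, fun n => ?_⟩
    calc infGrowth M r n * s ^ n ≤ M i * (r i ^ n)⁻¹ * r i ^ n := by
          have := h0 i
          have := zero_le_one.trans (hM i)
          gcongr
          exact infGrowth_le hM h0 n i
      _ = M i := by rw [mul_assoc, inv_mul_cancel₀ (pow_pos (h0 i) n).ne', mul_one]

end InfGrowth

/-! ### Balls of subexponential growth and the continuity of convolution. -/

namespace Dist

/-- The distributions whose moments are bounded by the inverse of `ρ`. -/
def ball (ρ : ℕ → ℝ) (hρ : ∀ n, 0 ≤ ρ n) : Submodule ℤ_[p] (Dist p) where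
  carrier := {l | ∀ μ, ‖l (Fn.monomial μ)‖ * ρ μ.degree ≤ 1}
  zero_mem' μ := by
    have : (0 : Dist p) (Fn.monomial μ) = 0 := rfl
    rw [this, norm_zero, zero_mul]
    exact zero_le_one
  add_mem' {l l'} hl hl' μ := by
    refine (mul_le_mul_of_nonneg_right (Padic.nonarchimedean (l (Fn.monomial μ)) _) (hρ _)).trans ?_
    rw [max_mul_of_nonneg _ _ (hρ _)]
    exact max_le (hl μ) (hl' μ)
  smul_mem' c l hl μ := by
    have : (c • l) (Fn.monomial μ) = (c : ℚ_[p]) * l (Fn.monomial μ) := rfl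
    rw [this, norm_mul, mul_assoc]
    exact mul_le_one₀ c.2 (mul_nonneg (norm_nonneg _) (hρ _)) (hl μ)

instance : IsTopologicalAddGroup (Dist p) :=
  inferInstanceAs (IsTopologicalAddGroup (StrongDual ℚ_[p] (Fn p)))

instance : ContinuousSMul ℚ_[p] (Dist p) :=
  inferInstanceAs (ContinuousSMul ℚ_[p] (StrongDual ℚ_[p] (Fn p)))

instance : T2Space (Dist p) := inferInstanceAs (T2Space (StrongDual ℚ_[p] (Fn p)))

theorem hasBasis_nhds_zero_polar : (𝓝 (0 : Dist p)).HasBasis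
    (fun Sε : Set (Fn p) × ℝ => Bornology.IsVonNBounded ℚ_[p] Sε.1 ∧ 0 < Sε.2)
    fun Sε => {l | ∀ F ∈ Sε.1, ‖l F‖ ≤ Sε.2} := by
  have h := ContinuousLinearMap.hasBasis_nhds_zero_of_basis (σ := RingHom.id ℚ_[p]) (E := Fn p)
    (Metric.nhds_basis_closedBall (x := (0 : ℚ_[p])))
  simp only [mem_closedBall_zero_iff] at h
  exact h

theorem norm_apply_le_of_moments {l : Dist p} {F : Fn p} {C : ℝ} (hC : 0 ≤ C)
    (h : ∀ μ, ‖Fn.coeff μ F‖ * ‖l (Fn.monomial μ)‖ ≤ C) : ‖l F‖ ≤ C := by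
  refine le_of_tendsto (hasSum_apply l F).norm (Eventually.of_forall fun s => ?_)
  refine IsUltrametricDist.norm_sum_le_of_forall_le_of_nonneg hC fun μ _ => ?_
  rw [norm_mul]
  exact h μ

/-- If the Gauss norm of radius `r` is at most `M_r` on `S`, all coefficients of degree `n` are at
most `inf_r M_r r^(-n)`. Divided by `ε`, with the constants raised to at least `1`, this infimum
serves as `ρ`. -/
theorem exists_ball_subset_polar {S : Set (Fn p)} (hS : Bornology.IsVonNBounded ℚ_[p] S) {ε : ℝ}
    (hε : 0 < ε) : ∃ (ρ : ℕ → ℝ) (hρ : IsGrowth ρ),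
      ∀ l ∈ ball (p := p) ρ (fun n => (hρ.pos n).le), ∀ F ∈ S, ‖l F‖ ≤ ε := by
  rw [Fn.withSeminorms.isVonNBounded_iff_seminorm_bounded] at hS
  choose M hM0 hM using hS
  have hM1 : ∀ r, 1 ≤ max 1 (ε⁻¹ * M r) := fun r => le_max_left _ _
  have h0 : ∀ r : Fn.Radius, 0 < (r : ℝ) := fun r => r.2.1
  have hg : IsGrowth (infGrowth (fun r => max 1 (ε⁻¹ * M r)) fun r : Fn.Radius => (r : ℝ)) := by
    refine isGrowth_infGrowth hM1 h0 (fun r => r.2.2) fun s hs => ?_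
    refine ⟨⟨max s (1 / 2), lt_max_of_lt_right (by norm_num), max_lt hs (by norm_num)⟩, ?_⟩
    exact le_max_left _ _
  refine ⟨_, hg, fun l hl F hF => norm_apply_le_of_moments hε.le fun μ => ?_⟩
  have h2 : ε⁻¹ * ‖Fn.coeff μ F‖ ≤
      infGrowth (fun r => max 1 (ε⁻¹ * M r)) (fun r : Fn.Radius => (r : ℝ)) μ.degree := by
    refine le_ciInf fun r => ?_
    rw [← div_eq_mul_inv, le_div_iff₀ (pow_pos (h0 r) _), mul_assoc]
    refine le_trans ?_ (le_max_right _ _)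
    gcongr
    exact (Fn.le_gauss F r μ).trans (hM r F hF).le
  have h3 := hl μ
  have h4 : ε⁻¹ * (‖Fn.coeff μ F‖ * ‖l (Fn.monomial μ)‖) ≤ 1 := by
    calc _ = ‖l (Fn.monomial μ)‖ * (ε⁻¹ * ‖Fn.coeff μ F‖) := by ring
      _ ≤ _ := mul_le_mul_of_nonneg_left h2 (norm_nonneg _)
      _ ≤ 1 := h3
  rwa [inv_mul_le_iff₀ hε, mul_one] at h4

theorem exists_polar_subset_ball {ρ : ℕ → ℝ} (hρ : IsGrowth ρ) :
    ∃ S : Set (Fn p), Bornology.IsVonNBounded ℚ_[p] S ∧ ∃ ε > 0, ∀ l : Dist p,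
      (∀ F ∈ S, ‖l F‖ ≤ ε) → l ∈ ball ρ fun n => (hρ.pos n).le := by
  have hp1 : (1 : ℝ) < p := by exact_mod_cast hp.out.one_lt
  have hp0 : (0 : ℝ) < p := one_pos.trans hp1
  -- The set is bounded because `ρ(n) r^n` is. It contains `c z^μ` with `|c|` the largest power of
  -- `p` not exceeding `ρ(|μ|)`; the choice `ε = p⁻¹` makes up for this rounding.
  refine ⟨{F | ∀ μ, ‖Fn.coeff μ F‖ ≤ ρ μ.degree}, ?_, (p : ℝ)⁻¹, inv_pos.2 hp0, fun l hl μ => ?_⟩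
  · rw [Fn.withSeminorms.isVonNBounded_iff_seminorm_bounded]
    intro r
    obtain ⟨C, hC⟩ := hρ.bound r r.2.1 r.2.2
    refine ⟨max C 0 + 1, by positivity, fun F hF => ?_⟩
    refine lt_of_le_of_lt (Fn.gauss_le F r (C := max C 0) fun μ => ?_) (lt_add_one _)
    exact (mul_le_mul_of_nonneg_right (hF μ) (pow_nonneg r.2.1.le _)).trans
      ((hC _).trans (le_max_left _ _))
  · obtain ⟨n, hn1, hn2⟩ := exists_mem_Ico_zpow (hρ.pos μ.degree) hp1
    have hc : ‖((p : ℚ_[p]) ^ (-n))‖ = (p : ℝ) ^ n := by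
      rw [Padic.norm_p_zpow, neg_neg]
    have h := hl ((p : ℚ_[p]) ^ (-n) • Fn.monomial μ) fun ν => by
      rw [map_smul, smul_eq_mul, norm_mul, hc, Fn.coeff_monomial]
      split_ifs with h
      · rw [norm_one, mul_one, h]
        exact hn1
      · rw [norm_zero, mul_zero]
        exact (hρ.pos _).le
    have h2 : l ((p : ℚ_[p]) ^ (-n) • Fn.monomial μ) = (p : ℚ_[p]) ^ (-n) * l (Fn.monomial μ) :=
      ContinuousLinearMap.map_smul (l : Fn p →L[ℚ_[p]] ℚ_[p]) _ _
    rw [h2, norm_mul, hc, ← one_div, le_div_iff₀ hp0] at h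
    calc _ ≤ ‖l (Fn.monomial μ)‖ * (p : ℝ) ^ (n + 1) :=
          mul_le_mul_of_nonneg_left hn2.le (norm_nonneg _)
      _ = (p : ℝ) ^ n * ‖l (Fn.monomial μ)‖ * p := by
          rw [zpow_add_one₀ hp0.ne']
          ring
      _ ≤ 1 := h

theorem ball_mem_nhds {ρ : ℕ → ℝ} (hρ : IsGrowth ρ) :
    (ball (p := p) ρ (fun n => (hρ.pos n).le) : Set (Dist p)) ∈ 𝓝 0 := by
  obtain ⟨S, hS, ε, hε, h⟩ := exists_polar_subset_ball (p := p) hρ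
  exact hasBasis_nhds_zero_polar.mem_iff.2 ⟨(S, ε), ⟨hS, hε⟩, h⟩

theorem exists_ball_subset {U : Set (Dist p)} (hU : U ∈ 𝓝 0) : ∃ (ρ : ℕ → ℝ) (hρ : IsGrowth ρ),
    (ball (p := p) ρ (fun n => (hρ.pos n).le) : Set (Dist p)) ⊆ U := by
  obtain ⟨⟨S, ε⟩, ⟨hS, hε⟩, h⟩ := hasBasis_nhds_zero_polar.mem_iff.1 hU
  obtain ⟨ρ, hρ, h2⟩ := exists_ball_subset_polar hS hε
  exact ⟨ρ, hρ, fun l hl => h (h2 l hl)⟩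

theorem norm_le_of_mem_degGE_of_mul_le {l l' : Poly p →ₗ[ℚ_[p]] ℚ_[p]} {g g' : ℕ → ℝ} {B : ℝ}
    (hB : 0 ≤ B) (hg : ∀ n, 0 ≤ g n) (h : ∀ μ, ‖l (Poly.mon p μ)‖ ≤ g μ.degree)
    (h' : ∀ μ, ‖l' (Poly.mon p μ)‖ ≤ g' μ.degree) {d : ℕ}
    (hgg : ∀ i j, d ≤ i + j → g i * g' j ≤ B) {t : Poly p ⊗[ℚ_[p]] Poly p} (ht : t ∈ degGE p d) :
    ‖LinearMap.mul' ℚ_[p] ℚ_[p] (TensorProduct.map l l' t)‖ ≤ B := by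
  induction ht using Submodule.span_induction with
  | zero => simpa using hB
  | add x y _ _ hx hy =>
    rw [map_add, map_add]
    exact (Padic.nonarchimedean _ _).trans (max_le hx hy)
  | smul c x _ hx =>
    rw [map_zsmul, map_zsmul, zsmul_eq_mul, norm_mul]
    exact (mul_le_of_le_one_left (norm_nonneg _) (Padic.norm_int_le_one c)).trans hx
  | mem x hx =>
    obtain ⟨α, β, hd, rfl⟩ := hx
    rw [TensorProduct.map_tmul, LinearMap.mul'_apply, norm_mul]
    exact (mul_le_mul (h α) (h' β) (norm_nonneg _) (hg _)).trans (hgg _ _ hd)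

/-- The comultiplication of `z^μ` involves only tensors of degrees `i`, `j` with `i + j ≥ |μ|`. The
larger of `2 i` and `2 j` is at least `|μ|`, so `ρ(2 i) ρ(2 j) ≥ ρ(|μ|)` because `ρ` is monotone and
at least `1`. -/
theorem norm_mul_le_of_growth {ρ : ℕ → ℝ} (hρ : IsGrowth ρ) {l l' : Dist p} {K K' : ℝ}
    (hK : 0 ≤ K) (hK' : 0 ≤ K') (h : ∀ μ, ‖l (Fn.monomial μ)‖ * ρ (2 * μ.degree) ≤ K)
    (h' : ∀ μ, ‖l' (Fn.monomial μ)‖ * ρ (2 * μ.degree) ≤ K') (μ : MultiIndex) :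
    ‖(l * l') (Fn.monomial μ)‖ * ρ μ.degree ≤ K * K' := by
  rw [← le_div_iff₀ (hρ.pos _), restrict_mul_mon]
  refine norm_le_of_mem_degGE_of_mul_le (g := fun n => K / ρ (2 * n)) (g' := fun n => K' / ρ (2 * n))
    (div_nonneg (mul_nonneg hK hK') (hρ.pos _).le) (fun n => div_nonneg hK (hρ.pos _).le)
    (fun ν => ?_) (fun ν => ?_) (fun i j hij => ?_) (comul_mon_mem μ)
  · rw [restrict_mon, le_div_iff₀ (hρ.pos _)]
    exact h ν
  · rw [restrict_mon, le_div_iff₀ (hρ.pos _)]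
    exact h' ν
  · rw [div_mul_div_comm]
    refine div_le_div_of_nonneg_left (mul_nonneg hK hK') (hρ.pos _) ?_
    rcases le_total i j with hle | hle
    · exact (hρ.mono (by omega)).trans (le_mul_of_one_le_left (hρ.pos _).le (hρ.one_le _))
    · exact (hρ.mono (by omega)).trans (le_mul_of_one_le_right (hρ.pos _).le (hρ.one_le _))

theorem exists_moment_mul_growth_le {ρ : ℕ → ℝ} (hρ : IsGrowth ρ) (l : Dist p) :
    ∃ K, 1 ≤ K ∧ ∀ μ, ‖l (Fn.monomial μ)‖ * ρ μ.degree ≤ K := by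
  obtain ⟨r, C, hC, h⟩ := exists_moment_bound l
  obtain ⟨C', hC'⟩ := hρ.bound r r.2.1 r.2.2
  refine ⟨max 1 (C * C'), le_max_left _ _, fun μ => le_trans ?_ (le_max_right _ _)⟩
  calc _ ≤ C * (r : ℝ) ^ μ.degree * ρ μ.degree :=
        mul_le_mul_of_nonneg_right (h r le_rfl μ) (hρ.pos _).le
    _ = C * (ρ μ.degree * (r : ℝ) ^ μ.degree) := by ring
    _ ≤ _ := mul_le_mul_of_nonneg_left (hC' _) hC

instance isTopologicalRing : IsTopologicalRing (Dist p) := by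
  refine IsTopologicalRing.of_addGroup_of_nhds_zero ?_ (fun l => ?_) (fun l => ?_)
  · intro U hU
    obtain ⟨ρ, hρ, hρU⟩ := exists_ball_subset hU
    refine mem_map.2 <| mem_of_superset (prod_mem_prod (ball_mem_nhds hρ.comp_two_mul)
      (ball_mem_nhds hρ.comp_two_mul)) fun x hx => hρU fun μ => ?_
    have h := norm_mul_le_of_growth hρ zero_le_one zero_le_one hx.1 hx.2 μ
    rw [mul_one] at h
    exact h
  · intro U hU
    obtain ⟨ρ, hρ, hρU⟩ := exists_ball_subset hU
    -- For a fixed factor `l`, its moments times `ρ(2 n)` are bounded by some `K`; shrinking the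
    -- ball of the other factor by `K` compensates.
    obtain ⟨K, hK1, hK⟩ := exists_moment_mul_growth_le hρ.comp_two_mul l
    have hK0 : 0 < K := one_pos.trans_le hK1
    refine mem_map.2 <| mem_of_superset (ball_mem_nhds (hρ.comp_two_mul.const_mul hK1)) fun x hx => hρU fun μ => ?_
    have h := norm_mul_le_of_growth hρ (K' := K⁻¹) hK0.le (inv_nonneg.2 hK0.le) hK (l' := x)
      (fun ν => by
        have := hx ν
        rw [mul_left_comm] at this
        rwa [← one_div, le_div_iff₀' hK0]) μ
    rwa [mul_inv_cancel₀ hK0.ne'] at h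
  · intro U hU
    obtain ⟨ρ, hρ, hρU⟩ := exists_ball_subset hU
    obtain ⟨K, hK1, hK⟩ := exists_moment_mul_growth_le hρ.comp_two_mul l
    have hK0 : 0 < K := one_pos.trans_le hK1
    refine mem_map.2 <| mem_of_superset (ball_mem_nhds (hρ.comp_two_mul.const_mul hK1)) fun x hx => hρU fun μ => ?_
    have h := norm_mul_le_of_growth hρ (K := K⁻¹) (inv_nonneg.2 hK0.le) hK0.le (l := x)
      (fun ν => by
        have := hx ν
        rw [mul_left_comm] at this
        rwa [← one_div, le_div_iff₀' hK0]) hK μ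
    rwa [inv_mul_cancel₀ hK0.ne'] at h

/-- A multiple of the distributions of level `m` is contained in a given neighbourhood of zero. -/
theorem exists_pow_smul_mem_ball {ρ : ℕ → ℝ} (hρ : IsGrowth ρ) (m : ℕ) : ∃ k : ℕ, ∀ l : Dist p,
    LevelBound m 1 l → (p : ℤ_[p]) ^ k • l ∈ ball (p := p) ρ fun n => (hρ.pos n).le := by
  obtain ⟨C, hC⟩ := hρ.bound _ (levelRadius_pos p (m + 1)) (levelRadius_lt_one p (m + 1))
  have h0 : Tendsto (fun k : ℕ => ‖(p : ℚ_[p])‖ ^ k * ((p : ℝ) ^ 4 * C)) atTop (𝓝 0) := by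
    simpa using (tendsto_pow_atTop_nhds_zero_of_lt_one (norm_nonneg _)
      (Padic.norm_p_lt_one (p := p))).mul_const ((p : ℝ) ^ 4 * C)
  obtain ⟨k, hk⟩ := (h0.eventually (ge_mem_nhds one_pos)).exists
  refine ⟨k, fun l hl μ => ?_⟩
  have h1 : ((p : ℤ_[p]) ^ k • l) (Fn.monomial μ) = (p : ℚ_[p]) ^ k * l (Fn.monomial μ) := by
    rw [intCoe_smul, smul_apply]
    simp
  rw [h1, norm_mul, norm_pow, mul_assoc]
  refine le_trans (mul_le_mul_of_nonneg_left ?_ (by positivity)) hk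
  calc _ ≤ ((p : ℝ) ^ 4 * levelRadius p (m + 1) ^ μ.degree) * ρ μ.degree := by
        refine mul_le_mul_of_nonneg_right ?_ (hρ.pos _).le
        exact (hl μ).trans (by rw [one_mul]; exact levelNorm_le_levelRadius_pow p m μ)
    _ = (p : ℝ) ^ 4 * (ρ μ.degree * levelRadius p (m + 1) ^ μ.degree) := by ring
    _ ≤ _ := mul_le_mul_of_nonneg_left (hC _) (by positivity)

end Dist

end

section

open Filter Topology WideOpen.Dist

variable {p : ℕ} [hp : Fact p.Prime]

/-! ### Derivatives along one-parameter subgroups -/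

section Exponential

variable {𝔸 : Type*} [NormedRing 𝔸] [NormedAlgebra ℚ_[p] 𝔸]

variable (p 𝔸) in
-- At level `0` the factorial of `⌊n / p^0⌋` is `n!`, so its norm is at least `R_0^n` with `R_0 =
-- p⁻¹`; the radius of convergence is therefore at least `p⁻¹`.
theorem radius_expSeries_pos : 0 < (NormedSpace.expSeries ℚ_[p] 𝔸).radius := by
  let r : NNReal := ⟨levelRadius p 0, (levelRadius_pos p 0).le⟩
  have hr : 0 < r := levelRadius_pos p 0
  refine lt_of_lt_of_le (ENNReal.coe_pos.2 hr)
    ((NormedSpace.expSeries ℚ_[p] 𝔸).le_radius_of_bound (max 1 ‖(1 : 𝔸)‖) fun n => ?_)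
  have h1 : ‖NormedSpace.expSeries ℚ_[p] 𝔸 n‖ ≤ (qNorm p 0 n)⁻¹ * max 1 ‖(1 : 𝔸)‖ := by
    rw [NormedSpace.expSeries, qNorm, qFactorial, pow_zero, Nat.div_one, ← norm_inv]
    refine (ContinuousMultilinearMap.opNorm_smul_le _ _).trans ?_
    exact mul_le_mul_of_nonneg_left ContinuousMultilinearMap.norm_mkPiAlgebraFin_le (by positivity)
  have h2 := qNorm_pos p 0 n
  calc _ ≤ (qNorm p 0 n)⁻¹ * max 1 ‖(1 : 𝔸)‖ * qNorm p 0 n :=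
        mul_le_mul h1 (levelRadius_pow_le_qNorm p 0 n) (pow_nonneg hr.le n) (by positivity)
    _ = _ := by field_simp

theorem hasDerivAt_exp_smul_zero [CompleteSpace 𝔸] (X : 𝔸) :
    HasDerivAt (fun t : ℚ_[p] => NormedSpace.exp (t • X)) X 0 := by
  have h1 : HasFDerivAt (NormedSpace.exp : 𝔸 → 𝔸) (1 : 𝔸 →L[ℚ_[p]] 𝔸)
      ((0 : ℚ_[p]) • X) := by
    rw [zero_smul]
    exact hasFDerivAt_exp_zero_of_radius_pos (radius_expSeries_pos p 𝔸)
  have h2 : HasDerivAt (fun t : ℚ_[p] => t • X) ((1 : ℚ_[p]) • X) 0 :=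
    (hasDerivAt_id (0 : ℚ_[p])).smul_const X
  rw [one_smul] at h2
  exact h1.comp_hasDerivAt 0 h2

end Exponential

theorem hasDerivAt_exp_smul_entry (X : Gl2 p) (i j : Fin 2) :
    HasDerivAt (fun t : ℚ_[p] => NormedSpace.exp (t • X) i j) (X i j) 0 := by
  -- The norm on matrices is auxiliary: the derivative of an entry does not refer to it.
  let N : NormedRing (Gl2 p) := Matrix.linftyOpNormedRing
  let A : NormedAlgebra ℚ_[p] (Gl2 p) := Matrix.linftyOpNormedAlgebra
  have hc : @CompleteSpace (Gl2 p) N.toMetricSpace.toPseudoMetricSpace.toUniformSpace :=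
    FiniteDimensional.complete ℚ_[p] (Gl2 p)
  have h := @hasDerivAt_exp_smul_zero p _ (Gl2 p) N A hc X
  exact hasDerivAt_pi.1 (hasDerivAt_pi.1 h i) j


/-- Second-order Taylor estimate. By the ultrametric inequality the remainder is at most its largest
term, and for `|μ| ≥ 2` one has `R^|μ| ≤ R^2 r^(|μ| - 2)`. -/
theorem norm_eval_sub_le (F : Fn p) {r : Fn.Radius} {z : Gl2 p} {R : ℝ} (hR : R ≤ r)
    (hz : ∀ i j, ‖z i j‖ ≤ R) :
    ‖F.eval (1 + z) - Fn.coeff 0 F - tangent p z F‖ ≤ (Fn.gauss r F * ((r : ℝ) ^ 2)⁻¹) * R ^ 2 := by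
  classical
  have hr0 := r.2.1
  have hR0 : 0 ≤ R := (norm_nonneg _).trans (hz 0 0)
  let f : MultiIndex → ℚ_[p] := fun μ => Fn.coeff μ F * μ.prod fun ij n => z ij.1 ij.2 ^ n
  have hprod : ∀ μ : MultiIndex, ‖μ.prod fun ij n => z ij.1 ij.2 ^ n‖ ≤ R ^ μ.degree := by
    intro μ
    rw [Finsupp.prod_fintype _ _ (fun i => pow_zero _), norm_prod, Finsupp.degree_eq_sum,
      ← Finset.prod_pow_eq_pow_sum]
    refine Finset.prod_le_prod (fun _ _ => norm_nonneg _) fun ij _ => ?_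
    rw [norm_pow]
    exact pow_le_pow_left₀ (norm_nonneg _) (hz _ _) _
  have hs : Summable f := by
    refine NonarchimedeanAddGroup.summable_of_tendsto_cofinite_zero ?_
    refine squeeze_zero_norm (fun μ => ?_) (F.tendsto_coeff r.2.1 r.2.2)
    rw [norm_mul]
    exact mul_le_mul_of_nonneg_left ((hprod μ).trans (pow_le_pow_left₀ hR0 hR _))
      (norm_nonneg _)
  have heval : F.eval (1 + z) = ∑' μ, f μ := by
    rw [Fn.eval, add_sub_cancel_left]
  let s₀ : Finset MultiIndex := insert 0 (Finset.univ.image fun ij => Finsupp.single ij 1)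
  have hs₀ : ∑ μ ∈ s₀, f μ = Fn.coeff 0 F + tangent p z F := by
    rw [Finset.sum_insert, Finset.sum_image, tangent_apply]
    · congr 1
      · simp [f]
      · refine Finset.sum_congr rfl fun ij _ => ?_
        have h : (Finsupp.single ij 1).prod (fun ij n => z ij.1 ij.2 ^ n) = z ij.1 ij.2 :=
          (Finsupp.prod_single_index (h := fun (ij : Fin 2 × Fin 2) n => z ij.1 ij.2 ^ n) (pow_zero _)).trans
            (pow_one _)
        exact (congrArg (Fn.coeff _ F * ·) h).trans (mul_comm _ _)
    · intro i _ j _ h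
      exact Finsupp.single_left_injective one_ne_zero h
    · simp
  rw [sub_sub, heval, ← hs₀]
  refine le_of_tendsto (hs.hasSum.sub_const (∑ μ ∈ s₀, f μ)).norm
    ((eventually_ge_atTop s₀).mono fun s hss => ?_)
  rw [← Finset.sum_sdiff hss, add_sub_cancel_right]
  refine IsUltrametricDist.norm_sum_le_of_forall_le_of_nonneg
    (mul_nonneg (mul_nonneg (apply_nonneg _ _) (by positivity)) (by positivity)) fun μ hμ => ?_
  -- The indices of degree at most one are `0` and the unit vectors, all of which lie in `s₀`.
  have hdeg : 2 ≤ μ.degree := by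
    rw [Finset.mem_sdiff] at hμ
    by_contra! h
    refine hμ.2 ?_
    by_cases h0 : μ = 0
    · exact Finset.mem_insert.2 (Or.inl h0)
    obtain ⟨ij, hij⟩ := Finsupp.ne_iff.1 h0
    have hij1 : 1 ≤ μ ij := Nat.one_le_iff_ne_zero.2 hij
    refine Finset.mem_insert_of_mem (Finset.mem_image.2 ⟨ij, Finset.mem_univ _, Finsupp.ext fun k => ?_⟩)
    rw [Finsupp.degree_eq_sum, ← Finset.add_sum_erase _ _ (Finset.mem_univ ij)] at h
    by_cases hk : ij = k
    · subst hk
      rw [Finsupp.single_eq_same]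
      omega
    · rw [Finsupp.single_eq_of_ne (Ne.symm hk)]
      have := Finset.single_le_sum (f := μ) (fun _ _ => Nat.zero_le _)
        (Finset.mem_erase.2 ⟨Ne.symm hk, Finset.mem_univ k⟩)
      omega
  obtain ⟨d, hd⟩ := Nat.exists_eq_add_of_le hdeg
  rw [norm_mul]
  calc _ ≤ ‖Fn.coeff μ F‖ * R ^ μ.degree := mul_le_mul_of_nonneg_left (hprod μ) (norm_nonneg _)
    _ ≤ ‖Fn.coeff μ F‖ * (R ^ 2 * (r : ℝ) ^ d) := by
        rw [hd, pow_add]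
        gcongr
    _ = ‖Fn.coeff μ F‖ * (r : ℝ) ^ μ.degree * ((r : ℝ) ^ 2)⁻¹ * R ^ 2 := by
        rw [hd, pow_add]
        field_simp
    _ ≤ _ := by
        gcongr
        exact Fn.le_gauss F r μ

theorem hasDerivAt_eval_exp (X : Gl2 p) (F : Fn p) :
    HasDerivAt (fun t : ℚ_[p] => F.eval (NormedSpace.exp (t • X))) (tangent p X F) 0 := by
  let r : Fn.Radius := ⟨1 / 2, by norm_num, by norm_num⟩
  let z : ℚ_[p] → Gl2 p := fun t => NormedSpace.exp (t • X) - 1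
  have hz0 : z 0 = 0 := by simp [z, NormedSpace.exp_zero]
  have hz : ∀ i j, HasDerivAt (fun t => z t i j) (X i j) 0 := fun i j =>
    (hasDerivAt_exp_smul_entry X i j).sub_const _
  have heval : ∀ t, F.eval (NormedSpace.exp (t • X)) = F.eval (1 + z t) := fun t => by
    rw [add_sub_cancel]
  have h1 : HasDerivAt (fun t => Fn.coeff 0 F + tangent p (z t) F) (tangent p X F) 0 := by
    simp only [tangent_apply]
    exact (HasDerivAt.fun_sum fun ij _ => (hz ij.1 ij.2).mul_const _).const_add _
  have hb : ∀ i j, (fun t => z t i j) =O[𝓝 0] fun t : ℚ_[p] => t := fun i j => by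
    have h := (hz i j).isBigO_sub
    rw [hz0] at h
    simpa using h
  choose K hK using fun i j => (hb i j).bound
  let K' : ℝ := ∑ i, ∑ j, |K i j|
  have hK' : ∀ i j, K i j ≤ K' := fun i j =>
    (le_abs_self _).trans <| (Finset.single_le_sum (f := fun j => |K i j|)
      (fun _ _ => abs_nonneg _) (Finset.mem_univ j)).trans <|
      Finset.single_le_sum (f := fun i => ∑ j, |K i j|)
        (fun _ _ => Finset.sum_nonneg fun _ _ => abs_nonneg _) (Finset.mem_univ i)
  -- Near `t = 0` the matrix `exp(t X) - 1` stays in the polydisc of radius `r`, where the power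
  -- series converges; default values of `exp` and `eval` elsewhere do not affect the derivative at
  -- `0`.
  have hr : ∀ᶠ t : ℚ_[p] in 𝓝 0, K' * ‖t‖ ≤ r := by
    have h : Tendsto (fun t : ℚ_[p] => K' * ‖t‖) (𝓝 0) (𝓝 0) := by
      simpa using ((continuous_norm (E := ℚ_[p])).tendsto 0).const_mul K'
    exact h.eventually (ge_mem_nhds r.2.1)
  have h2 : HasDerivAt (fun t => F.eval (1 + z t) - Fn.coeff 0 F - tangent p (z t) F) 0 0 := by
    have hO : (fun t => F.eval (1 + z t) - Fn.coeff 0 F - tangent p (z t) F) =O[𝓝 0]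
        fun t : ℚ_[p] => ‖t - 0‖ ^ 2 := by
      refine Asymptotics.IsBigO.of_bound (Fn.gauss r F * ((r : ℝ) ^ 2)⁻¹ * K' ^ 2) ?_
      filter_upwards [hr, eventually_all.2 fun i => eventually_all.2 fun j => hK i j] with t ht htK
      refine (norm_eval_sub_le F ht fun i j => (htK i j).trans
        (mul_le_mul_of_nonneg_right (hK' i j) (norm_nonneg _))).trans_eq ?_
      rw [norm_pow, norm_norm, sub_zero]
      ring
    simpa using (hO.hasFDerivAt (𝕜 := ℚ_[p]) one_lt_two).hasDerivAt
  have h := h1.add h2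
  rw [add_zero] at h
  refine h.congr_of_eventuallyEq (Eventually.of_forall fun t => ?_)
  simp only [heval, Pi.add_apply]
  ring

end

section

open Filter Topology WideOpen.Dist

variable {p : ℕ} [hp : Fact p.Prime]

/-! ### Completions and their direct limits -/

section Lattice

variable {M N : Type*} [AddCommGroup M] [Module ℤ_[p] M] [AddCommGroup N] [Module ℤ_[p] N]
  [TopologicalSpace N] [IsTopologicalAddGroup N]

theorem continuous_latticeTopology (L : Submodule ℤ_[p] M) (f : M →ₗ[ℤ_[p]] N)
    (h : ∀ U ∈ 𝓝 (0 : N), ∃ k : ℕ, ∀ y ∈ L, (p : ℤ_[p]) ^ k • f y ∈ U) :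
    @Continuous _ _ (latticeTopology p L) _ f := by
  let := latticeTopology p L
  refine continuous_def.2 fun U hU x hx => ?_
  have h1 : (f x + ·) ⁻¹' U ∈ 𝓝 (0 : N) := by
    refine (continuous_const_add (f x)).continuousAt.preimage_mem_nhds ?_
    rw [add_zero]
    exact hU.mem_nhds hx
  obtain ⟨k, hk⟩ := h _ h1
  refine ⟨k, fun y hy => ?_⟩
  rw [Set.mem_preimage, map_add, map_smul]
  exact hk y hy

end Lattice

namespace PadicCompletion

variable {A : Type*} [Ring A] [Algebra ℤ_[p] A]

/-- For lifts `u_k` of the components, `u_(k+1) - u_k = w_k p^k`. The series `∑ w_(n+i) p^i`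
converges in the completion and serves as `y`, because `p^n y` telescopes to the limit of the `u_k`
minus `u_n`. No torsion hypothesis is needed. -/
theorem exists_eq_of_add_pow_smul (x : PadicCompletion p A) (n : ℕ) :
    ∃ u y, x = of p A u + (p : ℤ_[p]) ^ n • y := by
  choose u hu using fun k => Ideal.Quotient.mk_surjective (x.1 k)
  have hc : ∀ k, Ideal.Quotient.mk (powIdeal p A k) (u (k + 1)) = x.1 k := fun k => by
    have h := x.2 k
    rw [← hu (k + 1)] at h
    exact h
  have hw : ∀ k, ∃ w, w * (p : A) ^ k = u (k + 1) - u k := fun k =>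
    (mem_powIdeal p).1 ((Ideal.Quotient.mk_eq_mk_iff_sub_mem _ _).1 ((hc k).trans (hu k).symm))
  choose w hw using hw
  have hlevel : ∀ k j, Ideal.Quotient.mk (powIdeal p A k) (u (k + j)) = x.1 k := by
    intro k j
    induction j with
    | zero => exact hu k
    | succ j ih =>
      rw [← ih, Ideal.Quotient.mk_eq_mk_iff_sub_mem]
      refine (mem_powIdeal p).2 ⟨w (k + j) * (p : A) ^ j, ?_⟩
      rw [mul_assoc, ← pow_add, add_comm j k, hw]
      rfl
  let y : PadicCompletion p A :=
    ⟨fun j => Ideal.Quotient.mk (powIdeal p A j) (∑ i ∈ Finset.range j, w (n + i) * (p : A) ^ i),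
      fun j => by
        change Ideal.Quotient.mk (powIdeal p A j)
          (∑ i ∈ Finset.range (j + 1), w (n + i) * (p : A) ^ i) = Ideal.Quotient.mk (powIdeal p A j) _
        rw [Ideal.Quotient.mk_eq_mk_iff_sub_mem, Finset.sum_range_succ, add_sub_cancel_left]
        exact (mem_powIdeal p).2 ⟨_, rfl⟩⟩
  refine ⟨u n, y, Subtype.ext (funext fun j => ?_)⟩
  have h1 : (u n + (p : ℤ_[p]) ^ n • ∑ i ∈ Finset.range j, w (n + i) * (p : A) ^ i) = u (n + j) := by
    have h2 : ∀ i, (p : ℤ_[p]) ^ n • (w (n + i) * (p : A) ^ i) = u (n + (i + 1)) - u (n + i) := by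
      intro i
      rw [← add_assoc, ← hw, pow_add, ← mul_assoc, Algebra.smul_def, map_pow, map_natCast,
        ← mul_assoc, ((Nat.cast_commute p (w (n + i))).pow_left n).eq]
    rw [Finset.smul_sum, Finset.sum_congr rfl fun i _ => h2 i,
      Finset.sum_range_sub fun i => u (n + i), add_zero, add_sub_cancel]
  change x.1 j = Ideal.Quotient.mk (powIdeal p A j)
    (u n + (p : ℤ_[p]) ^ n • ∑ i ∈ Finset.range j, w (n + i) * (p : A) ^ i)
  rw [h1, add_comm, hlevel]

theorem denseRange_of : DenseRange (of p A) := by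
  refine dense_iff_inter_open.2 fun U hU ⟨x, hx⟩ => ?_
  obtain ⟨k, hk⟩ := hU x hx
  obtain ⟨u, y, h⟩ := exists_eq_of_add_pow_smul x k
  refine ⟨of p A u, ?_, u, rfl⟩
  have h2 := hk (-y) trivial
  rwa [h, smul_neg, add_neg_cancel_right] at h2

theorem map_of {B : Type*} [Ring B] [Algebra ℤ_[p] B] (φ : A →ₐ[ℤ_[p]] B) (u : A) :
    map p φ (of p A u) = of p B (φ u) := rfl

theorem algHom_ext_of_continuous {B : Type*} [Ring B] [Algebra ℤ_[p] B] [TopologicalSpace B]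
    [T2Space B] {φ ψ : PadicCompletion p A →ₐ[ℤ_[p]] B} (hφ : Continuous φ) (hψ : Continuous ψ)
    (h : ∀ u, φ (of p A u) = ψ (of p A u)) : φ = ψ :=
  DFunLike.coe_injective (denseRange_of.equalizer hφ hψ (funext h))

end PadicCompletion

namespace CompletionQ

variable {A : Type*} [Ring A] [Algebra ℤ_[p] A]

instance : IsScalarTower ℤ_[p] ℚ_[p] (CompletionQ p A) :=
  inferInstanceAs (IsScalarTower ℤ_[p] ℚ_[p] (ℚ_[p] ⊗[ℤ_[p]] PadicCompletion p A))

theorem _root_.Padic.exists_pow_mul_norm_le_one (c : ℚ_[p]) : ∃ k : ℕ, ‖(p : ℚ_[p]) ^ k * c‖ ≤ 1 := by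
  have h0 : Tendsto (fun k : ℕ => ‖(p : ℚ_[p])‖ ^ k * ‖c‖) atTop (𝓝 0) := by
    simpa using (tendsto_pow_atTop_nhds_zero_of_lt_one (norm_nonneg _)
      (Padic.norm_p_lt_one (p := p))).mul_const ‖c‖
  obtain ⟨k, hk⟩ := (h0.eventually (ge_mem_nhds one_pos)).exists
  exact ⟨k, by rwa [norm_mul, norm_pow]⟩

theorem exists_pow_smul_eq_of (z : CompletionQ p A) : ∃ (k : ℕ) (x : PadicCompletion p A),
    (p : ℤ_[p]) ^ k • z = of p A x := by
  refine TensorProduct.induction_on z ⟨0, 0, ?_⟩ (fun c x => ?_) fun y z hy hz => ?_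
  · rw [map_zero]
    exact smul_zero (A := CompletionQ p A) _
  · obtain ⟨k, hk⟩ := Padic.exists_pow_mul_norm_le_one c
    let d : ℤ_[p] := ⟨(p : ℚ_[p]) ^ k * c, hk⟩
    refine ⟨k, d • x, ?_⟩
    change ((p : ℤ_[p]) ^ k • c) ⊗ₜ[ℤ_[p]] x = (1 : ℚ_[p]) ⊗ₜ[ℤ_[p]] (d • x)
    rw [TensorProduct.tmul_smul, TensorProduct.smul_tmul', Algebra.smul_def, Algebra.smul_def, mul_one]
    congr 1
  · obtain ⟨k, x, hx⟩ := hy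
    obtain ⟨l, y', hy'⟩ := hz
    refine ⟨k + l, (p : ℤ_[p]) ^ l • x + (p : ℤ_[p]) ^ k • y', ?_⟩
    have key : ∀ y z : CompletionQ p A, (p : ℤ_[p]) ^ (k + l) • (y + z) =
        (p : ℤ_[p]) ^ l • (p : ℤ_[p]) ^ k • y + (p : ℤ_[p]) ^ k • (p : ℤ_[p]) ^ l • z := by
      intro y z
      rw [smul_smul, smul_smul, ← pow_add, ← pow_add, add_comm l k, smul_add]
    rw [map_add, map_smul, map_smul, ← hx, ← hy']
    exact key y z

variable (B : Type*) [Ring B] [Algebra ℚ_[p] B] [Algebra ℤ_[p] B] [IsScalarTower ℤ_[p] ℚ_[p] B]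

variable {B} in
/-- The extension of a homomorphism from the completion to the completion with `p` inverted. -/
def lift (φ : PadicCompletion p A →ₐ[ℤ_[p]] B) : CompletionQ p A →ₐ[ℚ_[p]] B :=
  (Algebra.TensorProduct.lift (Algebra.ofId ℚ_[p] B) φ fun c x => Algebra.commutes c (φ x) :
    ℚ_[p] ⊗[ℤ_[p]] PadicCompletion p A →ₐ[ℚ_[p]] B)

variable {B} in
theorem lift_of (φ : PadicCompletion p A →ₐ[ℤ_[p]] B) (x : PadicCompletion p A) :
    lift φ (of p A x) = φ x := by
  change Algebra.ofId ℚ_[p] B 1 * φ x = φ x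
  rw [map_one, one_mul]

theorem map_of {A' : Type*} [Ring A'] [Algebra ℤ_[p] A'] (φ : A →ₐ[ℤ_[p]] A')
    (x : PadicCompletion p A) : map p φ (of p A x) = of p A' (PadicCompletion.map p φ x) := by
  change (Algebra.TensorProduct.map (AlgHom.id ℚ_[p] ℚ_[p]) (PadicCompletion.map p φ))
    ((1 : ℚ_[p]) ⊗ₜ[ℤ_[p]] x) = (1 : ℚ_[p]) ⊗ₜ[ℤ_[p]] PadicCompletion.map p φ x
  rw [Algebra.TensorProduct.map_tmul, map_one]

variable {B} in
theorem algHom_ext {φ ψ : CompletionQ p A →ₐ[ℚ_[p]] B}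
    (h : ∀ x, φ (of p A x) = ψ (of p A x)) : φ = ψ :=
  Algebra.TensorProduct.ext (S := ℚ_[p]) (Subsingleton.elim _ _) (AlgHom.ext h)

end CompletionQ

namespace CompletionLimit

variable {R : Type*} [Ring R] [Algebra ℤ_[p] R] (S : ℕ →o Subalgebra ℤ_[p] R)
variable {B : Type*} [Ring B] [Algebra ℚ_[p] B]

instance : IsScalarTower ℤ_[p] ℚ_[p] (CompletionLimit S) := IsScalarTower.of_algebraMap_eq' rfl

theorem exists_of (z : CompletionLimit S) : ∃ m x, of S m x = z :=
  DirectLimit.induction (f := transition S) (C := fun z : CompletionLimit S => ∃ m x, of S m x = z)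
    (fun m x => ⟨m, x, rfl⟩) z

/-- The homomorphism from the direct limit induced by a compatible family of homomorphisms. -/
def lift (g : ∀ m, CompletionQ p (S m) →ₐ[ℚ_[p]] B)
    (hg : ∀ m n h x, g n (transition S m n h x) = g m x) : CompletionLimit S →ₐ[ℚ_[p]] B :=
  AlgHom.ofLinearMap
    { toFun := DirectLimit.lift (transition S) (fun m => g m) fun m n h x => (hg m n h x).symm
      map_add' := DirectLimit.lift_add (f := transition S) g fun m n h x => (hg m n h x).symm
      map_smul' := DirectLimit.lift_smul (f := transition S) g fun m n h x => (hg m n h x).symm }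
    (DirectLimit.lift_one (f := transition S) g fun m n h x => (hg m n h x).symm)
    (DirectLimit.lift_mul (f := transition S) g fun m n h x => (hg m n h x).symm)

theorem exists_pow_smul_eq_of (z : CompletionLimit S) :
    ∃ (k m : ℕ) (x : PadicCompletion p (S m)),
      (p : ℤ_[p]) ^ k • z = of S m (CompletionQ.of p (S m) x) := by
  obtain ⟨m, y, rfl⟩ := exists_of S z
  obtain ⟨k, x, hx⟩ := CompletionQ.exists_pow_smul_eq_of y
  refine ⟨k, m, x, ?_⟩
  rw [← hx, algebra_compatible_smul ℚ_[p], algebra_compatible_smul ℚ_[p] _ y, map_smul]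

end CompletionLimit

end

section

open Filter Topology WideOpen.Dist

variable {p : ℕ} [hp : Fact p.Prime]

/-! ### The isomorphism with the distribution algebra -/

/-- Decay at rate `r` beats a weight of rate `R > r` once the degree is large, and there are only
finitely many indices of bounded degree. -/
theorem finite_setOf_lt_of_radius {a : MultiIndex → ℝ} {w : MultiIndex → ℝ} {C c r R : ℝ}
    (h0 : 0 ≤ r) (hR0 : 0 < R) (hr : r < R) (hc : 0 < c) (ha : ∀ μ, a μ ≤ C * r ^ μ.degree)
    (hw : ∀ μ, c * R ^ μ.degree ≤ w μ) : {μ | w μ < a μ}.Finite := by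
  have h1 : Tendsto (fun d : ℕ => C * (r / R) ^ d) atTop (𝓝 0) := by
    simpa using (tendsto_pow_atTop_nhds_zero_of_lt_one (div_nonneg h0 hR0.le)
      ((div_lt_one hR0).2 hr)).const_mul C
  obtain ⟨D, hD⟩ := eventually_atTop.1 (h1.eventually (ge_mem_nhds hc))
  refine (Finsupp.finite_of_degree_le D).subset fun μ hμ => ?_
  by_contra hd
  have hd : D < μ.degree := not_le.1 hd
  refine absurd (lt_of_lt_of_le hμ ((ha μ).trans (le_trans ?_ (hw μ)))) (lt_irrefl _)
  have h2 := hD _ hd.le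
  rw [div_pow, mul_div_assoc', div_le_iff₀ (pow_pos hR0 _)] at h2
  exact h2

theorem restrict_pow_smul_apply (k : ℕ) (l : Dist p) (P : Poly p) :
    (restrict ((p : ℤ_[p]) ^ k • l)).ofConv P = (p : ℚ_[p]) ^ k * (restrict l).ofConv P := by
  rw [intCoe_smul, restrict_smul_apply]
  simp

theorem exists_pow_smul_completionHom_eq {m k : ℕ} {l : Dist p} (φ : Poly p →ₗ[ℚ_[p]] ℚ_[p])
    (h : ∀ P, (restrict l).ofConv P = φ (gaussMap p P))
    (hφ : ∀ μ, ‖φ (Poly.mon p μ)‖ ≤ ‖(p : ℚ_[p])‖ ^ k * levelNorm p m μ)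
    (hfin : ∀ n : ℕ, {μ | ‖(p : ℚ_[p])‖ ^ n * levelNorm p m μ < ‖φ (Poly.mon p μ)‖}.Finite) :
    ∃ x, (p : ℤ_[p]) ^ k • completionHom p m x = l := by
  have hp0 : (p : ℚ_[p]) ≠ 0 := Nat.cast_ne_zero.2 hp.out.ne_zero
  have hpk : 0 < ‖(p : ℚ_[p])‖ ^ k := pow_pos (norm_pos_iff.2 hp0) k
  have hnorm : ∀ μ, ‖(((p : ℚ_[p]) ^ k)⁻¹ • φ) (Poly.mon p μ)‖ =
      (‖(p : ℚ_[p])‖ ^ k)⁻¹ * ‖φ (Poly.mon p μ)‖ := fun μ => by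
    rw [LinearMap.smul_apply, norm_smul, norm_inv, norm_pow]
  obtain ⟨x, hx⟩ := exists_completionHom_eq (m := m) (l := ((p : ℚ_[p]) ^ k)⁻¹ • l)
    (((p : ℚ_[p]) ^ k)⁻¹ • φ) (fun P => by
      rw [restrict_smul_apply, h]
      rfl) (fun μ => by rw [hnorm, inv_mul_le_iff₀ hpk]; exact hφ μ) (fun n => by
      refine (hfin (k + n)).subset fun μ hμ => ?_
      have hμ : ‖(p : ℚ_[p])‖ ^ n * levelNorm p m μ <
        ‖(((p : ℚ_[p]) ^ k)⁻¹ • φ) (Poly.mon p μ)‖ := hμ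
      rw [hnorm, lt_inv_mul_iff₀ hpk, ← mul_assoc, ← pow_add] at hμ
      exact hμ)
  refine ⟨x, ?_⟩
  rw [hx, intCoe_smul, smul_smul]
  simp [hp0]

theorem finite_levelNorm_lt {m : ℕ} {φ : Poly p →ₗ[ℚ_[p]] ℚ_[p]} {C r : ℝ} (h0 : 0 ≤ r)
    (hr : r < levelRadius p m) (h : ∀ μ, ‖φ (Poly.mon p μ)‖ ≤ C * r ^ μ.degree) (n : ℕ) :
    {μ | ‖(p : ℚ_[p])‖ ^ n * levelNorm p m μ < ‖φ (Poly.mon p μ)‖}.Finite :=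
  finite_setOf_lt_of_radius h0 (levelRadius_pos p m) hr
    (pow_pos (norm_pos_iff.2 (Nat.cast_ne_zero.2 hp.out.ne_zero)) n) h fun μ =>
      mul_le_mul_of_nonneg_left (levelRadius_pow_le_levelNorm p m μ) (by positivity)

/-- The coordinates of a distribution with respect to the Gauss decomposition. -/
theorem exists_coordinates (l : Dist p) : ∃ (φ : Poly p →ₗ[ℚ_[p]] ℚ_[p]) (C r : ℝ), 0 ≤ C ∧ 0 < r ∧
    r < 1 ∧ (∀ μ, ‖φ (Poly.mon p μ)‖ ≤ C * r ^ μ.degree) ∧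
    ∀ P, (restrict l).ofConv P = φ (gaussMap p P) := by
  obtain ⟨r, C, hC, h⟩ := exists_moment_bound l
  obtain ⟨φ, h1, h2⟩ := exists_comp_gaussMap_eq (restrict l).ofConv hC r.2.1.le r.2.2 fun μ => by
    rw [restrict_mon]
    exact h r le_rfl μ
  exact ⟨φ, C, r, hC, r.2.1, r.2.2, h1, fun P => (h2 P).symm⟩

theorem exists_pow_smul_eq_completionHom (l : Dist p) :
    ∃ (k m : ℕ) (x : PadicCompletion p (level p m)), (p : ℤ_[p]) ^ k • l = completionHom p m x := by
  obtain ⟨φ, C, r, hC, h0, h1, hb, h⟩ := exists_coordinates l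
  -- The strict inequality `r < R_m` makes the Gauss coordinates tend to zero relative to the weight
  -- of level `m`, as membership in the completion requires.
  obtain ⟨m, hm⟩ := exists_lt_levelRadius (p := p) h1
  have ht : Tendsto (fun k : ℕ => ‖(p : ℚ_[p])‖ ^ k * C) atTop (𝓝 0) := by
    simpa using (tendsto_pow_atTop_nhds_zero_of_lt_one (norm_nonneg _)
      (Padic.norm_p_lt_one (p := p))).mul_const C
  obtain ⟨k, hk⟩ := (ht.eventually (ge_mem_nhds one_pos)).exists
  have hb' : ∀ μ, ‖((p : ℚ_[p]) ^ k • φ) (Poly.mon p μ)‖ ≤ 1 * r ^ μ.degree := fun μ => by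
    rw [LinearMap.smul_apply, norm_smul, norm_pow]
    calc _ ≤ ‖(p : ℚ_[p])‖ ^ k * (C * r ^ μ.degree) :=
          mul_le_mul_of_nonneg_left (hb μ) (by positivity)
      _ = ‖(p : ℚ_[p])‖ ^ k * C * r ^ μ.degree := by ring
      _ ≤ _ := mul_le_mul_of_nonneg_right hk (by positivity)
  obtain ⟨x, hx⟩ := exists_completionHom_eq (m := m) (l := (p : ℤ_[p]) ^ k • l)
    ((p : ℚ_[p]) ^ k • φ) (fun P => by
      rw [restrict_pow_smul_apply, h]
      rfl) (fun μ => (hb' μ).trans (by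
        rw [one_mul]
        exact (pow_le_pow_left₀ h0.le hm.le _).trans (levelRadius_pow_le_levelNorm p m μ)))
    (finite_levelNorm_lt h0.le hm hb')
  exact ⟨k, m, x, hx.symm⟩

/-- Every `ℤ_p`-submodule of the distribution algebra which contains a multiple of the image of the
completion of every level is a neighbourhood of zero. -/
theorem exists_ball_le {W : Submodule ℤ_[p] (Dist p)} {k : ℕ → ℕ}
    (hW : ∀ m x, (p : ℤ_[p]) ^ k m • completionHom p m x ∈ W) :
    ∃ (ρ : ℕ → ℝ) (hρ : IsGrowth ρ), ball (p := p) ρ (fun n => (hρ.pos n).le) ≤ W := by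
  have hp1 : (1 : ℝ) < p := Nat.one_lt_cast.2 hp.out.one_lt
  have hM : ∀ m, 1 ≤ (p : ℝ) ^ k m := fun m => one_le_pow₀ hp1.le
  have h0 := levelRadius_pos p
  have hg : IsGrowth (infGrowth (fun m => (p : ℝ) ^ k m) (levelRadius p)) :=
    isGrowth_infGrowth hM h0 (levelRadius_lt_one p) fun s hs =>
      (exists_lt_levelRadius (p := p) hs).imp fun _ => le_of_lt
  refine ⟨_, hg.const_mul hp1.le, fun l hl => ?_⟩
  -- The factor `p > 1` puts `ρ` strictly above the infimum, so that for each degree some single `m`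
  -- realises it up to this factor, whether or not the infimum is attained.
  set ρ : ℕ → ℝ := fun n => p * infGrowth (fun m => (p : ℝ) ^ k m) (levelRadius p) n with hρdef
  have hρ : IsGrowth ρ := hg.const_mul hp1.le
  obtain ⟨φ, C, r, hC, hr0, hr1, hb, h⟩ := exists_coordinates l
  -- The bound passes from the moments to the Gauss coordinates because the coordinate change is
  -- integral and only involves higher degrees, where `1 / ρ` is not larger. The descending
  -- induction can start since `φ` decays faster than `1 / ρ`.
  have hφρ : ∀ μ, ‖φ (Poly.mon p μ)‖ ≤ 1 * (ρ μ.degree)⁻¹ := by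
    refine norm_le_of_norm_gaussMap_le (fun μ => ?_) (fun μ ν hμν => ?_) ?_ fun μ => ?_
    · have := hρ.pos μ.degree
      positivity
    · have := hρ.pos ν.degree
      refine (mul_le_of_le_one_left (by positivity) (norm_coeff_gaussMap_le_one μ ν)).trans ?_
      rw [one_mul, one_mul]
      exact inv_anti₀ (hρ.pos _) (hρ.mono hμν.le)
    · obtain ⟨R, hrR, hR1⟩ := exists_between hr1
      have hR0 := hr0.trans hrR
      obtain ⟨C', hC'⟩ := hρ.bound R hR0 hR1
      have hC'0 : 0 < C' := (mul_pos (hρ.pos 0) (pow_pos hR0 0)).trans_le (hC' 0)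
      refine finite_setOf_lt_of_radius hr0.le hR0 hrR (inv_pos.2 hC'0) hb fun μ => ?_
      rw [one_mul, inv_mul_le_iff₀ hC'0, ← div_eq_mul_inv, le_div_iff₀ (hρ.pos _), mul_comm]
      exact hC' _
    · rw [← h, restrict_mon, one_mul, ← one_div, le_div_iff₀ (hρ.pos _)]
      exact hl μ
  have hφm : ∀ μ, ∃ m, ‖φ (Poly.mon p μ)‖ ≤ ‖(p : ℚ_[p])‖ ^ k m * levelNorm p m μ := by
    intro μ
    have h2 : infGrowth (fun m => (p : ℝ) ^ k m) (levelRadius p) μ.degree < ρ μ.degree :=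
      lt_mul_of_one_lt_left (hg.pos _) hp1
    obtain ⟨m, hm⟩ := exists_lt_of_ciInf_lt h2
    refine ⟨m, (hφρ μ).trans ?_⟩
    have h3 : 0 < (p : ℝ) ^ k m * (levelRadius p m ^ μ.degree)⁻¹ :=
      mul_pos (one_pos.trans_le (hM m)) (inv_pos.2 (pow_pos (h0 m) _))
    rw [one_mul, Padic.norm_p, inv_pow]
    calc _ ≤ ((p : ℝ) ^ k m * (levelRadius p m ^ μ.degree)⁻¹)⁻¹ := inv_anti₀ h3 hm.le
      _ = ((p : ℝ) ^ k m)⁻¹ * levelRadius p m ^ μ.degree := by rw [mul_inv, inv_inv]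
      _ ≤ _ := mul_le_mul_of_nonneg_left (levelRadius_pow_le_levelNorm p m μ) (by positivity)
  choose m hm using hφm
  -- The level `m μ` varies with `μ`, and `W` need not be closed, so infinitely many terms cannot be
  -- summed one by one. The fixed level `N` takes care of all terms outside a finite set at once.
  obtain ⟨N, hN⟩ := exists_lt_levelRadius (p := p) hr1
  have hs := finite_levelNorm_lt hr0.le hN hb (k N)
  let term : MultiIndex → Dist p := fun μ => φ (Poly.mon p μ) • theta p (Env.pbw (pbwExp μ))
  have hterm : ∀ μ P, (restrict (term μ)).ofConv P =
      (φ (Poly.mon p μ) • Poly.coeff μ) (gaussMap p P) := fun μ P => by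
    rw [restrict_smul_apply, isGaussCoeff_theta_pbw, pbwIndex_pbwExp]
    rfl
  have hcoord : ∀ μ ν, (φ (Poly.mon p μ) • Poly.coeff μ) (Poly.mon p ν) =
      if ν = μ then φ (Poly.mon p μ) else 0 := fun μ ν => by
    rw [LinearMap.smul_apply, Poly.coeff_mon]
    simp [eq_comm]
  -- A single term has only one nonzero Gauss coordinate, so the decay condition is trivial and the
  -- bound at level `m μ` suffices.
  have htermW : ∀ μ, term μ ∈ W := by
    intro μ
    have hpos := levelNorm_pos p (m μ)
    obtain ⟨x, hx⟩ := exists_pow_smul_completionHom_eq (m := m μ) (k := k (m μ)) _ (hterm μ)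
      (fun ν => by
        rw [hcoord]
        split_ifs with hν
        · rw [hν]
          exact hm μ
        · rw [norm_zero]
          have := hpos ν
          positivity)
      (fun n => (Set.finite_singleton μ).subset fun ν hν => by
        by_contra hne
        have hne : ν ≠ μ := hne
        have hν : _ < ‖(φ (Poly.mon p μ) • Poly.coeff μ) (Poly.mon p ν)‖ := hν
        rw [hcoord, if_neg hne, norm_zero] at hν
        have := hpos ν
        exact absurd hν (not_lt.2 (by positivity)))
    rw [← hx]
    exact hW _ _
  have hsum : ∀ P, (restrict (∑ μ ∈ hs.toFinset, term μ)).ofConv P =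
      ∑ μ ∈ hs.toFinset, (restrict (term μ)).ofConv P := fun P =>
    map_sum (evalAt (Poly.toFn p P)) _ _
  have hrest : l - ∑ μ ∈ hs.toFinset, term μ ∈ W := by
    let ψ : Poly p →ₗ[ℚ_[p]] ℚ_[p] :=
      φ - ∑ μ ∈ hs.toFinset, φ (Poly.mon p μ) • Poly.coeff μ
    have hc : ∀ ν, ψ (Poly.mon p ν) =
        if ν ∈ hs.toFinset then 0 else φ (Poly.mon p ν) := fun ν => by
      rw [LinearMap.sub_apply, LinearMap.sum_apply, Finset.sum_congr rfl fun μ _ => hcoord μ ν,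
        Finset.sum_ite_eq]
      split_ifs
      · exact sub_self _
      · exact sub_zero _
    obtain ⟨x, hx⟩ := exists_pow_smul_completionHom_eq (m := N) (k := k N)
      (l := l - ∑ μ ∈ hs.toFinset, term μ)
      ψ (fun P => by
        rw [restrict_sub_apply, hsum, h, LinearMap.sub_apply, LinearMap.sum_apply]
        simp only [hterm]) (fun ν => by
        rw [hc]
        have := levelNorm_pos p N ν
        split_ifs with hν
        · rw [norm_zero]
          positivity
        · rwa [Set.Finite.mem_toFinset, Set.mem_ofPred_eq, not_lt] at hν)
      (finite_levelNorm_lt hr0.le hN (C := C) fun ν => by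
        rw [hc]
        split_ifs
        · rw [norm_zero]
          positivity
        · exact hb ν)
    rw [← hx]
    exact hW _ _
  have h4 := W.add_mem hrest (W.sum_mem fun μ (_ : μ ∈ hs.toFinset) => htermW μ)
  rwa [sub_add_cancel] at h4

theorem continuous_of_levelBound {A : Type*} [Ring A] [Algebra ℤ_[p] A] {m : ℕ}
    {φ : PadicCompletion p A →ₐ[ℤ_[p]] Dist p} (h : ∀ x, LevelBound m 1 (φ x)) : Continuous φ := by
  refine continuous_latticeTopology ⊤ φ.toLinearMap fun U hU => ?_
  obtain ⟨ρ, hρ, hρU⟩ := exists_ball_subset hU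
  obtain ⟨k, hk⟩ := exists_pow_smul_mem_ball (p := p) hρ m
  exact ⟨k, fun y _ => hρU (hk _ (h y))⟩

variable (p) in
theorem continuous_completionHom (m : ℕ) : Continuous (completionHom p m) :=
  continuous_of_levelBound levelBound_completionHom

/-- Both sides are continuous in `x` and agree on the dense image of the uncompleted algebra. -/
theorem completionHom_map {m n : ℕ} (h : m ≤ n) (x : PadicCompletion p (level p m)) :
    completionHom p n (PadicCompletion.map p (Subalgebra.inclusion ((level p).monotone h)) x) =
      completionHom p m x := by
  have h1 : (completionHom p n).comp
      (PadicCompletion.map p (Subalgebra.inclusion ((level p).monotone h))) = completionHom p m := by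
    refine PadicCompletion.algHom_ext_of_continuous
      (continuous_of_levelBound (m := n) fun y => ?_) (continuous_completionHom p m) fun u => ?_
    · rw [AlgHom.comp_apply]
      exact levelBound_completionHom _
    · rw [AlgHom.comp_apply, PadicCompletion.map_of, completionHom_of, completionHom_of,
        Subalgebra.coe_inclusion]
  exact DFunLike.congr_fun h1 x

variable (p) in
/-- The homomorphism from the direct limit of the completions to the distribution algebra. -/
def limitHom : CompletionLimit (level p) →ₐ[ℚ_[p]] Dist p :=
  CompletionLimit.lift (level p) (fun m => CompletionQ.lift (completionHom p m)) fun m n h x =>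
    DFunLike.congr_fun (CompletionQ.algHom_ext
      (φ := (CompletionQ.lift (completionHom p n)).comp (transition (level p) m n h)) fun y => by
        rw [CompletionQ.lift_of, ← completionHom_map h]
        change CompletionQ.lift (completionHom p n) (CompletionQ.map p _ (CompletionQ.of p _ y)) = _
        rw [CompletionQ.map_of, CompletionQ.lift_of]) x

theorem limitHom_of (m : ℕ) (x : PadicCompletion p (level p m)) :
    limitHom p (CompletionLimit.of (level p) m (CompletionQ.of p (level p m) x)) =
      completionHom p m x := CompletionQ.lift_of _ x

theorem intPow_smul_eq (B : Type*) [AddCommGroup B] [Module ℚ_[p] B] [Module ℤ_[p] B]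
    [IsScalarTower ℤ_[p] ℚ_[p] B] (k : ℕ) (b : B) : (p : ℤ_[p]) ^ k • b = (p : ℚ_[p]) ^ k • b := by
  rw [algebra_compatible_smul ℚ_[p], map_pow, map_natCast]

theorem pow_ne_zero_padic (k : ℕ) : (p : ℚ_[p]) ^ k ≠ 0 :=
  pow_ne_zero k (Nat.cast_ne_zero.2 hp.out.ne_zero)

theorem limitHom_bijective : Function.Bijective (limitHom p) := by
  constructor
  · refine (injective_iff_map_eq_zero _).2 fun z hz => ?_
    obtain ⟨k, m, x, hx⟩ := CompletionLimit.exists_pow_smul_eq_of (level p) z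
    rw [intPow_smul_eq] at hx
    have h1 := limitHom_of m x
    rw [← hx, map_smul, hz, smul_zero] at h1
    rw [(injective_iff_map_eq_zero _).1 (completionHom_injective m) x h1.symm, map_zero, map_zero]
      at hx
    exact (smul_eq_zero.1 hx).resolve_left (pow_ne_zero_padic k)
  · intro l
    obtain ⟨k, m, x, hx⟩ := exists_pow_smul_eq_completionHom l
    refine ⟨((p : ℚ_[p]) ^ k)⁻¹ • CompletionLimit.of (level p) m (CompletionQ.of p _ x), ?_⟩
    rw [map_smul, limitHom_of, ← hx, intPow_smul_eq, inv_smul_smul₀ (pow_ne_zero_padic k)]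

variable (p) in
/-- The direct limit of the completions is isomorphic to the distribution algebra. -/
def limitEquiv : CompletionLimit (level p) ≃ₐ[ℚ_[p]] Dist p :=
  AlgEquiv.ofBijective (limitHom p) limitHom_bijective

theorem limitEquiv_of (m : ℕ) (x : PadicCompletion p (level p m)) :
    limitEquiv p (CompletionLimit.of (level p) m (CompletionQ.of p (level p m) x)) =
      completionHom p m x := limitHom_of m x

/-- The preimage of a ball is a `ℤ_p`-submodule that contains a multiple of the lattice at every
level, hence is open for the locally convex limit topology. -/
theorem continuous_limitEquiv : Continuous (limitEquiv p) := by
  refine continuous_def.2 fun U hU z hz => ?_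
  have h1 : (limitEquiv p z + ·) ⁻¹' U ∈ 𝓝 (0 : Dist p) := by
    refine (continuous_const_add (limitEquiv p z)).continuousAt.preimage_mem_nhds ?_
    rw [add_zero]
    exact hU.mem_nhds hz
  obtain ⟨ρ, hρ, hρU⟩ := exists_ball_subset h1
  let V : Submodule ℤ_[p] (CompletionLimit (level p)) :=
    (ball (p := p) ρ fun n => (hρ.pos n).le).comap
      ((limitEquiv p).toLinearMap.restrictScalars ℤ_[p])
  have hV : ∀ v, v ∈ V ↔ limitEquiv p v ∈ ball (p := p) ρ fun n => (hρ.pos n).le :=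
    fun _ => Iff.rfl
  refine ⟨V, fun m x hx => ?_, fun v hv => ?_⟩
  · obtain ⟨k, hk⟩ := exists_pow_smul_mem_ball (p := p) hρ m
    refine ⟨k, ?_⟩
    rintro _ ⟨y, rfl⟩
    rw [Set.mem_preimage, map_add, intPow_smul_eq, map_smul, AlgHom.toLinearMap_apply]
    refine V.add_mem hx ((hV _).2 ?_)
    rw [map_smul, limitEquiv_of, ← intPow_smul_eq]
    exact hk _ (levelBound_completionHom y)
  · rw [Set.mem_preimage, map_add]
    exact hρU ((hV v).1 hv)

/-- An open lattice of the limit contains `p^(k_m)` times the completion of each level `m`; its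
image then contains a ball by `exists_ball_le`. -/
theorem continuous_limitEquiv_symm : Continuous (limitEquiv p).symm := by
  refine continuous_def.2 fun U hU => isOpen_iff_mem_nhds.2 fun l hl => ?_
  obtain ⟨V, hV, hVU⟩ := hU _ hl
  have h1 : ∀ m, ∃ k : ℕ, ∀ x, (p : ℤ_[p]) ^ k • CompletionLimit.of (level p) m
      (CompletionQ.of p (level p m) x) ∈ V := fun m => by
    obtain ⟨k, hk⟩ := hV m 0 (by
      rw [Set.mem_preimage, map_zero]
      exact V.zero_mem)
    refine ⟨k, fun x => ?_⟩
    have h2 := hk _ ⟨x, rfl⟩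
    rw [Set.mem_preimage, zero_add, intPow_smul_eq, map_smul, ← intPow_smul_eq] at h2
    exact h2
  choose k hk using h1
  obtain ⟨ρ, hρ, h⟩ := exists_ball_le (W := V.comap
    ((limitEquiv p).symm.toLinearMap.restrictScalars ℤ_[p])) (k := k) fun m x => by
      change (limitEquiv p).symm _ ∈ V
      rw [← limitEquiv_of, intPow_smul_eq, map_smul, AlgEquiv.symm_apply_apply, ← intPow_smul_eq]
      exact hk m x
  have h2 : (l + ·) '' (ball (p := p) ρ fun n => (hρ.pos n).le) ∈ 𝓝 l := by
    have h3 := (Homeomorph.addLeft l).isOpenMap.image_mem_nhds (ball_mem_nhds (p := p) hρ)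
    simpa using h3
  refine mem_of_superset h2 ?_
  rintro _ ⟨v, hv, rfl⟩
  change (limitEquiv p).symm (l + v) ∈ U
  rw [map_add]
  exact hVU _ (h hv)

end

end WideOpen

end

open WideOpen in
theorem mainTheorem3 (p : ℕ) [Fact p.Prime] :
    (∀ m : ℕ, Subalgebra.toSubmodule (level p m) = levelModule p m) ∧
    IsTopologicalRing (Dist p) ∧ ContinuousSMul ℚ_[p] (Dist p) ∧
    ∃ Θ : Env p →ₐ[ℚ_[p]] Dist p,
      (∀ (X : Gl2 p) (F : Fn p),
        HasDerivAt (fun t : ℚ_[p] => F.eval (NormedSpace.exp (t • X))) (Θ (Env.ι p X) F) 0) ∧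
      (∀ Θ' : Env p →ₐ[ℚ_[p]] Dist p,
        (∀ (X : Gl2 p) (F : Fn p),
          HasDerivAt (fun t : ℚ_[p] => F.eval (NormedSpace.exp (t • X)))
            (Θ' (Env.ι p X) F) 0) → Θ' = Θ) ∧
      ∃ Φ : ∀ m : ℕ, PadicCompletion p (level p m) →ₐ[ℤ_[p]] Dist p,
        (∀ m, Continuous (Φ m) ∧ ∀ u : level p m, Φ m (PadicCompletion.of p (level p m) u) = Θ u) ∧
        (∀ (m : ℕ) (Φ' : PadicCompletion p (level p m) →ₐ[ℤ_[p]] Dist p), Continuous Φ' →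
          (∀ u : level p m, Φ' (PadicCompletion.of p (level p m) u) = Θ u) → Φ' = Φ m) ∧
        ∃ Ψ : CompletionLimit (level p) ≃ₐ[ℚ_[p]] Dist p,
          Continuous Ψ ∧ Continuous Ψ.symm ∧
          ∀ (m : ℕ) (x : PadicCompletion p (level p m)),
            Ψ (CompletionLimit.of (level p) m (CompletionQ.of p (level p m) x)) = Φ m x := by
  refine ⟨toSubmodule_level, inferInstance, inferInstance, theta p, fun X F => ?_, fun Θ' h => ?_,
    completionHom p, fun m => ⟨continuous_completionHom p m, completionHom_of⟩,
    fun m Φ' h1 h2 => ?_, limitEquiv p, continuous_limitEquiv, continuous_limitEquiv_symm,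
    limitEquiv_of⟩
  · rw [theta_ι]
    exact hasDerivAt_eval_exp X F
  · refine Env.hom_ext fun X => WideOpen.Dist.ext fun F => (h X F).unique ?_
    rw [theta_ι]
    exact hasDerivAt_eval_exp X F
  · exact PadicCompletion.algHom_ext_of_continuous h1 (continuous_completionHom p m) fun u => by
      rw [h2, completionHom_of]
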